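/- **Setting.** Let $A_{i,j}(m)\in\mathbf C$ ($1\le i,j\le 2$, $m\in\mathbf Z$) satisfy $A_{1,1}(m)=A_{2,2}(m)=1$ ($m\neq0$), $A_{1,2}(m)=A_{2,1}(-m)$ and $A_{1,2}(m)A_{2,1}(m)\ne A_{1,1}(m)A_{2,2}(m)$ ($m\in\mathbf Z$). Let $a_i(m),Q_i$ be the generators of the Heisenberg algebra with $[a_i(m),a_j(n)]=\frac1mA_{i,j}(m)\delta_{m+n,0}$ ($m,n\ne0$), $[a_i(0),Q_j]=A_{i,j}(0)$ and all other commutators zero, acting on the direct sum of the Fock spaces of all momenta $\mu\in\mathbf C^2$ ($a_j(0)$ acts as $\mu_j$). For complex $\lambda_{i,j}(m), s_j(m), g_i$ ($1\le i\le3$, $1\le j\le2$) put $$T_1(z)=\sum_{i=1}^3g_i\Lambda_i(z),\quad \Lambda_i(z)=e^{\sum_j\lambda_{i,j}(0)a_j(0)}:\exp\Big(\sum_j\sum_{m\ne0}\lambda_{i,j}(m)a_j(m)z^{-m}\Big):,$$ $$S_j(w)=w^{\frac12A_{j,j}(0)}e^{Q_j}w^{a_j(0)}:\exp\Big(\sum_{m\neq0}s_j(m)a_j(m)w^{-m}\Big):,\qquad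 \widetilde S_j(w)=e^{-Q_j}S_j(w).$$ For vertex operators $V,W$ write $V(z)W(w)=\varphi_{V,W}(z,w):V(z)W(w):$ with $\varphi_{V,W}\in\mathbf C[[w/z]]$. Let $p_{i,j},q_{i,j}\in\mathbf C^\times$. The conditions are: * *Mutual locality*: $\varphi_{\Lambda_i,S_j}(z,w)$ (for $|z|\gg|w|$) and $\varphi_{S_j,\Lambda_i}(w,z)$ (for $|w|\gg|z|$) both converge to $\dfrac{w-z/p_{i,j}}{w-z/q_{i,j}}$ ($1\le i\le3$, $1\le j\le2$). * *Commutativity up to a total difference*: $[T_1(z),S_j(w)]=B_j(z)\big(\delta(q_{j,j}w/z)-\delta(q_{j+1,j}w/z)\big)$ for some currents $B_j(z)$ ($j=1,2$), where $\delta(z)=\sum_{m\in\mathbf Z}z^m$ and $z^\beta\delta(qw/z)=(qw)^\beta\delta(qw/z)$ for $\beta\in\mathbf C$. Complex powers of $q_{i,j}$ are formed with fixed logarithms $\log q_{i,j}$, chosen so that $\log q_{2,1}-\log q_{1,1}=\log q_{3,2}-\log q_{2,2}$ in case $q_{2,1}/q_{1,1}=q_{3,2}/q_{2,2}$. * *Symmetry*: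 $\varphi_{\widetilde S_1,\widetilde S_2}(w,z)=\varphi_{\widetilde S_2,\widetilde S_1}(w,z)$. * *Genericity*: the six $q_{i,j}$ are distinct, $|q_{j+1,j}/q_{j,j}|\neq1$ ($j=1,2$), the $A_{i,j}(0)$ are real, and $-1<A_{1,2}(0)=A_{2,1}(0)<0$. Put $r=1/(A_{1,2}(0)+1)$ if $A_{1,1}(0)\ne1$ and $r=-1/A_{1,2}(0)$ if $A_{1,1}(0)=1$, and define $x$ by $\log x=\frac1{2r}(\log q_{2,1}-\log q_{1,1})$, $x^y=e^{y\log x}$, so $x^{2r}=q_{2,1}/q_{1,1}$; put $[y]_x=\frac{x^y-x^{-y}}{x-x^{-1}}$. Case 1: $A_{1,1}(0)\ne1\ne A_{2,2}(0)$. Case 2: $A_{1,1}(0)\ne1=A_{2,2}(0)$. Case 3: $A_{1,1}(0)=A_{2,2}(0)=1$. Case 4: $A_{1,1}(0)=1\ne A_{2,2}(0)$. **Theorem.** (a) Assume all these conditions, and $B_1\neq0$, $B_2\ne0$. Then $$B_j(z)=g_j\Big(\frac{q_{j,j}}{p_{j,j}}-1\Big):\Lambda_j(z)S_j(q_{j,j}^{-1}z):\quad(j=1,2).$$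 In Case 4 the relabelling $i\mapsto4-i$ of the $\Lambda_i$ and $j\mapsto3-j$ of the $S_j$ (and $a_j$) leads to Case 2, with $r$ and $x$ formed from the relabelled data. In Cases 1, 2, 3 one has $r>1$, $|x|\ne0,1$, and the parameters are given by the formulas below up to the following transformations: 1. $\lambda_{i,j}(m)\mapsto\sigma^m\lambda_{i,j}(m)$, $q_{i,j}\mapsto\sigma q_{i,j}$, $p_{i,j}\mapsto\sigma p_{i,j}$ ($\sigma\ne0$); 2. for $m\ne0$: $s_j(m)\mapsto\alpha_j(m)s_j(m)$, $\lambda_{i,j}(m)\mapsto\lambda_{i,j}(m)\alpha_j(m)$, $A_{i,j}(m)\mapsto\alpha_i(m)^{-1}A_{i,j}(m)\alpha_j(m)$, where $\alpha_j(m)\neq0$, $\alpha_j(-m)=\alpha_j(m)^{-1}$; 3. $S_2(w)\mapsto S_2(-w)$: $s_2(m)\mapsto(-1)^ms_2(m)$, $q_{i,2}\mapsto-q_{i,2}$, $p_{i,2}\mapsto-p_{i,2}$; 4. $\lambda_{i,j}(0)\mapsto\lambda_{i,j}(0)+c_j$ for all $i$, where $\sum_kc_kA_{k,j}(0)\in2\pi\sqrt{-1}\,\mathbf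 Z$ ($j=1,2$). *All cases*: $p_{1,2}=q_{1,2}$, $p_{3,1}=q_{3,1}$, $s_j(m)=1$ ($m>0$), $A_{1,1}(m)=A_{2,2}(m)=1$, $A_{2,1}(m)=A_{1,2}(-m)$ ($m\ne0$). *Case 1*: $A_{1,1}(0)=A_{2,2}(0)=\frac{2(r-1)}r$, $A_{1,2}(0)=A_{2,1}(0)=-\frac{r-1}r$, $g_1=g_2=g_3$; $q_{i,i}=x^{i-1}$, $q_{i+1,i}=x^{2r+i-1}$, $p_{i,i}=x^{2r+i-3}$, $p_{i+1,i}=x^{i+1}$ ($i=1,2$); $A_{1,2}(m)=-\frac{[m]_x}{[2m]_x}$ ($m\neq0$), $s_j(m)=-\frac{[(r-1)m]_x[2m]_x}{[rm]_x[m]_x}$ ($m<0$); $\lambda_{i,j}(0)=\frac{2r}3\log x\cdot j$ for $j<i$ and $\frac{2r}3\log x\cdot(j-3)$ for $i\le j$; for $m\ne0$, $\frac{\lambda_{i,j}(m)}{s_j(m)}=-\frac{[rm]_x}{[3m]_x}(x-x^{-1})$ times $x^{(r+2)m}[jm]_x$ for $j<i$ and times $x^{(r-1)m}[(j-3)m]_x$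 for $i\le j$. *Case 2*: $A_{1,1}(0)=\frac{2(r-1)}r$, $A_{2,2}(0)=1$, $A_{1,2}(0)=A_{2,1}(0)=-\frac{r-1}r$, $g_1=g_2$, $g_3=[r-1]_xg_1$; $q_{i,i}=x^{i-1}$, $q_{i+1,i}=x^{2r+i-1}$, $p_{i,i}=x^{2r+i-3}$, $p_{i+1,i}=x^{-2r+5+(2r-3)i}$ ($i=1,2$); $A_{1,2}(m)=-\frac{[(r-1)m]_x}{[rm]_x}$ ($m>0$), $-\frac{[m]_x}{[2m]_x}$ ($m<0$); $s_1(m)=-\frac{[(r-1)m]_x[2m]_x}{[rm]_x[m]_x}$, $s_2(m)=-1$ ($m<0$); and, with $k_{1,1}=r$, $k_{1,2}=k_{2,2}=r-1$, $k_{2,1}=k_{3,1}=1$, $k_{3,2}=2$, $$\lambda_{i,j}(0)=\tfrac{2r}{r+1}\log x\cdot\begin{cases}k_{i,j}&(j<i)\\-k_{i,j}&(i\le j)\end{cases},\quad \frac{\lambda_{i,j}(m)}{s_j(m)}=\frac{[rm]_x}{[(r+1)m]_x}(x-x^{-1})\cdot\begin{cases}-x^{2rm}[k_{i,j}m]_x&(j<i)\\x^{(r-1)m}[k_{i,j}m]_x&(i\le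 j)\end{cases}\ (m\ne0).\tag{$*$}$$ *Case 3*: $A_{1,1}(0)=A_{2,2}(0)=1$, $A_{1,2}(0)=A_{2,1}(0)=-\frac1r$, $g_2=[r-1]_xg_1$, $g_3=g_1$; $q_{i,i}=x^{(r-1)(i-1)}$, $q_{i+1,i}=x^{r+1+(r-1)i}$, $p_{i,i}=p_{i+1,i}=x^{3r-5+(-r+3)i}$ ($i=1,2$); $A_{1,2}(m)=-\frac{[m]_x}{[rm]_x}$ ($m\neq0$); $s_1(m)=s_2(m)=-1$ ($m<0$); and $(*)$ with $k_{1,1}=k_{3,2}=r$ and all other $k_{i,j}=1$. (b) Conversely, let $r>1$ be real, fix $\log x$ with $|x|\neq0,1$, and let the parameters be given by the formulas of Case 1, 2 or 3 ($p_{1,2}=q_{1,2}$ and $p_{3,1}=q_{3,1}$ being arbitrary nonzero numbers), with logarithms such that $\log q_{j+1,j}-\log q_{j,j}=2r\log x$ ($j=1,2$). Then the conditions on the Heisenberg algebra, mutual locality, commutativity up to a total difference with the $B_j(z)$ of (a), and symmetry hold. -/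

import Mathlib

/-! ## The Heisenberg algebra on its Fock space -/

/-- The direct sum over all momenta `μ ∈ ℂ²` (the eigenvalues of `a_1(0), a_2(0)`) of the Fock
modules of the Heisenberg algebra.  Each summand is the polynomial ring in the creation operators
`a_j(-m)`, `m ≥ 1`; the variable `(j, k)` is `a_j(-(k+1))`. -/
abbrev Fock : Type := (Fin 2 → ℂ) →₀ MvPolynomial (Fin 2 × ℕ) ℂ

/-- The operator acting on the momentum `μ` summand as the scalar `f μ`, i.e. `f(a_1(0), a_2(0))`. -/
noncomputable def zeroModeFun (f : (Fin 2 → ℂ) → ℂ) : Module.End ℂ Fock :=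
  Finsupp.lsum ℂ fun μ => f μ • Finsupp.lsingle μ

/-- The operator `a_j(m)`: for `m < 0` multiplication by a variable, for `m > 0` the derivation
with `[a_i(m), a_j(-m)] = A_{i,j}(m) / m`, for `m = 0` the momentum. -/
noncomputable def heis (A : Fin 2 → Fin 2 → ℤ → ℂ) (j : Fin 2) : ℤ → Module.End ℂ Fock
  | Int.ofNat 0 => zeroModeFun fun μ => μ j
  | Int.ofNat (k + 1) => Finsupp.mapRange.linearMap
      (((k : ℂ) + 1)⁻¹ • ∑ l : Fin 2, A j l ((k : ℤ) + 1) •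
        (MvPolynomial.pderiv (R := ℂ) ((l, k) : Fin 2 × ℕ)).toLinearMap)
  | Int.negSucc k => Finsupp.mapRange.linearMap
      (LinearMap.mulLeft ℂ (MvPolynomial.X ((j, k) : Fin 2 × ℕ) : MvPolynomial (Fin 2 × ℕ) ℂ))

/-- The operator `exp (n_1 Q_1 + n_2 Q_2)`.  Since `[a_i(0), Q_j] = A_{i,j}(0)`, it shifts the
momentum `μ_i` by `∑ j, A_{i,j}(0) n_j`. -/
noncomputable def expQ (A : Fin 2 → Fin 2 → ℤ → ℂ) (n : Fin 2 → ℂ) : Module.End ℂ Fock :=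
  Finsupp.lmapDomain _ ℂ fun μ i => μ i + ∑ j, A i j 0 * n j

/-- The coefficient of `u ^ n` in the formal series `exp (∑_{m ≥ 1} D m * u ^ m)`. -/
noncomputable def expCoeff (D : ℕ → Module.End ℂ Fock) (n : ℕ) : Module.End ℂ Fock :=
  ∑ k ∈ Finset.range (n + 1), ((k.factorial : ℂ)⁻¹) •
    PowerSeries.coeff n ((PowerSeries.mk fun m => if m = 0 then 0 else D m) ^ k)

/-! ## Vertex operators -/

/-- The data of a vertex operator
`V(z) = z ^ pow * e ^ (∑ charge_j Q_j) * z ^ (∑ powA_j a_j(0)) * e ^ (∑ zero_j a_j(0))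
  * :exp (∑_j ∑_{m ≠ 0} osc_j(m) a_j(m) z ^ (-m)):`. The values `osc j 0` are not used. -/
structure VertexOp where
  charge : Fin 2 → ℂ
  pow : ℂ
  powA : Fin 2 → ℂ
  zero : Fin 2 → ℂ
  osc : Fin 2 → ℤ → ℂ

namespace VertexOp

/-- The coefficient of `z ^ k` in `exp (∑_j ∑_{m > 0} osc_j(-m) a_j(-m) z ^ m)`. -/
noncomputable def creation (A : Fin 2 → Fin 2 → ℤ → ℂ) (V : VertexOp) (k : ℕ) :
    Module.End ℂ Fock :=
  expCoeff (fun m => ∑ j, V.osc j (-(m : ℤ)) • heis A j (-(m : ℤ))) k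

/-- The coefficient of `z ^ (-l)` in `exp (∑_j ∑_{m > 0} osc_j(m) a_j(m) z ^ (-m))`. -/
noncomputable def annihilation (A : Fin 2 → Fin 2 → ℤ → ℂ) (V : VertexOp) (l : ℕ) :
    Module.End ℂ Fock :=
  expCoeff (fun m => ∑ j, V.osc j (m : ℤ) • heis A j (m : ℤ)) l

/-- The coefficient of `z ^ β` (`β ∈ ℂ`) in `z ^ (pow + ∑_j powA_j a_j(0))`. -/
noncomputable def zPow (V : VertexOp) (β : ℂ) : Module.End ℂ Fock :=
  open Classical in
  zeroModeFun fun μ => if V.pow + ∑ j, V.powA j * μ j = β then 1 else 0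

/-- The operator `exp (∑_j zero_j a_j(0))`. -/
noncomputable def expZero (V : VertexOp) : Module.End ℂ Fock :=
  zeroModeFun fun μ => Complex.exp (∑ j, V.zero j * μ j)

/-- The coefficient of `z ^ β` (`β ∈ ℂ`) in `V(z)`.  On each vector only finitely many terms of
the sum are nonzero. -/
noncomputable def mode (A : Fin 2 → Fin 2 → ℤ → ℂ) (V : VertexOp) (β : ℂ) (v : Fock) : Fock :=
  ∑ᶠ t : ℕ × ℕ, expQ A V.charge (V.expZero (V.creation A t.1 (V.annihilation A t.2
    (V.zPow (β - t.1 + t.2) v))))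

/-- The coefficient of `z ^ a * w ^ b` (`a, b ∈ ℂ`) in the normally ordered product
`:V(z) W(w):`. On each vector only finitely many terms of the sum are nonzero. -/
noncomputable def normalMode (A : Fin 2 → Fin 2 → ℤ → ℂ) (V W : VertexOp) (a b : ℂ) (v : Fock) :
    Fock :=
  ∑ᶠ t : (ℕ × ℕ) × (ℕ × ℕ),
    expQ A V.charge (expQ A W.charge (V.expZero (W.expZero
      (V.creation A t.1.1 (W.creation A t.2.1 (V.annihilation A t.1.2 (W.annihilation A t.2.2
        (V.zPow (a - t.1.1 + t.1.2) (W.zPow (b - t.2.1 + t.2.2) v)))))))))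

/-- `V(z) W(w) = φ(w/z) :V(z) W(w):` with the formal power series `φ = ∑ φ_k (w/z)^k`. On each
vector only finitely many terms of the sum are nonzero. -/
def HasOPE (A : Fin 2 → Fin 2 → ℤ → ℂ) (V W : VertexOp) (φ : ℕ → ℂ) : Prop :=
  ∀ (a b : ℂ) (v : Fock),
    V.mode A a (W.mode A b v) = ∑ᶠ k : ℕ, φ k • normalMode A V W (a + k) (b - k) v

/-- The product `exp (∑ n_j Q_j) * V(z)`. -/
def expQMul (n : Fin 2 → ℂ) (V : VertexOp) : VertexOp :=
  { V with charge := n + V.charge }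

end VertexOp

/-! ## The construction from two screening currents -/

/-- The parameters `A_{i,j}(m)`, `λ_{i,j}(m)`, `s_j(m)`, `g_i`, `p_{i,j}`, `q_{i,j}`.  All indices
start at `0`.  The values `s j 0` are not used. -/
structure Params where
  A : Fin 2 → Fin 2 → ℤ → ℂ
  lam : Fin 3 → Fin 2 → ℤ → ℂ
  s : Fin 2 → ℤ → ℂ
  g : Fin 3 → ℂ
  p : Fin 3 → Fin 2 → ℂ
  q : Fin 3 → Fin 2 → ℂ

namespace Params

/-- The conditions on the Heisenberg algebra. -/
def IsHeisenberg (P : Params) : Prop :=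
  (∀ j, ∀ m ≠ 0, P.A j j m = 1) ∧ (∀ m, P.A 0 1 m = P.A 1 0 (-m)) ∧
    ∀ m, P.A 0 1 m * P.A 1 0 m ≠ P.A 0 0 m * P.A 1 1 m

/-- The vertex operator `Λ_i(z)`. -/
def Lam (P : Params) (i : Fin 3) : VertexOp where
  charge := 0
  pow := 0
  powA := 0
  zero := fun j => P.lam i j 0
  osc := fun j m => P.lam i j m

/-- The screening current `S_j(w)`. -/
noncomputable def S (P : Params) (j : Fin 2) : VertexOp where
  charge := Pi.single j 1
  pow := P.A j j 0 / 2
  powA := Pi.single j 1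
  zero := 0
  osc := fun k m => if k = j then P.s j m else 0

/-- `S̃_j(w) = e^{-Q_j} S_j(w)`. -/
noncomputable def STilde (P : Params) (j : Fin 2) : VertexOp :=
  (P.S j).expQMul (-Pi.single j 1)

/-- The coefficient of `z ^ β` in `T_1(z) = ∑ g_i Λ_i(z)`. -/
noncomputable def TMode (P : Params) (β : ℂ) (v : Fock) : Fock :=
  ∑ i, P.g i • (P.Lam i).mode P.A β v

/-- Mutual locality: `φ_{Λ_i,S_j}(z,w)` and `φ_{S_j,Λ_i}(w,z)` converge, for `|z| ≫ |w|` and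
`|w| ≫ |z|` respectively, to the same rational function `(w - z/p_{i,j}) / (w - z/q_{i,j})`. -/
def MutualLocality (P : Params) : Prop :=
  ∀ i j, ∃ φ ψ : ℕ → ℂ,
    VertexOp.HasOPE P.A (P.Lam i) (P.S j) φ ∧ VertexOp.HasOPE P.A (P.S j) (P.Lam i) ψ ∧
    (∃ R : ℝ, 0 < R ∧ ∀ z w : ℂ, R * ‖w‖ < ‖z‖ →
      HasSum (fun n => φ n * (w / z) ^ n) ((w - z / P.p i j) / (w - z / P.q i j))) ∧
    (∃ R : ℝ, 0 < R ∧ ∀ z w : ℂ, R * ‖z‖ < ‖w‖ →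
      HasSum (fun n => ψ n * (z / w) ^ n) ((w - z / P.p i j) / (w - z / P.q i j)))

/-- A choice of logarithms `ℓ_{i,j}` of the `q_{i,j}`, giving a meaning to their complex powers.
The powers of the ratios `q_{2,1}/q_{1,1}` and `q_{3,2}/q_{2,2}` that it defines have to agree in
case the ratios agree. -/
def IsLogBranch (P : Params) (ℓ : Fin 3 → Fin 2 → ℂ) : Prop :=
  (∀ i j, Complex.exp (ℓ i j) = P.q i j) ∧
    (P.q 1 0 / P.q 0 0 = P.q 2 1 / P.q 1 1 → ℓ 1 0 - ℓ 0 0 = ℓ 2 1 - ℓ 1 1)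

/-- Commutativity up to a total difference:
`[T_1(z), S_j(w)] = B_j(z) (δ(q_{j,j} w/z) - δ(q_{j+1,j} w/z))`.
Here `B j c` is the coefficient of `z ^ c` (`c ∈ ℂ`) in `B_j(z)`, and for `β ∈ ℂ` one has
`z ^ β δ(q w/z) = (q w) ^ β δ(q w/z)`, so that the coefficient of `z ^ n w ^ b` in
`B_j(z) δ(q w/z)` is `q ^ b B_{j, n + b}`; the power is `q ^ b = exp (b ℓ)`. -/
def Commutativity (P : Params) (ℓ : Fin 3 → Fin 2 → ℂ) (B : Fin 2 → ℂ → Fock → Fock) : Prop :=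
  ∀ (j : Fin 2) (n : ℤ) (b : ℂ) (v : Fock),
    P.TMode n ((P.S j).mode P.A b v) - (P.S j).mode P.A b (P.TMode n v) =
      (Complex.exp (b * ℓ j.castSucc j) - Complex.exp (b * ℓ j.succ j)) • B j (n + b) v

/-- Symmetry: `φ_{S̃_1,S̃_2}(w,z) = φ_{S̃_2,S̃_1}(w,z)`. -/
def Symmetry (P : Params) : Prop :=
  ∃ φ : ℕ → ℂ, VertexOp.HasOPE P.A (P.STilde 0) (P.STilde 1) φ ∧
    VertexOp.HasOPE P.A (P.STilde 1) (P.STilde 0) φ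

/-- The genericity conditions; the `A_{i,j}(0)` are real. -/
def Generic (P : Params) : Prop :=
  (∀ i j, P.p i j ≠ 0 ∧ P.q i j ≠ 0) ∧
  (Function.Injective fun t : Fin 3 × Fin 2 => P.q t.1 t.2) ∧
  (∀ j : Fin 2, ‖P.q j.succ j / P.q j.castSucc j‖ ≠ 1) ∧
  (∀ i j, (P.A i j 0).im = 0) ∧
  P.A 0 1 0 = P.A 1 0 0 ∧ -1 < (P.A 0 1 0).re ∧ (P.A 0 1 0).re < 0

/-- The coefficient of `z ^ c` in
`g_j (q_{j,j}/p_{j,j} - 1) :Λ_j(z) S_j(q_{j,j}⁻¹ z):`, where `q_{j,j} ^ b = exp (b ℓ_{j,j})`. -/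
noncomputable def current (P : Params) (ℓ : Fin 3 → Fin 2 → ℂ) (j : Fin 2) (c : ℂ) (v : Fock) :
    Fock :=
  (P.g j.castSucc * (P.q j.castSucc j / P.p j.castSucc j - 1)) •
    ∑ᶠ n : ℤ, Complex.exp (-(c - n) * ℓ j.castSucc j) •
      VertexOp.normalMode P.A (P.Lam j.castSucc) (P.S j) n (c - n) v

/-! ### Transformations of the parameters -/

/-- Rearranging the indices. -/
def relabel (P : Params) (π : Equiv.Perm (Fin 3)) (κ : Equiv.Perm (Fin 2)) : Params where
  A := fun i j => P.A (κ i) (κ j)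
  lam := fun i j => P.lam (π i) (κ j)
  s := fun j => P.s (κ j)
  g := fun i => P.g (π i)
  p := fun i j => P.p (π i) (κ j)
  q := fun i j => P.q (π i) (κ j)

/-- Scaling the variable `z` of the `Λ_i(z)`. -/
noncomputable def scaleVar (P : Params) (σ : ℂ) : Params where
  A := P.A
  lam := fun i j m => σ ^ m * P.lam i j m
  s := P.s
  g := P.g
  p := fun i j => σ * P.p i j
  q := fun i j => σ * P.q i j

/-- Scaling the free fields. -/
noncomputable def scaleBoson (P : Params) (α : Fin 2 → ℤ → ℂ) : Params where
  A := fun i j m => if m = 0 then P.A i j m else (α i m)⁻¹ * P.A i j m * α j m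
  lam := fun i j m => if m = 0 then P.lam i j m else P.lam i j m * α j m
  s := fun j m => α j m * P.s j m
  g := P.g
  p := P.p
  q := P.q

/-- Changing the variable `w` of the second screening current only, `S_2(w) ↦ S_2(ε w)`. -/
noncomputable def scaleSecond (P : Params) (ε : ℂ) : Params where
  A := P.A
  lam := P.lam
  s := fun j m => if j = 1 then ε ^ m * P.s j m else P.s j m
  g := P.g
  p := fun i j => if j = 1 then ε * P.p i j else P.p i j
  q := fun i j => if j = 1 then ε * P.q i j else P.q i j

/-- Multiplying all the `Λ_i(z)` by the same operator `exp (∑_j c_j a_j(0))`. -/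
def shiftZero (P : Params) (c : Fin 2 → ℂ) : Params where
  A := P.A
  lam := fun i j m => if m = 0 then P.lam i j m + c j else P.lam i j m
  s := P.s
  g := P.g
  p := P.p
  q := P.q

/-! ### The explicit solutions -/

/-- `x ^ y = exp (y ξ)`, where `ξ = log x`. -/
noncomputable def xpow (ξ y : ℂ) : ℂ := Complex.exp (y * ξ)

/-- `[y]_x = (x ^ y - x ^ (-y)) / (x - x⁻¹)`, where `ξ = log x`. -/
noncomputable def xnum (ξ y : ℂ) : ℂ := (xpow ξ y - xpow ξ (-y)) / (xpow ξ 1 - xpow ξ (-1))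

/-- The part of the formulas that is common to all cases. -/
def Common (P : Params) : Prop :=
  P.p 0 1 = P.q 0 1 ∧ P.p 2 0 = P.q 2 0 ∧ (∀ j, ∀ m > 0, P.s j m = 1) ∧
  (∀ j, ∀ m ≠ 0, P.A j j m = 1) ∧ (∀ m ≠ 0, P.A 1 0 m = P.A 0 1 (-m))

/-- The formulas of Case 1, where `ξ = log x`. -/
def Solution1 (r : ℝ) (ξ : ℂ) (P : Params) : Prop :=
  P.Common ∧
  (∀ j, P.A j j 0 = 2 * (r - 1) / r) ∧ P.A 0 1 0 = -((r - 1) / r) ∧ P.A 1 0 0 = -((r - 1) / r) ∧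
  P.g 0 = P.g 1 ∧ P.g 1 = P.g 2 ∧
  (∀ j : Fin 2, let i : ℂ := (j : ℕ) + 1
    P.q j.castSucc j = xpow ξ (i - 1) ∧ P.q j.succ j = xpow ξ (2 * r + i - 1) ∧
    P.p j.castSucc j = xpow ξ (2 * r + i - 3) ∧ P.p j.succ j = xpow ξ (i + 1)) ∧
  (∀ m : ℤ, m ≠ 0 → P.A 0 1 m = -(xnum ξ m / xnum ξ (2 * m))) ∧
  (∀ j, ∀ m : ℤ, m < 0 →
    P.s j m = -(xnum ξ ((r - 1) * m) * xnum ξ (2 * m) / (xnum ξ (r * m) * xnum ξ m))) ∧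
  (∀ (i : Fin 3) (j : Fin 2), let j' : ℂ := (j : ℕ) + 1
    P.lam i j 0 = 2 * r / 3 * ξ * (if (j : ℕ) < (i : ℕ) then j' else j' - 3) ∧
    ∀ m : ℤ, m ≠ 0 → P.lam i j m = P.s j m *
      (-(xnum ξ (r * m) / xnum ξ (3 * m)) * (xpow ξ 1 - xpow ξ (-1)) *
        (if (j : ℕ) < (i : ℕ) then xpow ξ ((r + 2) * m) * xnum ξ (j' * m)
          else xpow ξ ((r - 1) * m) * xnum ξ ((j' - 3) * m))))

/-- The formulas for `λ_{i,j}` in Cases 2 and 3.  In the `i`-th row and `j`-th column, the matrix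
`k` holds the number `k_{i,j}` such that
`λ_{i,j}(0) = ±k_{i,j} 2r/(r+1) log x`, with the sign `-` for `i ≤ j` and `+` for `j < i`. -/
def LamFormula (r : ℝ) (ξ : ℂ) (k : Matrix (Fin 3) (Fin 2) ℂ) (P : Params) : Prop :=
  ∀ (i : Fin 3) (j : Fin 2),
    P.lam i j 0 = 2 * r / (r + 1) * ξ * (if (j : ℕ) < (i : ℕ) then k i j else -k i j) ∧
    ∀ m : ℤ, m ≠ 0 → P.lam i j m = P.s j m *
      (xnum ξ (r * m) / xnum ξ ((r + 1) * m) * (xpow ξ 1 - xpow ξ (-1)) *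
        (if (j : ℕ) < (i : ℕ) then -(xpow ξ (2 * r * m) * xnum ξ (k i j * m))
          else xpow ξ ((r - 1) * m) * xnum ξ (k i j * m)))

/-- The formulas of Case 2, where `ξ = log x`. -/
def Solution2 (r : ℝ) (ξ : ℂ) (P : Params) : Prop :=
  P.Common ∧
  P.A 0 0 0 = 2 * (r - 1) / r ∧ P.A 1 1 0 = 1 ∧
  P.A 0 1 0 = -((r - 1) / r) ∧ P.A 1 0 0 = -((r - 1) / r) ∧
  P.g 0 = P.g 1 ∧ P.g 2 = xnum ξ (r - 1) * P.g 0 ∧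
  (∀ j : Fin 2, let i : ℂ := (j : ℕ) + 1
    P.q j.castSucc j = xpow ξ (i - 1) ∧ P.q j.succ j = xpow ξ (2 * r + i - 1) ∧
    P.p j.castSucc j = xpow ξ (2 * r + i - 3) ∧
    P.p j.succ j = xpow ξ (-2 * r + 5 + (2 * r - 3) * i)) ∧
  (∀ m : ℤ, 0 < m → P.A 0 1 m = -(xnum ξ ((r - 1) * m) / xnum ξ (r * m))) ∧
  (∀ m : ℤ, m < 0 → P.A 0 1 m = -(xnum ξ m / xnum ξ (2 * m))) ∧
  (∀ m : ℤ, m < 0 →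
    P.s 0 m = -(xnum ξ ((r - 1) * m) * xnum ξ (2 * m) / (xnum ξ (r * m) * xnum ξ m)) ∧
    P.s 1 m = -1) ∧
  P.LamFormula r ξ !![(r : ℂ), r - 1; 1, r - 1; 1, 2]

/-- The formulas of Case 3, where `ξ = log x`. -/
def Solution3 (r : ℝ) (ξ : ℂ) (P : Params) : Prop :=
  P.Common ∧
  (∀ j, P.A j j 0 = 1) ∧ P.A 0 1 0 = -(1 / r) ∧ P.A 1 0 0 = -(1 / r) ∧
  P.g 1 = xnum ξ (r - 1) * P.g 0 ∧ P.g 2 = P.g 0 ∧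
  (∀ j : Fin 2, let i : ℂ := (j : ℕ) + 1
    P.q j.castSucc j = xpow ξ ((r - 1) * (i - 1)) ∧
    P.q j.succ j = xpow ξ (r + 1 + (r - 1) * i) ∧
    P.p j.castSucc j = xpow ξ (3 * r - 5 + (-r + 3) * i) ∧
    P.p j.succ j = xpow ξ (3 * r - 5 + (-r + 3) * i)) ∧
  (∀ m : ℤ, m ≠ 0 → P.A 0 1 m = -(xnum ξ m / xnum ξ (r * m))) ∧
  (∀ j, ∀ m : ℤ, m < 0 → P.s j m = -1) ∧
  P.LamFormula r ξ !![(r : ℂ), 1; 1, 1; 1, r]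

/-- The number `r` attached to a set of parameters. -/
noncomputable def rOf (P : Params) : ℝ :=
  open Classical in
  if P.A 0 0 0 = 1 then -(1 / (P.A 0 1 0).re) else 1 / ((P.A 0 1 0).re + 1)

/-- `ξ = log x` attached to a set of parameters: `x ^ (2 r) = q_{2,1} / q_{1,1}`. -/
noncomputable def xiOf (P : Params) (ℓ : Fin 3 → Fin 2 → ℂ) : ℂ :=
  (ℓ 1 0 - ℓ 0 0) / (2 * P.rOf)

/-- The parameters are given by the formulas of Cases 1, 2, 3, according to the values of
`A_{1,1}(0)` and `A_{2,2}(0)`, up to scaling `z`, scaling the free fields, the sign change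
`S_2(w) ↦ S_2(-w)`, and the ambiguity in the logarithms
`∑_k λ_{i,k}(0) A_{k,j}(0) = log (q_{i,j} / p_{i,j})`. -/
def IsExplicit (P : Params) (ℓ : Fin 3 → Fin 2 → ℂ) : Prop :=
  1 < P.rOf ∧ (P.xiOf ℓ).re ≠ 0 ∧
  ∃ (σ ε : ℂ) (α : Fin 2 → ℤ → ℂ) (c : Fin 2 → ℂ),
    σ ≠ 0 ∧ (ε = 1 ∨ ε = -1) ∧
    (∀ j, ∀ m ≠ 0, α j m ≠ 0) ∧ (∀ j, ∀ m > 0, α j (-m) = (α j m)⁻¹) ∧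
    (∀ j, ∃ n : ℤ, ∑ k, c k * P.A k j 0 = 2 * Real.pi * Complex.I * n) ∧
    let P' := (((P.scaleVar σ).scaleSecond ε).scaleBoson α).shiftZero c
    (P.A 0 0 0 ≠ 1 → P.A 1 1 0 ≠ 1 → Solution1 P.rOf (P.xiOf ℓ) P') ∧
    (P.A 0 0 0 ≠ 1 → P.A 1 1 0 = 1 → Solution2 P.rOf (P.xiOf ℓ) P') ∧
    (P.A 0 0 0 = 1 → P.A 1 1 0 = 1 → Solution3 P.rOf (P.xiOf ℓ) P')

end Params

/-! The conditions on operators are first translated into equations for numbers, the system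
`Params.Eqs`; the rest is algebra with that system.

Translation. A formal exponential `X = exp D` with noncommuting coefficients is handled through `u
X' = u D' X` and `X(0) = 1`, which determine `X`. Moving an annihilation exponential past a creation
exponential produces the scalar series `φ = exp (contr)`, so `V(z) W(w)` equals a zero mode constant
times `φ(w/z) :V(z) W(w):` (`hasOPE_opeSeries`), and the vacuum shows that the expansion is unique
(`HasOPE.unique`). Since `log ((1 - p u) / (1 - q u)) = ∑ (q ^ m - p ^ m) u ^ m / m`, mutual
locality becomes one equation for each `m ≠ 0`, the two orders of the product giving the two signs
of `m`, and one for the zero modes (`mutualLocality_iff`). The two expansions of the same rational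
function differ by a delta function at its pole (`commutator_eq`), on whose support the product
`:Λ_i(z) S_j(w):` fuses into a single vertex operator (`fusion`). Hence `[T_1(z), S_j(w)]` is a sum
of three delta functions at distinct points, and a Vandermonde argument separates them: the residue
not present in the total difference vanishes, and the other two are `B_j` and `-B_j`. A vertex
operator determines its exponents because the matrices `A(m)` are nondegenerate (`eq_of_mode_eq`),
so the equality of the two fused operators says that `Λ_j` and `Λ_{j+1}` differ only in the
oscillators and zero mode of `a_j`, by a known amount (`eqs_of_conditions`). All these steps can be
reversed (`conditions_of_eqs`).

Solving the system. Subtracting the locality equations of `Λ_j` and `Λ_{j+1}` eliminates `λ`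
(`Eqs.gram`). What remains expresses `c_j(m) = s_j(m) s_j(-m)` and `d(m) = s_1(m) A_{1,2}(m)
s_2(-m)` through the `p`, `q`. These numbers are even in `m`, for `d` by symmetry, and an identity
`D (y - x) = u - v` that survives the inversion of all of `x, y, u, v` forces `u = v` or `u v = x y`
(`mul_eq_mul_of_even`). Together with the zero mode equations, in which `exp (t L) = 1` with `t`
real forces `t = 0` because `Re L ≠ 0`, this yields `Params.Relations`: all the `p`, `q` that matter
are expressed by `q_{1,1}`, `L = log (q_{2,1} / q_{1,1})` and `A(0)`, up to the sign of `q_{2,2}`,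
and each `A_{j,j}(0)` is `1` or `-2 A_{1,2}(0)`. This dichotomy is the origin of the four cases.

Once `p`, `q` and `A(0)` are known, `c` and `d` are determined, and `λ_{i,j}(m) / s_j(m)` solves a
linear `2 × 2` system with determinant `c_1 c_2 - d ^ 2`. These quantities are invariant under
scaling of the free fields; a `Blueprint` records them. That the explicit formulas form a blueprint
is, for `m ≠ 0`, a set of rational identities in `X = x ^ m` and `Y = x ^ (r m)`. The same blueprint
serves both directions: uniqueness (`Eqs.follows`, `Eqs.normalize`) and the converse
(`Follows.eqs`). Case 4 is carried to Case 2 by reversing the order of all indices, under which the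
system is stable. -/

/-! ## Exponentials of power series with noncommuting coefficients -/

namespace FormalExp

open PowerSeries Finset

variable {R : Type*} [Ring R] [Algebra ℂ R]

/-- The Euler operator `u d/du`. -/
noncomputable def euler (f : PowerSeries R) : PowerSeries R :=
  PowerSeries.mk fun n => (n : ℂ) • coeff n f

@[simp] lemma coeff_euler (f : PowerSeries R) (n : ℕ) :
    coeff n (euler f) = (n : ℂ) • coeff n f := by simp [euler]

lemma euler_add (f g : PowerSeries R) : euler (f + g) = euler f + euler g := by
  ext n; simp

lemma euler_sub (f g : PowerSeries R) : euler (f - g) = euler f - euler g := by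
  ext n; simp [smul_sub]

lemma euler_C_mul (a : R) (f : PowerSeries R) : euler (C a * f) = C a * euler f := by
  ext n; simp [coeff_C_mul]

lemma euler_mul_C (a : R) (f : PowerSeries R) : euler (f * C a) = euler f * C a := by
  ext n; simp [coeff_mul_C]

lemma euler_mul (f g : PowerSeries R) : euler (f * g) = euler f * g + f * euler g := by
  ext n
  simp only [coeff_euler, coeff_mul, map_add, Finset.smul_sum, ← Finset.sum_add_distrib]
  refine Finset.sum_congr rfl fun x hx => ?_
  rw [HasAntidiagonal.mem_antidiagonal] at hx
  rw [← hx, Nat.cast_add, add_smul]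
  simp

lemma euler_X_pow (m : ℕ) : euler ((X : PowerSeries R) ^ m) = (m : ℂ) • X ^ m := by
  ext n
  rw [coeff_euler, coeff_smul, coeff_X_pow]
  split_ifs with h
  · rw [h]
  · simp

/-- `X` is the exponential of `∑_{m ≥ 1} D_m u ^ m`. -/
structure IsExp (D X : PowerSeries R) : Prop where
  zero : coeff 0 X = 1
  euler_eq : euler X = euler D * X

/-- `euler D` has no constant term, so the equation expresses `n Y_n` through the `Y_k` with `k <
n`, and `n` is invertible. -/
lemma eq_of_euler_eq {D Y Z : PowerSeries R} (hY : euler Y = euler D * Y)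
    (hZ : euler Z = euler D * Z) (h : coeff 0 Y = coeff 0 Z) : Y = Z := by
  ext n
  induction n using Nat.strong_induction_on with
  | _ n ih =>
    rcases Nat.eq_zero_or_pos n with rfl | hn
    · exact h
    have h1 := congrArg (coeff n) hY
    have h2 := congrArg (coeff n) hZ
    rw [coeff_mul] at h1 h2
    have h3 : (n : ℂ) • coeff n Y = (n : ℂ) • coeff n Z := by
      rw [← coeff_euler, ← coeff_euler, h1, h2]
      refine Finset.sum_congr rfl fun x hx => ?_
      rw [HasAntidiagonal.mem_antidiagonal] at hx
      rcases Nat.eq_zero_or_pos x.1 with h0 | h0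
      · simp [h0]
      · rw [ih x.2 (by omega)]
    have hn' : (n : ℂ) ≠ 0 := by exact_mod_cast hn.ne'
    exact smul_right_injective R hn' h3

lemma IsExp.unique {D Y Z : PowerSeries R} (hY : IsExp D Y) (hZ : IsExp D Z) : Y = Z :=
  eq_of_euler_eq hY.euler_eq hZ.euler_eq (hY.zero.trans hZ.zero.symm)

lemma IsExp.congr {D D' Y : PowerSeries R} (hY : IsExp D Y)
    (h : ∀ n ≠ 0, coeff n D = coeff n D') : IsExp D' Y := by
  refine ⟨hY.zero, ?_⟩
  rw [hY.euler_eq]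
  congr 1
  ext n
  rcases eq_or_ne n 0 with rfl | hn
  · simp
  · simp [h n hn]

/-- `a Y` and `Y a` satisfy the same Euler equation with the same constant term. -/
lemma IsExp.commute_coeff {D Y : PowerSeries R} (hY : IsExp D Y) {a : R}
    (h : ∀ n ≠ 0, Commute a (coeff n D)) (n : ℕ) : Commute a (coeff n Y) := by
  have hD : C a * euler D = euler D * C a := by
    ext n
    rw [coeff_C_mul, coeff_mul_C, coeff_euler]
    rcases eq_or_ne n 0 with rfl | hn
    · simp
    · rw [mul_smul_comm, smul_mul_assoc, (h n hn).eq]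
  have : C a * Y = Y * C a := by
    refine eq_of_euler_eq (D := D) ?_ ?_ ?_
    · rw [euler_C_mul, hY.euler_eq, ← mul_assoc, hD, mul_assoc]
    · rw [euler_mul_C, hY.euler_eq, mul_assoc]
    · rw [coeff_C_mul, coeff_mul_C, hY.zero, mul_one, one_mul]
  have h2 := congrArg (coeff n) this
  rwa [coeff_C_mul, coeff_mul_C] at h2

lemma IsExp.commute_coeff_coeff {D Y D' Y' : PowerSeries R} (hY : IsExp D Y) (hY' : IsExp D' Y')
    (h : ∀ m ≠ 0, ∀ n ≠ 0, Commute (coeff m D) (coeff n D')) (m n : ℕ) :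
    Commute (coeff m Y) (coeff n Y') :=
  hY'.commute_coeff (fun n hn => (hY.commute_coeff (fun m hm => (h m hm n hn).symm) m).symm) n

lemma commute_of_coeff {R : Type*} [Ring R] {Y Z : PowerSeries R} (h : ∀ m n, Commute (coeff m Y) (coeff n Z)) :
    Y * Z = Z * Y := by
  ext n
  rw [coeff_mul, coeff_mul, ← Finset.Nat.sum_antidiagonal_swap]
  exact Finset.sum_congr rfl fun x _ => (h _ _).eq

lemma IsExp.mul {D Y D' Y' : PowerSeries R} (hY : IsExp D Y) (hY' : IsExp D' Y')
    (h : ∀ m ≠ 0, ∀ n ≠ 0, Commute (coeff m D) (coeff n D')) : IsExp (D + D') (Y * Y') := by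
  refine ⟨?_, ?_⟩
  · rw [coeff_mul]
    simp [hY.zero, hY'.zero]
  · have hc : Y * euler D' = euler D' * Y := by
      refine commute_of_coeff fun m n => ?_
      rw [coeff_euler]
      rcases eq_or_ne n 0 with rfl | hn
      · simp
      · exact (hY.commute_coeff (fun m hm => (h m hm n hn).symm) m).symm.smul_right _
    rw [euler_mul, hY.euler_eq, hY'.euler_eq, euler_add, add_mul, mul_assoc, ← mul_assoc Y, hc,
      mul_assoc]

lemma IsExp.rescale {D Y : PowerSeries R} (hY : IsExp D Y) (q : ℂ) :
    IsExp (PowerSeries.mk fun n => q ^ n • coeff n D)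
      (PowerSeries.mk fun n => q ^ n • coeff n Y) := by
  refine ⟨by simp [hY.zero], ?_⟩
  ext n
  have h := congrArg (coeff n) hY.euler_eq
  rw [coeff_mul] at h ⊢
  rw [coeff_euler] at h
  rw [coeff_euler, coeff_mk, smul_comm, h, Finset.smul_sum]
  refine Finset.sum_congr rfl fun x hx => ?_
  rw [HasAntidiagonal.mem_antidiagonal] at hx
  simp only [coeff_euler, coeff_mk, smul_mul_assoc, mul_smul_comm]
  rw [← hx, pow_add, mul_smul, smul_comm (x.1 : ℂ)]
  simp only [smul_comm (q ^ x.2)]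

/-- The coefficients of the exponential series. -/
noncomputable def expSeries (D : ℕ → R) : PowerSeries R := PowerSeries.mk fun n =>
  ∑ k ∈ Finset.range (n + 1), ((k.factorial : ℂ)⁻¹) •
    PowerSeries.coeff n ((PowerSeries.mk fun m => if m = 0 then 0 else D m) ^ k)

lemma coeff_pow_eq_zero {R : Type*} [Ring R] {P : PowerSeries R} (hP : coeff 0 P = 0) {n k : ℕ} (h : n < k) :
    coeff n (P ^ k) = 0 := by
  induction k generalizing n with
  | zero => omega
  | succ k ih =>
    rw [pow_succ', coeff_mul]
    refine Finset.sum_eq_zero fun x hx => ?_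
    rw [HasAntidiagonal.mem_antidiagonal] at hx
    rcases Nat.eq_zero_or_pos x.1 with h0 | h0
    · rw [h0, hP, zero_mul]
    · rw [ih (by omega), mul_zero]

lemma euler_pow_succ {P : PowerSeries R} (hP : P * euler P = euler P * P) (k : ℕ) :
    euler (P ^ (k + 1)) = ((k + 1 : ℕ) : ℂ) • (euler P * P ^ k) := by
  induction k with
  | zero => simp
  | succ k ih =>
    rw [pow_succ' P (k + 1), euler_mul, ih, mul_smul_comm, ← mul_assoc P, hP, mul_assoc,
      ← pow_succ', Nat.cast_succ (k + 1), add_smul, one_smul, add_comm]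

lemma isExp_expSeries {D : ℕ → R} (h : ∀ m ≠ 0, ∀ n ≠ 0, Commute (D m) (D n)) :
    IsExp (PowerSeries.mk D) (expSeries D) := by
  set P : PowerSeries R := PowerSeries.mk fun m => if m = 0 then 0 else D m with hPdef
  have hP0 : coeff 0 P = 0 := by simp [P]
  have hPP : P * euler P = euler P * P := by
    refine commute_of_coeff fun m n => ?_
    rw [coeff_euler]
    refine Commute.smul_right ?_ _
    rcases eq_or_ne m 0 with rfl | hm
    · simp [P]
    rcases eq_or_ne n 0 with rfl | hn
    · simp [P]
    simpa [P, hm, hn] using h m hm n hn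
  -- `P ^ k` starts in degree `k`, so the truncation of the exponential sum may be moved beyond `n`.
  have key (n N : ℕ) (hN : n ≤ N) : coeff n (expSeries D) =
      ∑ k ∈ Finset.range (N + 1), ((k.factorial : ℂ)⁻¹) • coeff n (P ^ k) := by
    rw [expSeries, coeff_mk]
    refine Finset.sum_subset (by simpa using hN) fun k _ hk => ?_
    rw [coeff_pow_eq_zero hP0 (by simpa using hk), smul_zero]
  have main : IsExp P (expSeries D) := by
    refine ⟨by simp [expSeries], ?_⟩
    ext n
    -- One extra term is taken on the left: after the term `k = 0` is split off, the shifted sum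
    -- matches the unshifted one through `euler (P ^ (k + 1)) / (k + 1)! = euler P * P ^ k / k!`.
    rw [coeff_euler, key n (n + 1) (by omega), Finset.sum_range_succ', coeff_mul, smul_add,
      Finset.smul_sum]
    have h0 : (n : ℂ) • ((Nat.factorial 0 : ℂ)⁻¹ • coeff n (P ^ 0)) = 0 := by
      rw [pow_zero, coeff_one]
      split_ifs with hn
      · simp [hn]
      · simp
    rw [h0, add_zero]
    have h1 (k : ℕ) : (n : ℂ) • ((Nat.factorial (k + 1) : ℂ)⁻¹ • coeff n (P ^ (k + 1))) =
        ∑ x ∈ antidiagonal n, coeff x.1 (euler P) *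
          (((k.factorial : ℂ)⁻¹) • coeff x.2 (P ^ k)) := by
      have hk : ((k : ℂ) + 1) ≠ 0 := by exact_mod_cast Nat.succ_ne_zero k
      rw [smul_comm, ← coeff_euler, euler_pow_succ hPP, coeff_smul, coeff_mul, smul_smul,
        Nat.factorial_succ, Finset.smul_sum]
      refine Finset.sum_congr rfl fun x _ => ?_
      rw [mul_smul_comm]
      congr 1
      push_cast
      field_simp
    simp only [h1]
    rw [Finset.sum_comm]
    refine Finset.sum_congr rfl fun x hx => ?_
    rw [HasAntidiagonal.mem_antidiagonal] at hx
    rw [← Finset.mul_sum, ← key x.2 n (by omega)]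
  exact main.congr fun n hn => by simp [P, hn]

/-- If `[a, D_n] = κ δ_{n,m}` then `[a, exp D] = κ u ^ m exp D`. -/
lemma IsExp.C_mul_eq {D Y : PowerSeries R} (hY : IsExp D Y) {a : R} {m : ℕ} (hm : m ≠ 0) {κ : ℂ}
    (h : ∀ n ≠ 0, a * coeff n D = coeff n D * a + if n = m then κ • 1 else 0) :
    C a * Y = Y * C a + κ • (X ^ m * Y) := by
  have hD : C a * euler D = euler D * C a + (κ * m) • X ^ m := by
    ext n
    rw [map_add, coeff_C_mul, coeff_mul_C, coeff_euler, coeff_smul, coeff_X_pow]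
    rcases eq_or_ne n 0 with rfl | hn
    · simp [hm.symm]
    · rw [mul_smul_comm, smul_mul_assoc, h n hn, smul_add]
      split_ifs with hnm
      · rw [hnm, smul_smul, mul_comm κ]
      · simp
  have hX (f : PowerSeries R) : f * X ^ m = X ^ m * f := (commute_X_pow f m).eq
  have hX (f : PowerSeries R) : f * X ^ m = X ^ m * f := (commute_X_pow f m).eq
  -- The defect again satisfies the Euler equation for `D`, now with constant term `0`, hence it
  -- vanishes.
  have : C a * Y - Y * C a - κ • (X ^ m * Y) = 0 := by
    refine eq_of_euler_eq (D := D) ?_ (by ext n; simp) ?_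
    · have hs (f : PowerSeries R) : euler (κ • f) = κ • euler f := by
        ext n; simp only [coeff_euler, coeff_smul, smul_comm κ]
      rw [euler_sub, euler_sub, euler_C_mul, euler_mul_C, hs, euler_mul, hY.euler_eq, ← mul_assoc,
        hD, euler_X_pow]
      simp only [mul_sub, add_mul, smul_add, smul_mul_assoc, mul_smul_comm, smul_smul]
      rw [← mul_assoc (X ^ m), ← hX (euler D)]
      simp only [mul_assoc]
      abel
    · rw [map_sub, map_sub, coeff_C_mul, coeff_mul_C, coeff_smul, coeff_X_pow_mul', hY.zero]
      simp [hm]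
  rw [sub_sub, sub_eq_zero] at this
  exact this

lemma IsExp.mul_coeff {D Y : PowerSeries R} (hY : IsExp D Y) {a : R} {m : ℕ} (hm : m ≠ 0) {κ : ℂ}
    (h : ∀ n ≠ 0, a * coeff n D = coeff n D * a + if n = m then κ • 1 else 0) (n : ℕ) :
    a * coeff n Y = coeff n Y * a + κ • (if m ≤ n then coeff (n - m) Y else 0) := by
  have h2 := congrArg (coeff n) (hY.C_mul_eq hm h)
  rwa [map_add, coeff_C_mul, coeff_mul_C, coeff_smul, coeff_X_pow_mul'] at h2

lemma IsExp.coeff_mul' {D Y : PowerSeries R} (hY : IsExp D Y) {a : R} {m : ℕ} (hm : m ≠ 0) {κ : ℂ}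
    (h : ∀ n ≠ 0, coeff n D * a = a * coeff n D + if m = n then κ • 1 else 0) (n : ℕ) :
    coeff n Y * a = a * coeff n Y + κ • (if m ≤ n then coeff (n - m) Y else 0) := by
  rw [hY.mul_coeff hm (κ := -κ) (fun n hn => ?_) n, neg_smul, neg_add_cancel_right]
  rw [h n hn, add_assoc]
  by_cases h : n = m
  · simp [h]
  · simp [h, Ne.symm h]

/-- If the `D_n` commute, then `n X_n = ∑_{i + j = n} X_i (j D_j)`. -/
lemma IsExp.coeff_smul_eq {D Y : PowerSeries R} (hY : IsExp D Y)
    (h : ∀ m ≠ 0, ∀ n ≠ 0, Commute (coeff m D) (coeff n D)) (n : ℕ) :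
    (n : ℂ) • coeff n Y = ∑ x ∈ antidiagonal n, coeff x.1 Y * ((x.2 : ℂ) • coeff x.2 D) := by
  have h1 := congrArg (coeff n) hY.euler_eq
  rw [commute_of_coeff (fun i j => ?_), coeff_mul, coeff_euler] at h1
  · simpa only [coeff_euler] using h1
  · rw [coeff_euler]
    rcases eq_or_ne i 0 with rfl | hi
    · simp
    · exact (hY.commute_coeff (fun m hm => h i hi m hm) j).smul_left _

/-- The product of an exponential of annihilators and an exponential of creators. -/
lemma IsExp.coeff_mul_coeff {D Y D' Y' : PowerSeries R} {κ φ : PowerSeries ℂ} (hY : IsExp D Y)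
    (hY' : IsExp D' Y') (hφ : IsExp κ φ)
    (h : ∀ m ≠ 0, ∀ n ≠ 0, coeff m D * coeff n D' =
      coeff n D' * coeff m D + if n = m then coeff m κ • 1 else 0) (l k : ℕ) :
    coeff l Y * coeff k Y' = ∑ x ∈ antidiagonal l,
      coeff x.1 φ • ((if x.1 ≤ k then coeff (k - x.1) Y' else 0) * coeff x.2 Y) := by
  -- Series in two variables: an outer `u` for the annihilators and an inner `v` for the creators.
  -- `up f` is `f(u)`, `C Y'` is `Y'(v)`, and `diag f` is the central series `f(u v)`.
  let up (f : PowerSeries R) : PowerSeries (PowerSeries R) := PowerSeries.mk fun n => C (coeff n f)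
  let diag (f : PowerSeries ℂ) : PowerSeries (PowerSeries R) :=
    PowerSeries.mk fun n => coeff n f • X ^ n
  have hup {f g : PowerSeries R} (h : euler f = euler g * f) :
      euler (up f) = euler (up g) * up f := by
    ext n : 1
    have h2 := congrArg (coeff n) h
    rw [coeff_euler, coeff_mul] at h2
    have hC (c : ℂ) (a : R) : c • (C a : PowerSeries R) = C (c • a) := by
      ext n; simp [coeff_C]
    simp only [up, coeff_euler, coeff_mk, coeff_mul, hC, h2, ← map_mul, ← map_sum]
  have hdiag {f g : PowerSeries ℂ} (h : euler f = euler g * f) :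
      euler (diag f) = euler (diag g) * diag f := by
    ext n : 1
    have h2 := congrArg (coeff n) h
    rw [coeff_euler, coeff_mul] at h2
    rw [coeff_euler, coeff_mul]
    simp only [diag, coeff_mk, smul_smul, ← smul_eq_mul, h2, Finset.sum_smul]
    refine Finset.sum_congr rfl fun x hx => ?_
    rw [HasAntidiagonal.mem_antidiagonal] at hx
    simp only [coeff_euler, coeff_mk, smul_mul_assoc, mul_smul_comm, smul_smul, ← pow_add, hx,
      smul_eq_mul]
    congr 1
    ring
  have hcent (f : PowerSeries ℂ) (Z : PowerSeries (PowerSeries R)) : diag f * Z = Z * diag f := by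
    refine commute_of_coeff fun m n => ?_
    simp only [diag, coeff_mk]
    exact Commute.smul_left (commute_X_pow _ _).symm _
  have heuler (f : PowerSeries ℂ) : euler (diag f) = diag (euler f) := by
    ext n : 1
    simp [diag, smul_smul]
  -- Coefficientwise this is `[D_n, Y'] = κ_n v ^ n Y'`.
  have hswap : C Y' * euler (up D) = (euler (up D) - euler (diag κ)) * C Y' := by
    ext n : 1
    rw [coeff_C_mul, coeff_mul_C, map_sub, coeff_euler, coeff_euler, ← smul_sub]
    rcases eq_or_ne n 0 with rfl | hn
    · simp
    rw [mul_smul_comm, smul_mul_assoc, sub_mul]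
    simp only [up, diag, coeff_mk]
    rw [hY'.C_mul_eq hn (h n hn), smul_mul_assoc, add_sub_cancel_right]
  -- In the variable `u` both sides solve the Euler equation for `up D` and have constant term
  -- `Y'(v)`.
  have main : up Y * C Y' = diag φ * (C Y' * up Y) := by
    refine eq_of_euler_eq (D := up D) ?_ ?_ ?_
    · rw [euler_mul_C, hup hY.euler_eq, mul_assoc]
    · rw [euler_mul, euler_mul, hdiag hφ.euler_eq, hup hY.euler_eq]
      have h0 : euler (C Y') = 0 := by
        ext n : 1
        rcases eq_or_ne n 0 with rfl | hn
        · simp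
        · simp [coeff_C, hn]
      rw [h0, zero_mul, zero_add, ← mul_assoc (C Y'), hswap, sub_mul, sub_mul, mul_sub]
      have e1 : diag φ * (euler (up D) * C Y' * up Y) = euler (up D) * (diag φ * (C Y' * up Y)) := by
        rw [mul_assoc, ← mul_assoc, hcent, mul_assoc]
      have e2 : diag φ * (euler (diag κ) * C Y' * up Y) =
          euler (diag κ) * diag φ * (C Y' * up Y) := by
        rw [mul_assoc, ← mul_assoc, hcent]
      rw [e1, e2]
      abel
    · rw [coeff_mul_C, coeff_mul]
      simp [up, diag, hY.zero, hφ.zero]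
  have h2 := congrArg (fun f => coeff k (coeff l f)) main
  rw [coeff_mul_C, coeff_mul l (diag φ)] at h2
  simp only [up, coeff_mk, coeff_C_mul, map_sum, diag, smul_mul_assoc, coeff_smul] at h2
  rw [h2]
  refine Finset.sum_congr rfl fun x _ => ?_
  rw [← mul_assoc, coeff_mul_C, coeff_X_pow_mul']

end FormalExp

/-! ## Operators on the Fock space -/

open FormalExp in
lemma expCoeff_eq (D : ℕ → Module.End ℂ Fock) (n : ℕ) :
    expCoeff D n = PowerSeries.coeff n (expSeries D) := by
  simp [expCoeff, expSeries]

/-- An operator on the polynomial ring acting on all Fock modules. -/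
noncomputable def fockMap (f : Module.End ℂ (MvPolynomial (Fin 2 × ℕ) ℂ)) : Module.End ℂ Fock :=
  Finsupp.mapRange.linearMap f

lemma fockMap_single (f : Module.End ℂ (MvPolynomial (Fin 2 × ℕ) ℂ)) (μ : Fin 2 → ℂ)
    (x : MvPolynomial (Fin 2 × ℕ) ℂ) :
    fockMap f (Finsupp.single μ x) = Finsupp.single μ (f x) := by
  simp [fockMap]

lemma zeroModeFun_single (f : (Fin 2 → ℂ) → ℂ) (μ : Fin 2 → ℂ) (x : MvPolynomial (Fin 2 × ℕ) ℂ) :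
    zeroModeFun f (Finsupp.single μ x) = f μ • Finsupp.single μ x := by
  simp [zeroModeFun]

lemma expQ_single (A : Fin 2 → Fin 2 → ℤ → ℂ) (n μ : Fin 2 → ℂ) (x : MvPolynomial (Fin 2 × ℕ) ℂ) :
    expQ A n (Finsupp.single μ x) = Finsupp.single (fun i => μ i + ∑ j, A i j 0 * n j) x := by
  simp [expQ, Finsupp.mapDomain_single]

/-- Two operators agree if they agree on all vectors of a definite momentum. -/
lemma fock_end_ext {S T : Module.End ℂ Fock}
    (h : ∀ μ x, S (Finsupp.single μ x) = T (Finsupp.single μ x)) : S = T :=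
  Finsupp.lhom_ext fun μ x => h μ x

lemma fockMap_mul (f g : Module.End ℂ (MvPolynomial (Fin 2 × ℕ) ℂ)) :
    fockMap (f * g) = fockMap f * fockMap g :=
  fock_end_ext fun μ x => by simp [fockMap_single]

lemma fockMap_commute_zeroModeFun (f : Module.End ℂ (MvPolynomial (Fin 2 × ℕ) ℂ))
    (g : (Fin 2 → ℂ) → ℂ) : Commute (fockMap f) (zeroModeFun g) :=
  fock_end_ext fun μ x => by simp [fockMap_single, zeroModeFun_single]

lemma fockMap_commute_expQ (f : Module.End ℂ (MvPolynomial (Fin 2 × ℕ) ℂ))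
    (A : Fin 2 → Fin 2 → ℤ → ℂ) (n : Fin 2 → ℂ) : Commute (fockMap f) (expQ A n) :=
  fock_end_ext fun μ x => by simp [fockMap_single, expQ_single]

lemma zeroModeFun_commute (f g : (Fin 2 → ℂ) → ℂ) : Commute (zeroModeFun f) (zeroModeFun g) :=
  fock_end_ext fun μ x => by simp [zeroModeFun_single, smul_smul, mul_comm]

lemma expQ_commute (A : Fin 2 → Fin 2 → ℤ → ℂ) (m n : Fin 2 → ℂ) :
    Commute (expQ A m) (expQ A n) :=
  fock_end_ext fun μ x => by
    simp only [Module.End.mul_apply, expQ_single]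
    congr 1
    ext i
    ring

lemma expQ_mul (A : Fin 2 → Fin 2 → ℤ → ℂ) (m n : Fin 2 → ℂ) :
    expQ A m * expQ A n = expQ A (m + n) :=
  fock_end_ext fun μ x => by
    simp only [Module.End.mul_apply, expQ_single]
    congr 1
    ext i
    simp only [Pi.add_apply, mul_add, Finset.sum_add_distrib]
    ring

/-- The derivation `∂ / ∂ a_l(-m)`, `m ≥ 1`. -/
noncomputable def der (l : Fin 2) (m : ℕ) : Module.End ℂ Fock :=
  fockMap (MvPolynomial.pderiv (R := ℂ) ((l, m - 1) : Fin 2 × ℕ)).toLinearMap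

lemma heis_pos (A : Fin 2 → Fin 2 → ℤ → ℂ) (j : Fin 2) {m : ℕ} (hm : m ≠ 0) :
    heis A j m = (m : ℂ)⁻¹ • ∑ l, A j l m • der l m := by
  obtain ⟨k, rfl⟩ := Nat.exists_eq_succ_of_ne_zero hm
  refine fock_end_ext fun μ x => ?_
  change Finsupp.mapRange.linearMap _ _ = _
  simp [der, fockMap_single, Fin.sum_univ_two]

/-- The creation operator `a_j(-m)`, `m ≥ 1`. -/
noncomputable def cre (j : Fin 2) (m : ℕ) : Module.End ℂ Fock :=
  fockMap (LinearMap.mulLeft ℂ (MvPolynomial.X ((j, m - 1) : Fin 2 × ℕ)))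

lemma heis_neg (A : Fin 2 → Fin 2 → ℤ → ℂ) (j : Fin 2) {m : ℕ} (hm : m ≠ 0) :
    heis A j (-(m : ℤ)) = cre j m := by
  obtain ⟨k, rfl⟩ := Nat.exists_eq_succ_of_ne_zero hm
  refine fock_end_ext fun μ x => ?_
  rw [show -((k.succ : ℕ) : ℤ) = Int.negSucc k from rfl, cre, fockMap_single]
  exact Finsupp.mapRange_single (hf := map_zero _)

/-- The commutator of two derivations is a derivation, and this one vanishes on the variables. -/
lemma pderiv_pderiv_comm (a b : Fin 2 × ℕ) (p : MvPolynomial (Fin 2 × ℕ) ℂ) :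
    MvPolynomial.pderiv a (MvPolynomial.pderiv b p) =
      MvPolynomial.pderiv b (MvPolynomial.pderiv a p) := by
  classical
  have h : ⁅MvPolynomial.pderiv (R := ℂ) a, MvPolynomial.pderiv (R := ℂ) b⁆ = 0 := by
    refine MvPolynomial.derivation_ext fun i => ?_
    rw [Derivation.commutator_apply, MvPolynomial.pderiv_X, MvPolynomial.pderiv_X, Pi.single_apply,
      Pi.single_apply]
    split_ifs <;> simp
  have h2 := congrArg (fun d => d p) h
  simp only [Derivation.commutator_apply, Derivation.zero_apply] at h2
  exact sub_eq_zero.mp h2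

lemma der_commute (k l : Fin 2) (m n : ℕ) : Commute (der k m) (der l n) := by
  rw [Commute, SemiconjBy, der, der, ← fockMap_mul, ← fockMap_mul]
  exact congrArg fockMap (LinearMap.ext fun p => pderiv_pderiv_comm _ _ p)

lemma cre_commute (k l : Fin 2) (m n : ℕ) : Commute (cre k m) (cre l n) := by
  rw [Commute, SemiconjBy, cre, cre, ← fockMap_mul, ← fockMap_mul]
  refine congrArg fockMap (LinearMap.ext fun p => ?_)
  simp only [Module.End.mul_apply, LinearMap.mulLeft_apply]
  ring

/-- The canonical commutation relation. Both indices have to be nonzero: the variable is numbered by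
the truncated difference `m - 1`, so `m = 0` and `m = 1` denote the same variable. -/
lemma der_mul_cre (k l : Fin 2) {m n : ℕ} (hm : m ≠ 0) (hn : n ≠ 0) :
    der k m * cre l n = cre l n * der k m + if n = m ∧ l = k then 1 else 0 := by
  refine fock_end_ext fun μ x => ?_
  simp only [Module.End.mul_apply, LinearMap.add_apply, der, cre, fockMap_single,
    LinearMap.mulLeft_apply, Derivation.coeFn_coe,
    MvPolynomial.pderiv_mul]
  rw [add_comm, Finsupp.single_add]
  congr 1
  by_cases h : n = m ∧ l = k
  · rw [if_pos h, h.1, h.2, MvPolynomial.pderiv_X_self, one_mul, Module.End.one_apply]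
  · rw [if_neg h, MvPolynomial.pderiv_X_of_ne, zero_mul, Finsupp.single_zero,
      LinearMap.zero_apply]
    intro h2
    rw [Prod.mk.injEq] at h2
    exact h ⟨by omega, h2.1⟩

namespace VertexOp

open FormalExp

variable (A : Fin 2 → Fin 2 → ℤ → ℂ) (V W : VertexOp)

/-- The exponent of the annihilation part. -/
noncomputable def annD : PowerSeries (Module.End ℂ Fock) :=
  PowerSeries.mk fun m => ∑ j, V.osc j (m : ℤ) • heis A j (m : ℤ)

/-- The exponent of the creation part. -/
noncomputable def creD : PowerSeries (Module.End ℂ Fock) :=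
  PowerSeries.mk fun m => ∑ j, V.osc j (-(m : ℤ)) • heis A j (-(m : ℤ))

lemma coeff_annD {m : ℕ} (hm : m ≠ 0) : PowerSeries.coeff m (annD A V) =
    ∑ l, (∑ j, V.osc j m * A j l m / m) • der l m := by
  simp only [annD, PowerSeries.coeff_mk, heis_pos A _ hm, Fin.sum_univ_two, smul_add, smul_smul,
    add_smul]
  have e (a b : ℂ) : a * ((m : ℂ)⁻¹ * b) = a * b / m := by ring
  simp only [e]
  abel

lemma coeff_creD {m : ℕ} (hm : m ≠ 0) : PowerSeries.coeff m (creD A V) =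
    ∑ j, V.osc j (-(m : ℤ)) • cre j m := by
  simp only [creD, PowerSeries.coeff_mk, heis_neg A _ hm]

lemma annD_commute {m n : ℕ} (hm : m ≠ 0) (hn : n ≠ 0) :
    Commute (PowerSeries.coeff m (annD A V)) (PowerSeries.coeff n (annD A W)) := by
  rw [coeff_annD A V hm, coeff_annD A W hn]
  exact Commute.sum_left _ _ _ fun i _ => Commute.sum_right _ _ _ fun j _ =>
    ((der_commute _ _ _ _).smul_left _).smul_right _

lemma creD_commute {m n : ℕ} (hm : m ≠ 0) (hn : n ≠ 0) :
    Commute (PowerSeries.coeff m (creD A V)) (PowerSeries.coeff n (creD A W)) := by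
  rw [coeff_creD A V hm, coeff_creD A W hn]
  exact Commute.sum_left _ _ _ fun i _ => Commute.sum_right _ _ _ fun j _ =>
    ((cre_commute _ _ _ _).smul_left _).smul_right _

lemma der_mul_creD (l : Fin 2) {m n : ℕ} (hm : m ≠ 0) (hn : n ≠ 0) :
    der l m * PowerSeries.coeff n (creD A V) = PowerSeries.coeff n (creD A V) * der l m +
      if n = m then V.osc l (-(m : ℤ)) • 1 else 0 := by
  rw [coeff_creD A V hn]
  simp only [Finset.mul_sum, Finset.sum_mul, mul_smul_comm, smul_mul_assoc,
    der_mul_cre _ _ hm hn, smul_add, Finset.sum_add_distrib]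
  congr 1
  by_cases h : n = m
  · simp only [h, true_and, if_true, smul_ite, smul_zero, Finset.sum_ite_eq', Finset.mem_univ]
  · simp [h]

lemma annD_mul_cre (l : Fin 2) {m n : ℕ} (hm : m ≠ 0) (hn : n ≠ 0) :
    PowerSeries.coeff m (annD A V) * cre l n = cre l n * PowerSeries.coeff m (annD A V) +
      if n = m then (∑ j, V.osc j m * A j l m / m) • 1 else 0 := by
  rw [coeff_annD A V hm]
  simp only [Finset.mul_sum, Finset.sum_mul, mul_smul_comm, smul_mul_assoc,
    der_mul_cre _ _ hm hn, smul_add]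
  rw [Finset.sum_add_distrib]
  congr 1
  by_cases h : n = m
  · simp only [h, true_and, if_true, smul_ite, smul_zero, Finset.sum_ite_eq, Finset.mem_univ]
  · simp [h]

/-- The exponent of the contraction function. -/
noncomputable def contr : PowerSeries ℂ := PowerSeries.mk fun m =>
  (∑ j, ∑ k, V.osc j m * A j k m * W.osc k (-(m : ℤ))) / m

lemma annD_mul_creD {m n : ℕ} (hm : m ≠ 0) (hn : n ≠ 0) :
    PowerSeries.coeff m (annD A V) * PowerSeries.coeff n (creD A W) =
      PowerSeries.coeff n (creD A W) * PowerSeries.coeff m (annD A V) +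
      if n = m then PowerSeries.coeff m (contr A V W) • 1 else 0 := by
  rw [coeff_creD A W hn]
  simp only [Finset.mul_sum, Finset.sum_mul, mul_smul_comm, smul_mul_assoc,
    annD_mul_cre A V _ hm hn, smul_add]
  rw [Finset.sum_add_distrib]
  congr 1
  by_cases h : n = m
  · simp only [h, if_true, contr, PowerSeries.coeff_mk, smul_smul, ← Finset.sum_smul,
      Fin.sum_univ_two]
    congr 1
    ring
  · simp [h]

/-- The generating series of the annihilation parts. -/
noncomputable def annX : PowerSeries (Module.End ℂ Fock) := PowerSeries.mk (V.annihilation A)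

/-- The generating series of the creation parts. -/
noncomputable def creX : PowerSeries (Module.End ℂ Fock) := PowerSeries.mk (V.creation A)

lemma isExp_annX : IsExp (annD A V) (annX A V) := by
  have h : annX A V = expSeries (fun m : ℕ => ∑ j, V.osc j (m : ℤ) • heis A j (m : ℤ)) := by
    ext n : 1
    rw [annX, PowerSeries.coeff_mk, annihilation, expCoeff_eq]
  rw [h]
  exact isExp_expSeries fun m hm n hn => by simpa [annD] using annD_commute A V V hm hn

lemma isExp_creX : IsExp (creD A V) (creX A V) := by
  have h : creX A V =
      expSeries (fun m : ℕ => ∑ j, V.osc j (-(m : ℤ)) • heis A j (-(m : ℤ))) := by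
    ext n : 1
    rw [creX, PowerSeries.coeff_mk, creation, expCoeff_eq]
  rw [h]
  exact isExp_expSeries fun m hm n hn => by simpa [creD] using creD_commute A V V hm hn

lemma coeff_annX (n : ℕ) : PowerSeries.coeff n (annX A V) = V.annihilation A n := by simp [annX]

lemma coeff_creX (n : ℕ) : PowerSeries.coeff n (creX A V) = V.creation A n := by simp [creX]

lemma annihilation_zero : V.annihilation A 0 = 1 := by
  rw [← coeff_annX, (isExp_annX A V).zero]

lemma creation_zero : V.creation A 0 = 1 := by
  rw [← coeff_creX, (isExp_creX A V).zero]

/-- The operators commuting with all annihilators commute with annihilation parts. -/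
lemma commute_annihilation {T : Module.End ℂ Fock}
    (h : ∀ f, Commute T (fockMap f)) (n : ℕ) : Commute T (V.annihilation A n) := by
  rw [← coeff_annX]
  refine (isExp_annX A V).commute_coeff (fun m hm => ?_) n
  rw [coeff_annD A V hm]
  exact Commute.sum_right _ _ _ fun l _ => (h _).smul_right _

lemma commute_creation {T : Module.End ℂ Fock}
    (h : ∀ f, Commute T (fockMap f)) (n : ℕ) : Commute T (V.creation A n) := by
  rw [← coeff_creX]
  refine (isExp_creX A V).commute_coeff (fun m hm => ?_) n
  rw [coeff_creD A V hm]
  exact Commute.sum_right _ _ _ fun l _ => (h _).smul_right _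

lemma annihilation_commute (m n : ℕ) : Commute (V.annihilation A m) (W.annihilation A n) := by
  rw [← coeff_annX, ← coeff_annX]
  exact (isExp_annX A V).commute_coeff_coeff (isExp_annX A W)
    (fun m hm n hn => annD_commute A V W hm hn) m n

lemma creation_commute (m n : ℕ) : Commute (V.creation A m) (W.creation A n) := by
  rw [← coeff_creX, ← coeff_creX]
  exact (isExp_creX A V).commute_coeff_coeff (isExp_creX A W)
    (fun m hm n hn => creD_commute A V W hm hn) m n

/-- Wick's rule for modes: normal ordering costs only the scalar series `exp (contr)`, whose degree
`x.1` is lost by both exponentials. -/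
lemma annihilation_mul_creation {φ : PowerSeries ℂ} (hφ : IsExp (contr A V W) φ) (l k : ℕ) :
    V.annihilation A l * W.creation A k = ∑ x ∈ Finset.HasAntidiagonal.antidiagonal l,
      PowerSeries.coeff x.1 φ • ((if x.1 ≤ k then W.creation A (k - x.1) else 0) *
        V.annihilation A x.2) := by
  have := (isExp_annX A V).coeff_mul_coeff (isExp_creX A W) hφ
    (fun m hm n hn => annD_mul_creD A V W hm hn) l k
  simpa only [coeff_annX, coeff_creX] using this

lemma annihilation_mul_cre (l : Fin 2) {m : ℕ} (hm : m ≠ 0) (n : ℕ) :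
    V.annihilation A n * cre l m = cre l m * V.annihilation A n +
      (∑ j, V.osc j m * A j l m / m) • (if m ≤ n then V.annihilation A (n - m) else 0) := by
  have := (isExp_annX A V).coeff_mul' (a := cre l m) hm
    (κ := ∑ j, V.osc j m * A j l m / m) (fun n hn => by
      rw [annD_mul_cre A V l hn hm]
      by_cases h : m = n
      · rw [h]
      · rw [if_neg h, if_neg h]) n
  simpa only [coeff_annX] using this

lemma der_mul_creation (l : Fin 2) {m : ℕ} (hm : m ≠ 0) (n : ℕ) :
    der l m * V.creation A n = V.creation A n * der l m +
      V.osc l (-(m : ℤ)) • (if m ≤ n then V.creation A (n - m) else 0) := by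
  have := (isExp_creX A V).mul_coeff hm (fun n hn => der_mul_creD A V l hm hn) n
  simpa only [coeff_creX] using this

/-- In `n X_n = ∑ X_i (j D_j)` the term `j = 0` vanishes, and every `D_j` with `j ≠ 0` is a
derivation, which kills constants. -/
lemma annihilation_vacuum (μ : Fin 2 → ℂ) (a : ℂ) {n : ℕ} (hn : n ≠ 0) :
    V.annihilation A n (Finsupp.single μ (MvPolynomial.C a)) = 0 := by
  have h := (isExp_annX A V).coeff_smul_eq (fun m hm n hn => annD_commute A V V hm hn) n
  have h2 := congrArg (fun T => T (Finsupp.single μ (MvPolynomial.C a))) h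
  simp only [LinearMap.smul_apply, LinearMap.sum_apply, Module.End.mul_apply, coeff_annX] at h2
  rw [Finset.sum_eq_zero] at h2
  · exact (smul_eq_zero.mp h2).resolve_left (by exact_mod_cast hn)
  intro x _
  rcases eq_or_ne x.2 0 with h0 | h0
  · simp [h0]
  · simp [coeff_annD A V h0, der, fockMap_single]

/-- On each vector, almost all annihilation parts vanish. -/
lemma exists_annihilation_eq_zero (v : Fock) : ∃ N, ∀ n ≥ N, V.annihilation A n v = 0 := by
  induction v using Finsupp.induction_linear with
  | zero => exact ⟨0, fun n _ => map_zero _⟩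
  | add v w hv hw =>
    obtain ⟨M, hM⟩ := hv
    obtain ⟨N, hN⟩ := hw
    exact ⟨max M N, fun n hn => by
      rw [map_add, hM n (le_of_max_le_left hn), hN n (le_of_max_le_right hn), add_zero]⟩
  | single μ p =>
    induction p using MvPolynomial.induction_on with
    | C a => exact ⟨1, fun n hn => annihilation_vacuum A V μ a (by omega)⟩
    | add p q hp hq =>
      obtain ⟨M, hM⟩ := hp
      obtain ⟨N, hN⟩ := hq
      exact ⟨max M N, fun n hn => by
        rw [Finsupp.single_add, map_add, hM n (le_of_max_le_left hn),
          hN n (le_of_max_le_right hn), add_zero]⟩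
    | mul_X p i hp =>
      obtain ⟨M, hM⟩ := hp
      -- Multiplication by the variable `i` is the creation operator of degree `i.2 + 1`; passing it
      -- lowers the degree of the annihilation part by exactly that much.
      refine ⟨M + (i.2 + 1), fun n hn => ?_⟩
      have h1 : Finsupp.single μ (p * MvPolynomial.X i) = cre i.1 (i.2 + 1) (Finsupp.single μ p) := by
        simp [cre, fockMap_single, mul_comm]
      have h2 := congrArg (fun T => T (Finsupp.single μ p))
        (annihilation_mul_cre A V i.1 (Nat.succ_ne_zero i.2) n)
      simp only [Module.End.mul_apply, LinearMap.add_apply, LinearMap.smul_apply] at h2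
      rw [h1, h2, hM n (by omega), if_pos (by omega), hM _ (by omega), map_zero, smul_zero,
        add_zero]

end VertexOp

/-! ## Modes of vertex operators -/

section IndexExtension

variable {M : Type*} [AddCommMonoid M]

open Classical in
/-- The extension by zero of a sequence to complex indices. -/
noncomputable def cext (f : ℕ → M) (β : ℂ) : M :=
  if h : ∃ k : ℕ, (k : ℂ) = β then f h.choose else 0

lemma cext_natCast (f : ℕ → M) (k : ℕ) : cext f k = f k := by
  have h : ∃ n : ℕ, (n : ℂ) = k := ⟨k, rfl⟩
  rw [cext, dif_pos h]
  exact congrArg f (Nat.cast_injective (R := ℂ) h.choose_spec)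

lemma cext_eq_zero {f : ℕ → M} {β : ℂ} (h : ∀ k : ℕ, (k : ℂ) = β → f k = 0) : cext f β = 0 := by
  by_cases hβ : ∃ k : ℕ, (k : ℂ) = β
  · obtain ⟨k, rfl⟩ := hβ
    rw [cext_natCast, h k rfl]
  · rw [cext, dif_neg hβ]

lemma cext_eq_zero_of_re_neg (f : ℕ → M) {β : ℂ} (h : β.re < 0) : cext f β = 0 := by
  refine cext_eq_zero fun k hk => ?_
  rw [← hk, Complex.natCast_re] at h
  exact absurd h (not_lt.mpr k.cast_nonneg)

lemma map_cext {M' F : Type*} [AddCommMonoid M'] [FunLike F M M'] [AddMonoidHomClass F M M']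
    (g : F) (f : ℕ → M) (β : ℂ) : g (cext f β) = cext (fun k => g (f k)) β := by
  by_cases hβ : ∃ k : ℕ, (k : ℂ) = β
  · obtain ⟨k, rfl⟩ := hβ
    rw [cext_natCast, cext_natCast]
  · rw [cext, dif_neg hβ, cext, dif_neg hβ, map_zero]

open Classical in
lemma finsum_ite_eq_cext (f : ℕ → M) (β : ℂ) :
    ∑ᶠ k : ℕ, (if (k : ℂ) = β then f k else 0) = cext f β := by
  by_cases hβ : ∃ k : ℕ, (k : ℂ) = β
  · obtain ⟨k, rfl⟩ := hβ
    rw [cext_natCast, finsum_eq_single _ k]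
    · simp
    · intro n hn
      rw [if_neg (by exact_mod_cast hn)]
  · rw [cext, dif_neg hβ]
    refine finsum_eq_zero_of_forall_eq_zero fun k => if_neg fun h => hβ ⟨k, h⟩

-- For each of the finitely many relevant `l` at most one `k` satisfies `k = γ + l`.
open Classical in
lemma finite_support_ite {γ : ℂ} {N : ℕ} {h : ℕ → ℕ → M} (hN : ∀ k, ∀ l ≥ N, h k l = 0) :
    (Function.support fun t : ℕ × ℕ =>
      if (t.1 : ℂ) = γ + t.2 then h t.1 t.2 else 0).Finite := by
  refine Set.Finite.of_finite_image (f := Prod.snd) ((Set.finite_Iio N).subset ?_) ?_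
  · rintro _ ⟨t, ht, rfl⟩
    by_contra hlt
    refine ht ?_
    simp only [hN t.1 t.2 (by simpa using hlt), ite_self]
  · intro t ht t' ht' htt
    have h1 : (t.1 : ℂ) = γ + t.2 := by
      by_contra hne
      exact ht (if_neg hne)
    have h2 : (t'.1 : ℂ) = γ + t'.2 := by
      by_contra hne
      exact ht' (if_neg hne)
    refine Prod.ext ?_ htt
    rw [← htt, ← h1] at h2
    exact_mod_cast h2.symm

open Classical in
lemma finsum_ite_eq_sum_cext {γ : ℂ} {N : ℕ} {h : ℕ → ℕ → M} (hN : ∀ k, ∀ l ≥ N, h k l = 0) :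
    ∑ᶠ t : ℕ × ℕ, (if (t.1 : ℂ) = γ + t.2 then h t.1 t.2 else 0) =
      ∑ l ∈ Finset.range N, cext (fun k => h k l) (γ + l) := by
  rw [← finsum_comp_equiv (Equiv.prodComm ℕ ℕ), finsum_curry]
  · simp only [Equiv.prodComm_apply, Prod.fst_swap, Prod.snd_swap]
    rw [finsum_eq_sum_of_support_subset (s := Finset.range N)]
    · exact Finset.sum_congr rfl fun l _ => finsum_ite_eq_cext _ _
    · intro l hl
      rw [Finset.coe_range, Set.mem_Iio]
      by_contra hlt
      refine hl ?_
      simp only [hN _ l (by simpa using hlt), ite_self, finsum_zero]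
  · have := (finite_support_ite (γ := γ) hN).preimage
      (Equiv.prodComm ℕ ℕ).injective.injOn
    exact this

end IndexExtension

/-- A vector on which `a_1(0), a_2(0)` act as `μ_1, μ_2`. -/
def IsWt (μ : Fin 2 → ℂ) (v : Fock) : Prop := ∀ f, zeroModeFun f v = f μ • v

lemma isWt_single (μ : Fin 2 → ℂ) (x : MvPolynomial (Fin 2 × ℕ) ℂ) :
    IsWt μ (Finsupp.single μ x) := fun f => zeroModeFun_single f μ x

lemma IsWt.map {μ : Fin 2 → ℂ} {v : Fock} (hv : IsWt μ v) {T : Module.End ℂ Fock}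
    (hT : ∀ f, Commute T (zeroModeFun f)) : IsWt μ (T v) := fun f => by
  rw [← Module.End.mul_apply, ← (hT f).eq, Module.End.mul_apply, hv f, map_smul]

lemma zeroModeFun_mul_expQ (A : Fin 2 → Fin 2 → ℤ → ℂ) (f : (Fin 2 → ℂ) → ℂ) (n : Fin 2 → ℂ) :
    zeroModeFun f * expQ A n =
      expQ A n * zeroModeFun fun μ => f fun i => μ i + ∑ j, A i j 0 * n j :=
  fock_end_ext fun μ x => by
    simp only [Module.End.mul_apply, expQ_single, zeroModeFun_single, map_smul]

lemma IsWt.expQ {μ : Fin 2 → ℂ} {v : Fock} (hv : IsWt μ v) (A : Fin 2 → Fin 2 → ℤ → ℂ)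
    (n : Fin 2 → ℂ) : IsWt (fun i => μ i + ∑ j, A i j 0 * n j) (expQ A n v) := fun f => by
  rw [← Module.End.mul_apply, zeroModeFun_mul_expQ, Module.End.mul_apply, hv, map_smul]

/-- Local finiteness of a family of operators need only be checked on vectors of a definite
momentum. -/
lemma finite_support_of_single {ι : Type*} {T : ι → Module.End ℂ Fock}
    (h : ∀ μ x, (Function.support fun t => T t (Finsupp.single μ x)).Finite) (v : Fock) :
    (Function.support fun t => T t v).Finite := by
  induction v using Finsupp.induction_linear with
  | zero => simp
  | add v w hv hw =>
    refine (hv.union hw).subset ?_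
    simp only [map_add]
    exact Function.support_add _ _
  | single μ x => exact h μ x

/-- The sum of a locally finite family of operators. -/
noncomputable def finsumEnd {ι : Type*} (T : ι → Module.End ℂ Fock)
    (h : ∀ v, (Function.support fun t => T t v).Finite) : Module.End ℂ Fock where
  toFun v := ∑ᶠ t, T t v
  map_add' v w := by
    simp only [map_add]
    exact finsum_add_distrib (h v) (h w)
  map_smul' c v := by
    simp only [map_smul, RingHom.id_apply]
    exact (smul_finsum' c (h v)).symm

namespace VertexOp

variable (A : Fin 2 → Fin 2 → ℤ → ℂ) (V W : VertexOp)

/-- The exponent of `z` in the zero mode part of `V(z)` on vectors of momentum `μ`. -/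
noncomputable def expo (μ : Fin 2 → ℂ) : ℂ := V.pow + ∑ j, V.powA j * μ j

/-- The part of a vertex operator that does not depend on `z`. -/
noncomputable def lead : Module.End ℂ Fock := expQ A V.charge * V.expZero

/-- The part of a normally ordered product that does not depend on `z, w`. -/
noncomputable def lead₂ : Module.End ℂ Fock :=
  expQ A V.charge * (expQ A W.charge * (V.expZero * W.expZero))

lemma lead_commute_fockMap (f : Module.End ℂ (MvPolynomial (Fin 2 × ℕ) ℂ)) :
    Commute (lead A V) (fockMap f) :=
  ((fockMap_commute_expQ f A _).mul_right (fockMap_commute_zeroModeFun f _)).symm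

lemma lead_annihilation (n : ℕ) (v : Fock) :
    lead A V (W.annihilation A n v) = W.annihilation A n (lead A V v) :=
  congrArg (fun T => T v) (commute_annihilation A W (lead_commute_fockMap A V) n).eq

lemma lead_creation (n : ℕ) (v : Fock) :
    lead A V (W.creation A n v) = W.creation A n (lead A V v) :=
  congrArg (fun T => T v) (commute_creation A W (lead_commute_fockMap A V) n).eq

lemma lead_cext (β : ℂ) (v : Fock) :
    lead A V (cext (fun k => W.creation A k v) β) =
      cext (fun k => W.creation A k (lead A V v)) β := by
  rw [map_cext]
  simp only [lead_creation]

/-- The only reordering moves the exponential of `a(0)` past that of `Q`; the commutator of the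
exponents is a scalar. -/
lemma lead_lead (v : Fock) : lead A V (lead A W v) =
    Complex.exp (∑ j, V.zero j * ∑ k, A j k 0 * W.charge k) • lead₂ A V W v := by
  have h : V.expZero * expQ A W.charge =
      Complex.exp (∑ j, V.zero j * ∑ k, A j k 0 * W.charge k) • (expQ A W.charge * V.expZero) := by
    rw [expZero, zeroModeFun_mul_expQ]
    refine fock_end_ext fun μ x => ?_
    simp only [LinearMap.smul_apply, Module.End.mul_apply, zeroModeFun_single, map_smul, smul_smul,
      mul_add, Finset.sum_add_distrib, Complex.exp_add, mul_comm]
  have h2 : lead A V * lead A W =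
      Complex.exp (∑ j, V.zero j * ∑ k, A j k 0 * W.charge k) • lead₂ A V W := by
    rw [lead, lead, lead₂, mul_assoc, ← mul_assoc V.expZero, h, smul_mul_assoc, mul_smul_comm,
      mul_assoc]
  exact congrArg (fun T => T v) h2

variable {A V W}

lemma IsWt.annihilation {μ : Fin 2 → ℂ} {v : Fock} (hv : IsWt μ v) (n : ℕ) :
    IsWt μ (V.annihilation A n v) :=
  hv.map fun f => (commute_annihilation A V (fun g => (fockMap_commute_zeroModeFun g f).symm) n).symm

lemma IsWt.creation {μ : Fin 2 → ℂ} {v : Fock} (hv : IsWt μ v) (n : ℕ) :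
    IsWt μ (V.creation A n v) :=
  hv.map fun f => (commute_creation A V (fun g => (fockMap_commute_zeroModeFun g f).symm) n).symm

lemma IsWt.cext_creation {μ : Fin 2 → ℂ} {v : Fock} (hv : IsWt μ v) (β : ℂ) :
    IsWt μ (cext (fun k => V.creation A k v) β) := by
  by_cases hβ : ∃ k : ℕ, (k : ℂ) = β
  · obtain ⟨k, rfl⟩ := hβ
    rw [cext_natCast]
    exact IsWt.creation hv k
  · rw [cext, dif_neg hβ]
    exact fun f => by simp

lemma IsWt.lead {μ : Fin 2 → ℂ} {v : Fock} (hv : IsWt μ v) :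
    IsWt (fun i => μ i + ∑ j, A i j 0 * V.charge j) (lead A V v) := by
  rw [VertexOp.lead, Module.End.mul_apply]
  exact (hv.map fun f => zeroModeFun_commute _ f).expQ A _

lemma zPow_apply {μ : Fin 2 → ℂ} {v : Fock} (hv : IsWt μ v) (β : ℂ) [Decidable (expo V μ = β)] :
    V.zPow β v = if expo V μ = β then v else 0 := by
  rw [zPow, hv]
  by_cases h : expo V μ = β
  · rw [if_pos h]
    rw [expo] at h
    simp only [h, if_true, one_smul]
  · rw [if_neg h]
    rw [expo] at h
    simp only [h, if_false, zero_smul]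

variable (A V W)

/-- The terms of `mode`. -/
noncomputable def modeTerm (β : ℂ) (t : ℕ × ℕ) : Module.End ℂ Fock :=
  expQ A V.charge * V.expZero * V.creation A t.1 * V.annihilation A t.2 * V.zPow (β - t.1 + t.2)

/-- The terms of `normalMode`. -/
noncomputable def normalTerm (a b : ℂ) (t : (ℕ × ℕ) × (ℕ × ℕ)) : Module.End ℂ Fock :=
  lead₂ A V W * V.creation A t.1.1 * W.creation A t.2.1 * V.annihilation A t.1.2 *
    W.annihilation A t.2.2 * V.zPow (a - t.1.1 + t.1.2) * W.zPow (b - t.2.1 + t.2.2)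

lemma mode_eq_finsum (β : ℂ) (v : Fock) : V.mode A β v = ∑ᶠ t, modeTerm A V β t v := rfl

lemma normalMode_eq_finsum (a b : ℂ) (v : Fock) :
    normalMode A V W a b v = ∑ᶠ t, normalTerm A V W a b t v := rfl

open Classical in
lemma modeTerm_apply {μ : Fin 2 → ℂ} {v : Fock} (hv : IsWt μ v) (β : ℂ) (t : ℕ × ℕ) :
    modeTerm A V β t v = if (t.1 : ℂ) = β - expo V μ + t.2 then
      lead A V (V.creation A t.1 (V.annihilation A t.2 v)) else 0 := by
  simp only [modeTerm, Module.End.mul_apply, zPow_apply hv, lead]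
  have h : expo V μ = β - t.1 + t.2 ↔ (t.1 : ℂ) = β - expo V μ + t.2 :=
    ⟨fun h => by rw [h]; ring, fun h => by rw [h]; ring⟩
  by_cases h2 : (t.1 : ℂ) = β - expo V μ + t.2
  · rw [if_pos (h.mpr h2), if_pos h2]
  · rw [if_neg (mt h.mp h2), if_neg h2]
    simp only [map_zero]

open Classical in
lemma normalTerm_apply {μ : Fin 2 → ℂ} {v : Fock} (hv : IsWt μ v) (a b : ℂ)
    (t : (ℕ × ℕ) × (ℕ × ℕ)) :
    normalTerm A V W a b t v = if (t.1.1 : ℂ) = a - expo V μ + t.1.2 then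
      (if (t.2.1 : ℂ) = b - expo W μ + t.2.2 then
        lead₂ A V W (V.creation A t.1.1 (W.creation A t.2.1
          (V.annihilation A t.1.2 (W.annihilation A t.2.2 v)))) else 0) else 0 := by
  simp only [normalTerm, Module.End.mul_apply, zPow_apply hv]
  have h : expo V μ = a - t.1.1 + t.1.2 ↔ (t.1.1 : ℂ) = a - expo V μ + t.1.2 :=
    ⟨fun h => by rw [h]; ring, fun h => by rw [h]; ring⟩
  have h' : expo W μ = b - t.2.1 + t.2.2 ↔ (t.2.1 : ℂ) = b - expo W μ + t.2.2 :=
    ⟨fun h => by rw [h]; ring, fun h => by rw [h]; ring⟩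
  by_cases h2 : (t.2.1 : ℂ) = b - expo W μ + t.2.2
  · rw [if_pos (h'.mpr h2), if_pos h2, zPow_apply hv]
    by_cases h1 : (t.1.1 : ℂ) = a - expo V μ + t.1.2
    · rw [if_pos (h.mpr h1), if_pos h1]
    · rw [if_neg (mt h.mp h1), if_neg h1]
      simp only [map_zero]
  · rw [if_neg (mt h'.mp h2), if_neg h2]
    simp only [map_zero, ite_self]

lemma modeTerm_finite (β : ℂ) (v : Fock) :
    (Function.support fun t => modeTerm A V β t v).Finite := by
  classical
  refine finite_support_of_single (fun μ x => ?_) v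
  obtain ⟨N, hN⟩ := exists_annihilation_eq_zero A V (Finsupp.single μ x)
  simp only [modeTerm_apply A V (isWt_single μ x)]
  refine finite_support_ite (N := N)
    (h := fun k l => lead A V (V.creation A k (V.annihilation A l _))) fun k l hl => ?_
  rw [hN l hl, map_zero, map_zero]

/-- On a vector of definite momentum the creation degree is determined by the annihilation degree
`l`; `cext` gives zero when the required degree is not a natural number. -/
lemma mode_eq {μ : Fin 2 → ℂ} {v : Fock} (hv : IsWt μ v) {N : ℕ}
    (hN : ∀ n ≥ N, V.annihilation A n v = 0) (β : ℂ) :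
    V.mode A β v = ∑ l ∈ Finset.range N,
      lead A V (cext (fun k => V.creation A k (V.annihilation A l v)) (β - expo V μ + l)) := by
  classical
  rw [mode_eq_finsum]
  simp only [modeTerm_apply A V hv]
  rw [finsum_ite_eq_sum_cext (N := N)
    (h := fun k l => lead A V (V.creation A k (V.annihilation A l v)))]
  · simp only [map_cext]
  · intro k l hl
    rw [hN l hl, map_zero, map_zero]

/-- The terms of a normally ordered product that do not vanish trivially. -/
noncomputable def normalSummand (a b : ℂ) (l m : ℕ) (v : Fock) : Fock :=
  lead₂ A V W (cext (fun i => V.creation A i (cext (fun j => W.creation A j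
    (V.annihilation A l (W.annihilation A m v))) (b + m))) (a + l))

lemma annihilation_annihilation_eq_zero {v : Fock} {N : ℕ}
    (hV : ∀ n ≥ N, V.annihilation A n v = 0) (hW : ∀ n ≥ N, W.annihilation A n v = 0)
    {l m : ℕ} (h : N ≤ l ∨ N ≤ m) : V.annihilation A l (W.annihilation A m v) = 0 := by
  rcases h with h | h
  · rw [← Module.End.mul_apply, (annihilation_commute A V W l m).eq, Module.End.mul_apply, hV l h,
      map_zero]
  · rw [hW m h, map_zero]

open Classical in
lemma normalTerm_finite (a b : ℂ) (v : Fock) :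
    (Function.support fun t => normalTerm A V W a b t v).Finite := by
  refine finite_support_of_single (fun μ x => ?_) v
  set v : Fock := Finsupp.single μ x with hvdef
  have hv : IsWt μ v := isWt_single μ x
  obtain ⟨N₁, hN₁⟩ := exists_annihilation_eq_zero A V v
  obtain ⟨N₂, hN₂⟩ := exists_annihilation_eq_zero A W v
  have hV : ∀ n ≥ max N₁ N₂, V.annihilation A n v = 0 := fun n hn => hN₁ n (le_of_max_le_left hn)
  have hW : ∀ n ≥ max N₁ N₂, W.annihilation A n v = 0 := fun n hn => hN₂ n (le_of_max_le_right hn)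
  -- The indicator of `l < max N₁ N₂` replaces the operators: it counts the pairs of degrees that
  -- can contribute.
  have h1 := finite_support_ite (M := ℕ) (γ := a - expo V μ) (N := max N₁ N₂)
    (h := fun k l => if l < max N₁ N₂ then 1 else 0) (fun k l hl => if_neg (by omega))
  have h2 := finite_support_ite (M := ℕ) (γ := b - expo W μ) (N := max N₁ N₂)
    (h := fun k l => if l < max N₁ N₂ then 1 else 0) (fun k l hl => if_neg (by omega))
  refine (h1.prod h2).subset fun t ht => ?_
  rw [Function.mem_support, normalTerm_apply A V W hv] at ht
  simp only [ne_eq, ite_eq_right_iff, Classical.not_imp] at ht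
  obtain ⟨ht1, ht2, ht3⟩ := ht
  have hl : t.1.2 < max N₁ N₂ ∧ t.2.2 < max N₁ N₂ := by
    by_contra hcon
    rw [annihilation_annihilation_eq_zero A V W hV hW (by omega)] at ht3
    simp at ht3
  constructor
  · simp only [Function.mem_support, if_pos ht1, if_pos hl.1, ne_eq, one_ne_zero, not_false_eq_true]
  · simp only [Function.mem_support, if_pos ht2, if_pos hl.2, ne_eq, one_ne_zero, not_false_eq_true]

lemma normalMode_eq {μ : Fin 2 → ℂ} {v : Fock} (hv : IsWt μ v) {N : ℕ}
    (hV : ∀ n ≥ N, V.annihilation A n v = 0) (hW : ∀ n ≥ N, W.annihilation A n v = 0) (a b : ℂ) :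
    normalMode A V W a b v = ∑ l ∈ Finset.range N, ∑ m ∈ Finset.range N,
      normalSummand A V W (a - expo V μ) (b - expo W μ) l m v := by
  classical
  rw [normalMode_eq_finsum, finsum_curry _ (normalTerm_finite A V W a b v)]
  simp only [normalTerm_apply A V W hv]
  have h1 (t : ℕ × ℕ) : ∑ᶠ t' : ℕ × ℕ, (if (t.1 : ℂ) = a - expo V μ + t.2 then
      (if (t'.1 : ℂ) = b - expo W μ + t'.2 then
        lead₂ A V W (V.creation A t.1 (W.creation A t'.1
          (V.annihilation A t.2 (W.annihilation A t'.2 v)))) else 0) else 0) =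
      if (t.1 : ℂ) = a - expo V μ + t.2 then ∑ m ∈ Finset.range N,
        lead₂ A V W (V.creation A t.1 (cext (fun j => W.creation A j
          (V.annihilation A t.2 (W.annihilation A m v))) (b - expo W μ + m))) else 0 := by
    by_cases ht : (t.1 : ℂ) = a - expo V μ + t.2
    · simp only [if_pos ht]
      rw [finsum_ite_eq_sum_cext (N := N) (h := fun k l => lead₂ A V W (V.creation A t.1
        (W.creation A k (V.annihilation A t.2 (W.annihilation A l v)))))]
      · simp only [map_cext]
      · intro k l hl
        rw [hW l hl]
        simp only [map_zero]
    · simp only [if_neg ht, finsum_zero]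
  simp only [h1]
  rw [finsum_ite_eq_sum_cext (N := N) (h := fun k l => ∑ m ∈ Finset.range N,
        lead₂ A V W (V.creation A k (cext (fun j => W.creation A j
          (V.annihilation A l (W.annihilation A m v))) (b - expo W μ + m))))]
  · refine Finset.sum_congr rfl fun l _ => ?_
    by_cases hβ : ∃ k : ℕ, (k : ℂ) = a - expo V μ + l
    · obtain ⟨k, hk⟩ := hβ
      simp only [normalSummand, ← hk, cext_natCast]
    · have h0 {M : Type} [AddCommMonoid M] (f : ℕ → M) : cext f (a - expo V μ + l) = 0 :=
        cext_eq_zero fun k hk => absurd ⟨k, hk⟩ hβ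
      simp only [normalSummand, h0, map_zero, Finset.sum_const_zero]
  · intro k l hl
    refine Finset.sum_eq_zero fun m _ => ?_
    rw [annihilation_annihilation_eq_zero A V W hV hW (Or.inl hl)]
    simp only [map_zero]
    rw [cext_eq_zero fun _ _ => rfl]
    simp only [map_zero]

/-- `mode` as a linear operator. -/
noncomputable def modeEnd (β : ℂ) : Module.End ℂ Fock :=
  finsumEnd (modeTerm A V β) (modeTerm_finite A V β)

/-- `normalMode` as a linear operator. -/
noncomputable def normalEnd (a b : ℂ) : Module.End ℂ Fock :=
  finsumEnd (normalTerm A V W a b) (normalTerm_finite A V W a b)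

lemma modeEnd_apply (β : ℂ) (v : Fock) : modeEnd A V β v = V.mode A β v := rfl

lemma normalEnd_apply (a b : ℂ) (v : Fock) : normalEnd A V W a b v = normalMode A V W a b v := rfl

end VertexOp

/-! ## Operator product expansions -/

/-- Every pair in the support lies in the box `K × N`, hence has total degree below `K + N`, so
nothing is lost by summing by total degree. -/
lemma sum_range_antidiagonal {M : Type*} [AddCommMonoid M] {F : ℕ × ℕ → M} {K N : ℕ}
    (hF0 : ∀ x : ℕ × ℕ, K ≤ x.1 ∨ N ≤ x.2 → F x = 0) :
    ∑ l ∈ Finset.range (K + N), ∑ x ∈ Finset.HasAntidiagonal.antidiagonal l, F x =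
      ∑ n ∈ Finset.range K, ∑ l ∈ Finset.range N, F (n, l) := by
  rw [← Finset.sum_product' (f := fun n l => F (n, l)), Finset.sum_sigma']
  refine Finset.sum_bij_ne_zero (fun x _ _ => x.2) ?_ ?_ ?_ ?_
  · intro x _ hx0
    by_contra hx
    refine hx0 (hF0 _ ?_)
    rw [Finset.mem_product, Finset.mem_range, Finset.mem_range] at hx
    omega
  · rintro ⟨l, x⟩ hx _ ⟨l', x'⟩ hx' _ h
    rw [Finset.mem_sigma, Finset.HasAntidiagonal.mem_antidiagonal] at hx hx'
    simp only at h hx hx'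
    subst h
    rw [← hx.2, ← hx'.2]
  · intro x hx hx0
    rw [Finset.mem_product, Finset.mem_range, Finset.mem_range] at hx
    refine ⟨⟨x.1 + x.2, x⟩, ?_, hx0, rfl⟩
    rw [Finset.mem_sigma, Finset.HasAntidiagonal.mem_antidiagonal, Finset.mem_range]
    exact ⟨by simp only; omega, rfl⟩
  · intro x _ _
    rfl

namespace VertexOp

open FormalExp

variable (A : Fin 2 → Fin 2 → ℤ → ℂ) (V W : VertexOp)

lemma normalMode_comm (a b : ℂ) (v : Fock) :
    normalMode A V W a b v = normalMode A W V b a v := by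
  rw [normalMode_eq_finsum, normalMode_eq_finsum,
    ← finsum_comp_equiv (Equiv.prodComm (ℕ × ℕ) (ℕ × ℕ))]
  refine finsum_congr fun t => congrArg (fun T : Module.End ℂ Fock => T v) ?_
  simp only [normalTerm, lead₂, Equiv.prodComm_apply, Prod.fst_swap, Prod.snd_swap]
  have h1 := (expQ_commute A V.charge W.charge).eq
  have h2 : V.expZero * W.expZero = W.expZero * V.expZero := (zeroModeFun_commute _ _).eq
  have h3 := (creation_commute A V W t.2.1 t.1.1).eq
  have h4 := (annihilation_commute A V W t.2.2 t.1.2).eq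
  have h5 : V.zPow (a - t.2.1 + t.2.2) * W.zPow (b - t.1.1 + t.1.2) =
    W.zPow (b - t.1.1 + t.1.2) * V.zPow (a - t.2.1 + t.2.2) := (zeroModeFun_commute _ _).eq
  rw [h2, ← mul_assoc (expQ A V.charge), h1]
  rw [mul_assoc _ (V.zPow _), h5]
  rw [mul_assoc _ (V.annihilation A _), h4]
  rw [mul_assoc _ (V.creation A _), h3]
  simp only [mul_assoc]

lemma exists_common_bound (v : Fock) :
    ∃ N, (∀ n ≥ N, V.annihilation A n v = 0) ∧ ∀ n ≥ N, W.annihilation A n v = 0 := by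
  obtain ⟨N₁, hN₁⟩ := exists_annihilation_eq_zero A V v
  obtain ⟨N₂, hN₂⟩ := exists_annihilation_eq_zero A W v
  exact ⟨max N₁ N₂, fun n hn => hN₁ n (le_of_max_le_left hn),
    fun n hn => hN₂ n (le_of_max_le_right hn)⟩

lemma normalSummand_eq_zero {a b : ℂ} {l m : ℕ} {v : Fock}
    (h : a.re + l < 0 ∨ b.re + m < 0) : normalSummand A V W a b l m v = 0 := by
  rw [normalSummand]
  rcases h with h | h
  · rw [cext_eq_zero_of_re_neg _ (by simpa using h), map_zero]
  · have h0 : cext (fun j => W.creation A j (V.annihilation A l (W.annihilation A m v))) (b + m) =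
        0 := cext_eq_zero_of_re_neg _ (by simpa using h)
    rw [h0]
    simp only [map_zero]
    rw [cext_eq_zero fun _ _ => rfl, map_zero]

/-- For very negative `k` the creation degree of `V` would be negative, for very large `k` that of
`W`. -/
lemma normalMode_finite_int (a b : ℂ) (v : Fock) :
    (Function.support fun k : ℤ => normalMode A V W (a + k) (b - k) v).Finite := by
  simp only [← normalEnd_apply]
  refine finite_support_of_single (T := fun k : ℤ => normalEnd A V W (a + k) (b - k))
    (fun μ x => ?_) v
  obtain ⟨N, hV, hW⟩ := exists_common_bound A V W (Finsupp.single μ x)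
  refine (Set.finite_Icc (-⌈|(a - expo V μ).re|⌉ - N) (⌈|(b - expo W μ).re|⌉ + N)).subset
    fun k hk => ?_
  by_contra hcon
  refine hk ?_
  simp only [normalEnd_apply]
  rw [normalMode_eq A V W (isWt_single μ x) hV hW]
  refine Finset.sum_eq_zero fun l hl => Finset.sum_eq_zero fun m hm => ?_
  rw [Finset.mem_range] at hl hm
  refine normalSummand_eq_zero A V W ?_
  rw [Set.mem_Icc, not_and_or, not_le, not_le] at hcon
  have hl' : (l : ℝ) < N := by exact_mod_cast hl
  have hm' : (m : ℝ) < N := by exact_mod_cast hm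
  rcases hcon with h | h
  · left
    have h1 := Int.le_ceil |(a - expo V μ).re|
    have h2 := le_abs_self (a - expo V μ).re
    have h3 : (k : ℝ) < -⌈|(a - expo V μ).re|⌉ - N := by exact_mod_cast h
    simp only [Complex.sub_re, Complex.add_re, Complex.intCast_re] at *
    linarith
  · right
    have h1 := Int.le_ceil |(b - expo W μ).re|
    have h2 := le_abs_self (b - expo W μ).re
    have h3 : (⌈|(b - expo W μ).re|⌉ : ℝ) + N < k := by exact_mod_cast h
    simp only [Complex.sub_re, Complex.intCast_re] at *
    linarith

lemma normalMode_finite_nat (a b : ℂ) (v : Fock) :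
    (Function.support fun k : ℕ => normalMode A V W (a + k) (b - k) v).Finite := by
  have := (normalMode_finite_int A V W a b v).preimage (Nat.cast_injective (R := ℤ)).injOn
  refine this.subset fun k hk => ?_
  simpa using hk

lemma ope_finite (φ : ℕ → ℂ) (a b : ℂ) (v : Fock) :
    (Function.support fun k : ℕ => φ k • normalMode A V W (a + k) (b - k) v).Finite :=
  (normalMode_finite_nat A V W a b v).subset fun k hk h0 => hk (by simp only at h0; simp [h0])

/-- The contraction function of two vertex operators. -/
noncomputable def opeSeries (A : Fin 2 → Fin 2 → ℤ → ℂ) (V W : VertexOp) : PowerSeries ℂ :=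
  expSeries fun m => PowerSeries.coeff m (contr A V W)

lemma isExp_opeSeries : IsExp (contr A V W) (opeSeries A V W) := by
  have := isExp_expSeries (D := fun m => PowerSeries.coeff m (contr A V W))
    fun _ _ _ _ => Commute.all _ _
  refine this.congr fun n _ => ?_
  simp

lemma annihilation_cext_creation (l : ℕ) (γ : ℂ) (v : Fock) :
    V.annihilation A l (cext (fun k => W.creation A k v) γ) =
      ∑ x ∈ Finset.HasAntidiagonal.antidiagonal l, PowerSeries.coeff x.1 (opeSeries A V W) •
        cext (fun k => W.creation A k (V.annihilation A x.2 v)) (γ - x.1) := by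
  by_cases hγ : ∃ k : ℕ, (k : ℂ) = γ
  · obtain ⟨k, rfl⟩ := hγ
    rw [cext_natCast, ← Module.End.mul_apply,
      annihilation_mul_creation A V W (isExp_opeSeries A V W), LinearMap.sum_apply]
    refine Finset.sum_congr rfl fun x _ => ?_
    rw [LinearMap.smul_apply, Module.End.mul_apply]
    split_ifs with h
    · rw [← Nat.cast_sub h, cext_natCast]
    · rw [cext_eq_zero fun n hn => ?_, LinearMap.zero_apply]
      refine absurd ?_ h
      have : n + x.1 = k := by
        exact_mod_cast (eq_sub_iff_add_eq.mp hn)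
      omega
  · rw [cext, dif_neg hγ, map_zero, Finset.sum_eq_zero]
    intro x _
    rw [cext_eq_zero fun n hn => absurd ⟨n + x.1, by push_cast; rw [hn]; ring⟩ hγ, smul_zero]

/-- Wick's rule summed over all annihilation degrees of `V`. Contractions of degree `n ≥ K` do not
contribute, since `β - n` then has negative real part and cannot be a creation degree. -/
lemma sum_annihilation_cext_creation {N K : ℕ} {α β : ℂ} {v : Fock}
    (hN : ∀ n ≥ N, V.annihilation A n v = 0) (hK : β.re < K) :
    ∑ l ∈ Finset.range (K + N), cext (fun i => V.creation A i
        (V.annihilation A l (cext (fun k => W.creation A k v) β))) (α + l) =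
      ∑ n ∈ Finset.range K, ∑ l ∈ Finset.range N, PowerSeries.coeff n (opeSeries A V W) •
        cext (fun i => V.creation A i (cext (fun k => W.creation A k (V.annihilation A l v))
          (β - n))) (α + n + l) := by
  set F : ℕ × ℕ → Fock := fun x => PowerSeries.coeff x.1 (opeSeries A V W) •
        cext (fun i => V.creation A i (cext (fun k => W.creation A k (V.annihilation A x.2 v))
          (β - x.1))) (α + x.1 + x.2) with hF
  have hz {γ : ℂ} : cext (fun i => V.creation A i (0 : Fock)) γ = 0 :=
    cext_eq_zero fun _ _ => map_zero _
  have hF0 (x : ℕ × ℕ) (hx : K ≤ x.1 ∨ N ≤ x.2) : F x = 0 := by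
    have h0 : cext (fun k => W.creation A k (V.annihilation A x.2 v)) (β - x.1) = 0 := by
      rcases hx with hx | hx
      · refine cext_eq_zero_of_re_neg _ ?_
        have : (K : ℝ) ≤ x.1 := by exact_mod_cast hx
        simp only [Complex.sub_re, Complex.natCast_re]
        linarith
      · rw [hN _ hx]
        exact cext_eq_zero fun _ _ => map_zero _
    simp only [hF, h0, hz, smul_zero]
  have h1 (l : ℕ) : cext (fun i => V.creation A i
        (V.annihilation A l (cext (fun k => W.creation A k v) β))) (α + l) =
      ∑ x ∈ Finset.HasAntidiagonal.antidiagonal l, F x := by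
    by_cases hα : ∃ k : ℕ, (k : ℂ) = α + l
    · obtain ⟨k, hk⟩ := hα
      rw [← hk, cext_natCast, annihilation_cext_creation, map_sum]
      refine Finset.sum_congr rfl fun x hx => ?_
      rw [Finset.HasAntidiagonal.mem_antidiagonal] at hx
      have : α + x.1 + x.2 = k := by
        rw [hk, ← hx]
        push_cast
        ring
      simp only [hF, this, cext_natCast, map_smul]
    · rw [cext, dif_neg hα, Finset.sum_eq_zero]
      intro x hx
      rw [Finset.HasAntidiagonal.mem_antidiagonal] at hx
      have : α + x.1 + x.2 = α + l := by
        rw [← hx]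
        push_cast
        ring
      simp only [hF, this]
      rw [cext, dif_neg hα, smul_zero]
  simp only [h1]
  exact sum_range_antidiagonal hF0

/-- The constant produced by moving the zero modes of `V` past the charge of `W`. -/
noncomputable def opeConst (A : Fin 2 → Fin 2 → ℤ → ℂ) (V W : VertexOp) : ℂ :=
  Complex.exp (∑ j, V.zero j * ∑ k, A j k 0 * W.charge k)

/-- The hypothesis `h` says that the charge of `W` does not change the exponent of `z` in `V(z)`.
Without it the product would carry a further complex power of `z`. -/
lemma sum_mode_lead {μ : Fin 2 → ℂ} {u : Fock} (hu : IsWt μ u)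
    (h : ∑ j, V.powA j * ∑ k, A j k 0 * W.charge k = 0) {N K : ℕ} {a β : ℂ}
    (hN : ∀ n ≥ N, V.annihilation A n u = 0) (hK : β.re < K) :
    V.mode A a (lead A W (cext (fun k => W.creation A k u) β)) = opeConst A V W •
        ∑ n ∈ Finset.range K, ∑ l ∈ Finset.range N, PowerSeries.coeff n (opeSeries A V W) •
          lead₂ A V W (cext (fun i => V.creation A i (cext (fun k => W.creation A k
            (V.annihilation A l u)) (β - n))) (a - expo V μ + n + l)) := by
  have hexpo : expo V (fun i => μ i + ∑ j, A i j 0 * W.charge j) = expo V μ := by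
    simp only [expo, mul_add, Finset.sum_add_distrib, h, add_zero]
  rw [mode_eq A V (N := K + N) (IsWt.lead (IsWt.cext_creation hu _))]
  · have h1 (l : ℕ) : lead A V (cext (fun k => V.creation A k (V.annihilation A l
        (lead A W (cext (fun k => W.creation A k u) β)))) (a - expo V μ + l)) =
        opeConst A V W • lead₂ A V W (cext (fun k => V.creation A k (V.annihilation A l
          (cext (fun k => W.creation A k u) β))) (a - expo V μ + l)) := by
      rw [opeConst, ← lead_lead, lead_cext A W V]
      simp only [lead_annihilation A W V]
    rw [hexpo, Finset.sum_congr rfl fun l _ => h1 l, ← Finset.smul_sum, ← map_sum,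
      sum_annihilation_cext_creation A V W hN hK]
    simp only [map_sum, map_smul]
  · intro n hn
    rw [← lead_annihilation, annihilation_cext_creation, Finset.sum_eq_zero, map_zero]
    intro x hx
    rw [Finset.HasAntidiagonal.mem_antidiagonal] at hx
    rcases le_or_gt K x.1 with hx1 | hx1
    · rw [cext_eq_zero_of_re_neg, smul_zero]
      have h1 : (K : ℝ) ≤ x.1 := by exact_mod_cast hx1
      rw [Complex.sub_re, Complex.natCast_re]
      linarith
    · rw [hN _ (by omega), cext_eq_zero fun _ _ => map_zero _, smul_zero]

lemma ope_of_isWt {μ : Fin 2 → ℂ} {v : Fock} (hv : IsWt μ v)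
    (h : ∑ j, V.powA j * ∑ k, A j k 0 * W.charge k = 0) (a b : ℂ) :
    V.mode A a (W.mode A b v) =
      ∑ᶠ k : ℕ, (opeConst A V W * PowerSeries.coeff k (opeSeries A V W)) •
        normalMode A V W (a + k) (b - k) v := by
  obtain ⟨N, hV, hW⟩ := exists_common_bound A V W v
  -- `K` exceeds the real part of every creation degree of `W` that can occur, so contractions of
  -- degree `K` or more vanish uniformly in `m < N`.
  obtain ⟨K, hK⟩ := exists_nat_gt ((b - expo W μ).re + N)
  have hKm {m : ℕ} (hm : m ∈ Finset.range N) : (b - expo W μ + m).re < K := by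
    have : (m : ℝ) < N := by exact_mod_cast Finset.mem_range.mp hm
    simp only [Complex.add_re, Complex.natCast_re]
    linarith
  have hL : V.mode A a (W.mode A b v) = ∑ m ∈ Finset.range N, opeConst A V W •
      ∑ n ∈ Finset.range K, ∑ l ∈ Finset.range N, PowerSeries.coeff n (opeSeries A V W) •
        normalSummand A V W (a + n - expo V μ) (b - n - expo W μ) l m v := by
    rw [mode_eq A W hv hW b, ← modeEnd_apply, map_sum]
    refine Finset.sum_congr rfl fun m hm => ?_
    rw [modeEnd_apply, sum_mode_lead A V W (IsWt.annihilation hv m) h (N := N)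
      (fun n hn => annihilation_annihilation_eq_zero A V W hV hW (Or.inl hn)) (hKm hm)]
    refine congrArg _ (Finset.sum_congr rfl fun n _ => Finset.sum_congr rfl fun l _ => ?_)
    rw [normalSummand, show b - expo W μ + m - n = b - n - expo W μ + m by ring,
      show a - expo V μ + n + l = a + n - expo V μ + l by ring]
  rw [hL, finsum_eq_sum_of_support_subset (s := Finset.range K)]
  · simp only [normalMode_eq A V W hv hV hW, Finset.smul_sum, mul_smul]
    rw [Finset.sum_comm]
    refine Finset.sum_congr rfl fun n _ => ?_
    rw [Finset.sum_comm]
  · intro n hn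
    rw [Finset.coe_range, Set.mem_Iio]
    by_contra hcon
    refine hn ?_
    simp only
    rw [normalMode_eq A V W hv hV hW, Finset.sum_eq_zero, smul_zero]
    refine fun l _ => Finset.sum_eq_zero fun m hm => normalSummand_eq_zero A V W (Or.inr ?_)
    have h1 : (K : ℝ) ≤ n := by exact_mod_cast not_lt.mp hcon
    have h2 := hKm hm
    simp only [Complex.sub_re, Complex.add_re, Complex.natCast_re] at h2 ⊢
    linarith

theorem hasOPE_opeSeries (h : ∑ j, V.powA j * ∑ k, A j k 0 * W.charge k = 0) :
    HasOPE A V W fun n => opeConst A V W * PowerSeries.coeff n (opeSeries A V W) := by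
  intro a b v
  induction v using Finsupp.induction_linear with
  | zero =>
    simp only [← modeEnd_apply, ← normalEnd_apply, map_zero, smul_zero, finsum_zero]
  | add v w hv hw =>
    simp only [← modeEnd_apply, ← normalEnd_apply, map_add, smul_add] at *
    rw [hv, hw]
    exact (finsum_add_distrib (ope_finite A V W _ a b v) (ope_finite A V W _ a b w)).symm
  | single μ x => exact ope_of_isWt A V W (isWt_single μ x) h a b

lemma lead₂_vacuum_ne_zero (μ : Fin 2 → ℂ) :
    lead₂ A V W (Finsupp.single μ (MvPolynomial.C 1)) ≠ 0 := by
  simp only [lead₂, Module.End.mul_apply, expZero, zeroModeFun_single, map_smul, expQ_single]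
  rw [smul_smul]
  refine smul_ne_zero (mul_ne_zero (Complex.exp_ne_zero _) (Complex.exp_ne_zero _)) ?_
  rw [Ne, Finsupp.single_eq_zero, map_one]
  exact one_ne_zero

/-- On the vacuum no annihilators act, and the creation degrees of `V` and `W` are `k` and `-k`;
both are nonnegative only for `k = 0`. This isolates a single coefficient of an operator product. -/
lemma normalMode_vacuum (μ : Fin 2 → ℂ) (k : ℤ) :
    normalMode A V W (expo V μ + k) (expo W μ - k) (Finsupp.single μ (MvPolynomial.C 1)) =
      if k = 0 then lead₂ A V W (Finsupp.single μ (MvPolynomial.C 1)) else 0 := by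
  rw [normalMode_eq A V W (isWt_single μ _) (N := 1)
    (fun n hn => annihilation_vacuum A V μ 1 (by omega))
    (fun n hn => annihilation_vacuum A W μ 1 (by omega))]
  simp only [Finset.sum_range_one]
  split_ifs with h
  · subst h
    have h0 : (0 : ℂ) = (0 : ℕ) := by simp
    rw [normalSummand]
    simp only [Int.cast_zero, Nat.cast_zero, add_zero, sub_zero, sub_self]
    rw [h0, cext_natCast, cext_natCast]
    simp only [annihilation_zero, creation_zero, Module.End.one_apply]
  · refine normalSummand_eq_zero A V W ?_
    rcases lt_or_gt_of_ne h with h | h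
    · left
      have : (k : ℝ) < 0 := by exact_mod_cast h
      simpa using this
    · right
      have : (0 : ℝ) < k := by exact_mod_cast h
      simpa using this

theorem HasOPE.unique {φ ψ : ℕ → ℂ} (hφ : HasOPE A V W φ) (hψ : HasOPE A V W ψ) : φ = ψ := by
  funext n
  have key (χ : ℕ → ℂ) : ∑ᶠ k : ℕ, χ k • normalMode A V W (expo V 0 - n + k) (expo W 0 + n - k)
      (Finsupp.single 0 (MvPolynomial.C 1)) =
      χ n • lead₂ A V W (Finsupp.single 0 (MvPolynomial.C 1)) := by
    have h (k : ℕ) : normalMode A V W (expo V 0 - n + k) (expo W 0 + n - k)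
        (Finsupp.single 0 (MvPolynomial.C 1)) =
        if (k : ℤ) - n = 0 then lead₂ A V W (Finsupp.single 0 (MvPolynomial.C 1)) else 0 := by
      rw [← normalMode_vacuum A V W 0 ((k : ℤ) - n)]
      congr 1
      · push_cast
        ring
      · push_cast
        ring
    simp only [h]
    rw [finsum_eq_single _ n]
    · simp
    · intro k hk
      rw [if_neg (by omega), smul_zero]
  have h := (hφ (expo V 0 - n) (expo W 0 + n) (Finsupp.single 0 (MvPolynomial.C 1))).symm.trans
    (hψ (expo V 0 - n) (expo W 0 + n) (Finsupp.single 0 (MvPolynomial.C 1)))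
  rw [key, key] at h
  exact smul_left_injective ℂ (lead₂_vacuum_ne_zero A V W 0) h

lemma hasOPE_iff (h : ∑ j, V.powA j * ∑ k, A j k 0 * W.charge k = 0) (φ : ℕ → ℂ) :
    HasOPE A V W φ ↔ φ = fun n => opeConst A V W * PowerSeries.coeff n (opeSeries A V W) :=
  ⟨fun hφ => hφ.unique A V W (hasOPE_opeSeries A V W h), fun hφ => hφ ▸ hasOPE_opeSeries A V W h⟩

end VertexOp

/-! ## Fusion of two vertex operators at proportional arguments -/

namespace VertexOp

open FormalExp

variable (A : Fin 2 → Fin 2 → ℤ → ℂ) (V W : VertexOp)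

/-- The vertex operator `:V(z) W(e ^ (-ℓ) z):` up to a constant. -/
noncomputable def fuse (ℓ : ℂ) : VertexOp where
  charge := V.charge + W.charge
  -- The powers of `z` come from `W` alone, which is right because `fusion` assumes that `V` has
  -- none. At `w = e ^ (-ℓ) z` the factor `w ^ (-m)` contributes `e ^ (m ℓ)` and `w ^ (a(0))`
  -- contributes `e ^ (-ℓ a(0))`; the scalar `e ^ (-pow ℓ)` is the constant left out.
  pow := W.pow
  powA := W.powA
  zero := fun j => V.zero j + W.zero j - ℓ * W.powA j
  osc := fun j m => V.osc j m + Complex.exp (m * ℓ) * W.osc j m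

lemma creation_fuse (ℓ : ℂ) (n : ℕ) : (fuse V W ℓ).creation A n =
    ∑ x ∈ Finset.HasAntidiagonal.antidiagonal n,
      Complex.exp (-x.2 * ℓ) • (V.creation A x.1 * W.creation A x.2) := by
  have hexp (m : ℕ) : Complex.exp (-ℓ) ^ m = Complex.exp (-m * ℓ) := by
    rw [← Complex.exp_nat_mul]
    congr 1
    ring
  have h1 := (isExp_creX A V).mul ((isExp_creX A W).rescale (Complex.exp (-ℓ)))
    fun m hm n hn => by
      rw [PowerSeries.coeff_mk]
      exact (creD_commute A V W hm hn).smul_right _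
  have h2 := h1.congr (D' := creD A (fuse V W ℓ)) fun n hn => by
    rw [map_add, PowerSeries.coeff_mk, coeff_creD A _ hn, coeff_creD A _ hn, coeff_creD A _ hn,
      hexp]
    simp only [fuse, add_smul, Finset.sum_add_distrib, Finset.smul_sum, smul_smul]
    push_cast
    rfl
  rw [← coeff_creX, (isExp_creX A _).unique h2, PowerSeries.coeff_mul]
  refine Finset.sum_congr rfl fun x _ => ?_
  rw [PowerSeries.coeff_mk, coeff_creX, coeff_creX, hexp, mul_smul_comm]

lemma annihilation_fuse (ℓ : ℂ) (n : ℕ) : (fuse V W ℓ).annihilation A n =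
    ∑ x ∈ Finset.HasAntidiagonal.antidiagonal n,
      Complex.exp (x.2 * ℓ) • (V.annihilation A x.1 * W.annihilation A x.2) := by
  have hexp (m : ℕ) : Complex.exp ℓ ^ m = Complex.exp (m * ℓ) := by
    rw [← Complex.exp_nat_mul]
  have h1 := (isExp_annX A V).mul ((isExp_annX A W).rescale (Complex.exp ℓ))
    fun m hm n hn => by
      rw [PowerSeries.coeff_mk]
      exact (annD_commute A V W hm hn).smul_right _
  have h2 := h1.congr (D' := annD A (fuse V W ℓ)) fun n hn => by
    simp only [map_add, PowerSeries.coeff_mk, annD, hexp]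
    simp only [fuse, add_smul, Finset.sum_add_distrib, Finset.smul_sum, smul_smul]
    push_cast
    rfl
  rw [← coeff_annX, (isExp_annX A _).unique h2, PowerSeries.coeff_mul]
  refine Finset.sum_congr rfl fun x _ => ?_
  rw [PowerSeries.coeff_mk, coeff_annX, coeff_annX, hexp, mul_smul_comm]

lemma lead_fuse {μ : Fin 2 → ℂ} {v : Fock} (hv : IsWt μ v) (ℓ : ℂ) :
    lead A (fuse V W ℓ) v = Complex.exp (-ℓ * ∑ j, W.powA j * μ j) • lead₂ A V W v := by
  simp only [lead, lead₂, ← mul_assoc, expQ_mul, fuse]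
  simp only [mul_assoc, Module.End.mul_apply, expZero, hv _, map_smul, smul_smul, ← Complex.exp_add]
  congr 2
  simp only [Fin.sum_univ_two]
  ring

/-- For fixed annihilation degrees `l, m` the creation degrees are `n + l` and `γ - n + m`. Their
sum does not depend on `n`, so the sum over `n` is the antidiagonal sum of `creation_fuse`. -/
lemma finsum_normalSummand {c γ e ℓ : ℂ} (hc : c = γ + e) (l m : ℕ) (v : Fock) :
    ∑ᶠ n : ℤ, Complex.exp (-(c - n) * ℓ) • normalSummand A V W n (γ - n) l m v =
      Complex.exp (-e * ℓ) • lead₂ A V W (cext (fun k => (fuse V W ℓ).creation A k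
        (Complex.exp (m * ℓ) • V.annihilation A l (W.annihilation A m v))) (γ + l + m)) := by
  by_cases hγ : ∃ N : ℕ, (N : ℂ) = γ + l + m
  · obtain ⟨N, hN⟩ := hγ
    rw [← hN, cext_natCast, map_smul, creation_fuse, LinearMap.sum_apply,
      Finset.Nat.sum_antidiagonal_eq_sum_range_succ_mk,
      finsum_eq_sum_of_support_subset
        (s := (Finset.range (N + 1)).image fun i : ℕ => (i : ℤ) - l),
      Finset.sum_image (fun x _ y _ h => by simpa using h)]
    · rw [map_smul, map_sum, Finset.smul_sum, Finset.smul_sum]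
      refine Finset.sum_congr rfl fun i hi => ?_
      have hi' : i ≤ N := by
        rw [Finset.mem_range] at hi
        omega
      have e1 : (((i : ℤ) - l : ℤ) : ℂ) + l = i := by
        push_cast
        ring
      have e2 : γ - (((i : ℤ) - l : ℤ) : ℂ) + m = ((N - i : ℕ) : ℂ) := by
        rw [Nat.cast_sub hi', hN]
        push_cast
        ring
      rw [normalSummand, e1, e2, cext_natCast, cext_natCast]
      simp only [LinearMap.smul_apply, Module.End.mul_apply, map_smul, smul_smul,
        ← Complex.exp_add]
      congr 2
      rw [hc, Nat.cast_sub hi', hN]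
      push_cast
      ring
    · intro n hn
      by_contra hcon
      refine hn ?_
      simp only
      rw [normalSummand, cext_eq_zero fun i hi => ?_, map_zero, smul_zero]
      have h0 : cext (fun j => W.creation A j (V.annihilation A l (W.annihilation A m v)))
          (γ - n + m) = 0 := by
        refine cext_eq_zero fun j hj => absurd ?_ hcon
        have h1 : ((i + j : ℕ) : ℂ) = N := by
          rw [hN]
          push_cast
          rw [hi, hj]
          ring
        have h2 : i + j = N := by exact_mod_cast h1
        rw [Finset.coe_image, Set.mem_image]
        refine ⟨i, by simp; omega, ?_⟩
        have h3 : ((i : ℤ) : ℂ) = ((n + l : ℤ) : ℂ) := by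
          push_cast
          exact hi
        have h4 : (i : ℤ) = n + l := by exact_mod_cast h3
        omega
      rw [h0, map_zero]
  · rw [cext_eq_zero fun k hk => absurd ⟨k, hk⟩ hγ, map_zero, smul_zero]
    refine finsum_eq_zero_of_forall_eq_zero fun n => ?_
    rw [normalSummand, cext_eq_zero fun i hi => ?_, map_zero, smul_zero]
    rw [cext_eq_zero fun j hj => ?_, map_zero]
    refine absurd ⟨i + j, ?_⟩ hγ
    push_cast
    rw [hi, hj]
    ring

lemma fusion_of_isWt {μ : Fin 2 → ℂ} {v : Fock} (hv : IsWt μ v) (hpow : V.pow = 0)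
    (hpowA : V.powA = 0) (ℓ c : ℂ) :
    ∑ᶠ n : ℤ, Complex.exp (-(c - n) * ℓ) • normalMode A V W n (c - n) v =
      Complex.exp (-W.pow * ℓ) • (fuse V W ℓ).mode A c v := by
  obtain ⟨N, hV, hW⟩ := exists_common_bound A V W v
  have hexpo : expo V μ = 0 := by simp [expo, hpow, hpowA]
  have hexpo' : expo (fuse V W ℓ) μ = expo W μ := rfl
  set F : ℕ × ℕ → Fock := fun x => lead A (fuse V W ℓ) (cext (fun k => (fuse V W ℓ).creation A k
    (Complex.exp (x.2 * ℓ) • V.annihilation A x.1 (W.annihilation A x.2 v)))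
      (c - expo W μ + x.1 + x.2)) with hF
  have hF0 (x : ℕ × ℕ) (hx : N ≤ x.1 ∨ N ≤ x.2) : F x = 0 := by
    simp only [hF]
    rw [annihilation_annihilation_eq_zero A V W hV hW hx, smul_zero,
      cext_eq_zero fun _ _ => map_zero _, map_zero]
  have hR : (fuse V W ℓ).mode A c v = ∑ l ∈ Finset.range N, ∑ m ∈ Finset.range N, F (l, m) := by
    rw [mode_eq A (fuse V W ℓ) hv (N := N + N), hexpo', ← sum_range_antidiagonal hF0]
    · refine Finset.sum_congr rfl fun L _ => ?_
      by_cases hβ : ∃ k : ℕ, (k : ℂ) = c - expo W μ + L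
      · obtain ⟨k, hk⟩ := hβ
        rw [← hk, cext_natCast, annihilation_fuse, LinearMap.sum_apply, map_sum, map_sum]
        refine Finset.sum_congr rfl fun x hx => ?_
        rw [Finset.HasAntidiagonal.mem_antidiagonal] at hx
        have : c - expo W μ + x.1 + x.2 = k := by
          rw [hk, ← hx]
          push_cast
          ring
        simp only [hF]
        rw [this, cext_natCast]
        rfl
      · rw [cext_eq_zero fun k hk => absurd ⟨k, hk⟩ hβ, map_zero, Finset.sum_eq_zero]
        intro x hx
        rw [Finset.HasAntidiagonal.mem_antidiagonal] at hx
        simp only [hF]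
        rw [cext_eq_zero fun k hk => absurd ⟨k, ?_⟩ hβ, map_zero]
        rw [hk, ← hx]
        push_cast
        ring
    · intro n hn
      rw [annihilation_fuse, LinearMap.sum_apply]
      refine Finset.sum_eq_zero fun x hx => ?_
      rw [Finset.HasAntidiagonal.mem_antidiagonal] at hx
      rw [LinearMap.smul_apply, Module.End.mul_apply,
        annihilation_annihilation_eq_zero A V W hV hW (by omega), smul_zero]
  have hfin (l m : ℕ) : (Function.support fun n : ℤ => Complex.exp (-(c - n) * ℓ) •
      normalSummand A V W n (c - expo W μ - n) l m v).Finite := by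
    refine (Set.finite_Icc (-(l : ℤ)) (⌈|(c - expo W μ).re|⌉ + m)).subset fun n hn => ?_
    by_contra hcon
    refine hn ?_
    simp only
    rw [normalSummand_eq_zero, smul_zero]
    rw [Set.mem_Icc, not_and_or, not_le, not_le] at hcon
    rcases hcon with h | h
    · left
      have : (n : ℝ) < -l := by exact_mod_cast h
      rw [Complex.intCast_re]
      linarith
    · right
      have h1 := Int.le_ceil |(c - expo W μ).re|
      have h2 := le_abs_self (c - expo W μ).re
      have h3 : (⌈|(c - expo W μ).re|⌉ : ℝ) + m < n := by exact_mod_cast h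
      rw [Complex.sub_re, Complex.intCast_re]
      linarith
  rw [hR]
  have hN (n : ℤ) : Complex.exp (-(c - n) * ℓ) • normalMode A V W n (c - n) v =
      ∑ l ∈ Finset.range N, ∑ m ∈ Finset.range N, Complex.exp (-(c - n) * ℓ) •
        normalSummand A V W n (c - expo W μ - n) l m v := by
    rw [normalMode_eq A V W hv hV hW, hexpo]
    simp only [Finset.smul_sum, sub_zero]
    refine Finset.sum_congr rfl fun l _ => Finset.sum_congr rfl fun m _ => ?_
    rw [show c - n - expo W μ = c - expo W μ - n by ring]
  simp only [hN]
  rw [finsum_sum_comm]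
  · simp only [Finset.smul_sum]
    refine Finset.sum_congr rfl fun l _ => ?_
    rw [finsum_sum_comm _ _ fun m _ => hfin l m]
    refine Finset.sum_congr rfl fun m _ => ?_
    rw [finsum_normalSummand A V W (e := expo W μ) (by ring)]
    simp only [hF]
    rw [lead_fuse A V W (μ := μ), smul_smul, ← Complex.exp_add]
    · congr 2
      rw [expo]
      ring
    · refine IsWt.cext_creation ?_ _
      intro f
      rw [map_smul, (IsWt.annihilation (IsWt.annihilation hv m) l) f, smul_comm]
  · intro l _
    refine (Set.Finite.biUnion (Finset.range N).finite_toSet fun m _ => hfin l m).subset ?_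
    exact Finset.support_sum _ _

/-- Setting `w = e ^ (-ℓ) z` multiplies the coefficient of `z ^ n w ^ (c - n)` by `e ^ (-(c - n)
ℓ)`; the prefactor on the right is the constant omitted from `fuse`. -/
theorem fusion (hpow : V.pow = 0) (hpowA : V.powA = 0) (ℓ c : ℂ) (v : Fock) :
    ∑ᶠ n : ℤ, Complex.exp (-(c - n) * ℓ) • normalMode A V W n (c - n) v =
      Complex.exp (-W.pow * ℓ) • (fuse V W ℓ).mode A c v := by
  have hfin (v : Fock) : (Function.support fun n : ℤ =>
      Complex.exp (-(c - n) * ℓ) • normalMode A V W n (c - n) v).Finite := by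
    have := normalMode_finite_int A V W 0 c v
    simp only [zero_add] at this
    exact this.subset fun k hk h0 => hk (by simp only at h0; simp [h0])
  induction v using Finsupp.induction_linear with
  | zero => simp only [← modeEnd_apply, ← normalEnd_apply, map_zero, smul_zero, finsum_zero]
  | add v w hv hw =>
    have h1 := finsum_add_distrib (hfin v) (hfin w)
    simp only [← modeEnd_apply, ← normalEnd_apply, map_add, smul_add] at *
    rw [← hv, ← hw, ← h1]
  | single μ x => exact fusion_of_isWt A V W (isWt_single μ x) hpow hpowA ℓ c

/-! ### A vertex operator is determined by its modes -/

lemma lead_vacuum (μ : Fin 2 → ℂ) : lead A V (Finsupp.single μ (MvPolynomial.C 1)) =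
    Complex.exp (∑ j, V.zero j * μ j) • Finsupp.single (fun i => μ i + ∑ j, A i j 0 * V.charge j)
      (MvPolynomial.C 1) := by
  rw [lead, Module.End.mul_apply, expZero, zeroModeFun_single, map_smul, expQ_single]

lemma vacuum_ne_zero (μ : Fin 2 → ℂ) :
    (Finsupp.single μ (MvPolynomial.C 1) : Fock) ≠ 0 := by
  rw [Ne, Finsupp.single_eq_zero, map_one]
  exact one_ne_zero

lemma mode_vacuum (μ : Fin 2 → ℂ) (n : ℕ) :
    V.mode A (expo V μ + n) (Finsupp.single μ (MvPolynomial.C 1)) =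
      V.creation A n (lead A V (Finsupp.single μ (MvPolynomial.C 1))) := by
  rw [mode_eq A V (isWt_single μ _) (N := 1)
    (fun n hn => annihilation_vacuum A V μ 1 (by omega)), Finset.sum_range_one]
  rw [show expo V μ + n - expo V μ + ((0 : ℕ) : ℂ) = (n : ℕ) by push_cast; ring, cext_natCast,
    annihilation_zero, Module.End.one_apply, lead_creation]

/-- Reads off the creation exponents from the modes. -/
lemma der_mode_vacuum (μ : Fin 2 → ℂ) (l : Fin 2) {n : ℕ} (hn : n ≠ 0) :
    der l n (V.mode A (expo V μ + n) (Finsupp.single μ (MvPolynomial.C 1))) =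
      V.osc l (-(n : ℤ)) • lead A V (Finsupp.single μ (MvPolynomial.C 1)) := by
  rw [mode_vacuum, ← Module.End.mul_apply, der_mul_creation A V l hn, if_pos le_rfl, Nat.sub_self,
    creation_zero, LinearMap.add_apply, Module.End.mul_apply, lead_vacuum]
  simp [der, fockMap_single]

/-- Reads off the annihilation exponents, but only after contraction with the matrix `A(n)`. -/
lemma mode_cre_vacuum (μ : Fin 2 → ℂ) (l : Fin 2) {n : ℕ} (hn : n ≠ 0) :
    V.mode A (expo V μ - n) (cre l n (Finsupp.single μ (MvPolynomial.C 1))) =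
      (∑ j, V.osc j n * A j l n / n) • lead A V (Finsupp.single μ (MvPolynomial.C 1)) := by
  have hann (k : ℕ) (hk : n ≤ k) :
      V.annihilation A k (cre l n (Finsupp.single μ (MvPolynomial.C 1))) =
      (∑ j, V.osc j n * A j l n / n) •
        V.annihilation A (k - n) (Finsupp.single μ (MvPolynomial.C 1)) := by
    rw [← Module.End.mul_apply, annihilation_mul_cre A V l hn, if_pos hk, LinearMap.add_apply,
      Module.End.mul_apply, annihilation_vacuum A V μ 1 (by omega), map_zero, zero_add,
      LinearMap.smul_apply]
  rw [mode_eq A V (μ := μ) (N := n + 1), Finset.sum_range_succ, Finset.sum_eq_zero, zero_add]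
  · rw [show expo V μ - n - expo V μ + n = (0 : ℕ) by push_cast; ring, cext_natCast, hann n le_rfl,
      Nat.sub_self, annihilation_zero, creation_zero, Module.End.one_apply, Module.End.one_apply,
      map_smul]
  · intro k hk
    rw [cext_eq_zero_of_re_neg, map_zero]
    have : (k : ℝ) < n := by exact_mod_cast Finset.mem_range.mp hk
    simp only [Complex.add_re, Complex.sub_re, Complex.natCast_re]
    linarith
  · exact (isWt_single μ _).map fun f => fockMap_commute_zeroModeFun _ f
  · intro k hk
    rw [hann k (by omega), annihilation_vacuum A V μ 1 (by omega), smul_zero]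

variable {A V W}

/-- The vacua of all momenta determine the constant and the zero mode exponent, the first
excitations determine the oscillator exponents. -/
theorem eq_of_mode_eq (hcharge : V.charge = W.charge) (hpow : V.pow = W.pow)
    (hpowA : V.powA = W.powA) (hA : ∀ m : ℤ, A 0 1 m * A 1 0 m ≠ A 0 0 m * A 1 1 m) {G H : ℂ}
    (hG : G ≠ 0) (h : ∀ c v, G • V.mode A c v = H • W.mode A c v) :
    G = H ∧ V.zero = W.zero ∧ ∀ j, ∀ m ≠ 0, V.osc j m = W.osc j m := by
  have hexpo (μ : Fin 2 → ℂ) : expo V μ = expo W μ := by rw [expo, expo, hpow, hpowA]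
  have hlead (μ : Fin 2 → ℂ) : G • lead A V (Finsupp.single μ (MvPolynomial.C 1)) =
      H • lead A W (Finsupp.single μ (MvPolynomial.C 1)) := by
    have h0 := h (expo V μ + (0 : ℕ)) (Finsupp.single μ (MvPolynomial.C 1))
    rw [mode_vacuum, hexpo, mode_vacuum] at h0
    simpa only [creation_zero, Module.End.one_apply] using h0
  have hexp (μ : Fin 2 → ℂ) : G * Complex.exp (∑ j, V.zero j * μ j) =
      H * Complex.exp (∑ j, W.zero j * μ j) := by
    have h0 := hlead μ
    rw [lead_vacuum, lead_vacuum, hcharge, smul_smul, smul_smul] at h0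
    exact smul_left_injective ℂ (vacuum_ne_zero _) h0
  have hGH : G = H := by simpa using hexp 0
  have hne : G • lead A V (Finsupp.single 0 (MvPolynomial.C 1)) ≠ 0 := by
    rw [lead_vacuum, smul_smul]
    exact smul_ne_zero (mul_ne_zero hG (Complex.exp_ne_zero _)) (vacuum_ne_zero _)
  refine ⟨hGH, ?_, ?_⟩
  · funext j
    by_contra hj
    replace hj := sub_ne_zero.mpr hj
    -- At this momentum the two exponents differ by exactly `1`, which would give `e = 1`.
    have h1 := mul_left_cancel₀ hG ((hexp (Pi.single j (V.zero j - W.zero j)⁻¹)).trans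
      (by rw [hGH]))
    rw [← sub_eq_zero, ← mul_left_inj' (Complex.exp_ne_zero
      (-∑ k, W.zero k * (Pi.single j (V.zero j - W.zero j)⁻¹ : Fin 2 → ℂ) k)), zero_mul, sub_mul,
      ← Complex.exp_add, ← Complex.exp_add, add_neg_cancel, Complex.exp_zero, sub_eq_zero] at h1
    have h2 : ∑ k, V.zero k * (Pi.single j (V.zero j - W.zero j)⁻¹ : Fin 2 → ℂ) k +
        -∑ k, W.zero k * (Pi.single j (V.zero j - W.zero j)⁻¹ : Fin 2 → ℂ) k = 1 := by
      simp only [Pi.single_apply, mul_ite, mul_zero, Finset.sum_ite_eq', Finset.mem_univ, if_true]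
      rw [← sub_eq_add_neg, ← sub_mul, mul_inv_cancel₀ hj]
    rw [h2] at h1
    have h3 := congrArg norm h1
    rw [Complex.norm_exp, Complex.one_re, norm_one, Real.exp_eq_one_iff] at h3
    exact one_ne_zero h3
  · intro j m hm
    obtain ⟨n, rfl | rfl⟩ := Int.eq_nat_or_neg m
    · have hn : n ≠ 0 := by simpa using hm
      have key (l : Fin 2) : ∑ j, (V.osc j n - W.osc j n) * A j l n = 0 := by
        have h1 := h (expo V 0 - n) (cre l n (Finsupp.single 0 (MvPolynomial.C 1)))
        rw [mode_cre_vacuum A V 0 l hn, hexpo, mode_cre_vacuum A W 0 l hn, smul_comm,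
          smul_comm H, ← hlead] at h1
        have h2 := smul_left_injective ℂ hne h1
        have hn' : (n : ℂ) ≠ 0 := by exact_mod_cast hn
        simp only [Fin.sum_univ_two] at h2 ⊢
        field_simp at h2
        linear_combination h2
      have k0 := key 0
      have k1 := key 1
      simp only [Fin.sum_univ_two] at k0 k1
      -- `key` is a homogeneous `2 × 2` system with matrix `A(n)`, solved by Cramer's rule.
      have hd : A 0 0 n * A 1 1 n - A 0 1 n * A 1 0 n ≠ 0 := fun h0 => hA n (by linear_combination -h0)
      have e0 : V.osc 0 n - W.osc 0 n = 0 := by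
        refine (mul_eq_zero.mp (?_ : _ * (A 0 0 n * A 1 1 n - A 0 1 n * A 1 0 n) = 0)).resolve_right
          hd
        linear_combination A 1 1 n * k0 - A 1 0 n * k1
      have e1 : V.osc 1 n - W.osc 1 n = 0 := by
        refine (mul_eq_zero.mp (?_ : _ * (A 0 0 n * A 1 1 n - A 0 1 n * A 1 0 n) = 0)).resolve_right
          hd
        linear_combination -A 0 1 n * k0 + A 0 0 n * k1
      fin_cases j
      · exact sub_eq_zero.mp e0
      · exact sub_eq_zero.mp e1
    · have hn : n ≠ 0 := by simpa using hm
      have h1 := congrArg (der j n) (h (expo V 0 + n) (Finsupp.single 0 (MvPolynomial.C 1)))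
      rw [map_smul, map_smul, der_mode_vacuum A V 0 j hn, hexpo, der_mode_vacuum A W 0 j hn,
        smul_comm, smul_comm H, ← hlead] at h1
      exact smul_left_injective ℂ hne h1

lemma mode_congr (hcharge : V.charge = W.charge) (hpow : V.pow = W.pow)
    (hpowA : V.powA = W.powA) (hzero : V.zero = W.zero)
    (hosc : ∀ j, ∀ m ≠ 0, V.osc j m = W.osc j m) (c : ℂ) (v : Fock) :
    V.mode A c v = W.mode A c v := by
  have h1 : V.creation A = W.creation A := by
    funext n
    rw [← coeff_creX, ← coeff_creX]
    refine congrArg _ ((isExp_creX A V).unique ((isExp_creX A W).congr fun n hn => ?_))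
    simp only [coeff_creD A _ hn]
    exact Finset.sum_congr rfl fun j _ => by rw [hosc j _ (by omega)]
  have h2 : V.annihilation A = W.annihilation A := by
    funext n
    rw [← coeff_annX, ← coeff_annX]
    refine congrArg _ ((isExp_annX A V).unique ((isExp_annX A W).congr fun n hn => ?_))
    simp only [annD, PowerSeries.coeff_mk]
    exact Finset.sum_congr rfl fun j _ => by rw [hosc j _ (by omega)]
  have h3 : V.zPow = W.zPow := by
    funext β
    rw [zPow, zPow, hpow, hpowA]
  rw [mode, mode, h1, h2, h3, hcharge, expZero, expZero, hzero]

end VertexOp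

/-! ## Expansions of `(1 - p u) / (1 - q u)` -/

section Rational

open PowerSeries FormalExp

/-- The coefficients of `(1 - p u) / (1 - q u)`. -/
noncomputable def ratCoeff (p q : ℂ) : ℕ → ℂ
  | 0 => 1
  | n + 1 => (q - p) * q ^ n

lemma mk_pow_mul (q : ℂ) : PowerSeries.mk (fun n => q ^ n) * (1 - C q * X) = 1 := by
  ext n
  rw [mul_sub, mul_one, ← mul_assoc, map_sub]
  cases n with
  | zero => simp
  | succ n => simp [coeff_succ_mul_X, coeff_mul_C, pow_succ, coeff_one]

lemma mk_ratCoeff (p q : ℂ) :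
    PowerSeries.mk (ratCoeff p q) = (1 - C p * X) * PowerSeries.mk (fun n => q ^ n) := by
  ext n
  rw [mul_comm, mul_sub, mul_one, ← mul_assoc, map_sub]
  cases n with
  | zero => simp [ratCoeff]
  | succ n =>
    simp [coeff_succ_mul_X, coeff_mul_C, ratCoeff]
    ring

/-- The logarithmic derivative `u d/du` of `(1 - p u) / (1 - q u)` is `1 / (1 - q u) - 1 / (1 - p
u)`. -/
lemma isExp_ratCoeff (p q : ℂ) :
    IsExp (PowerSeries.mk fun m => (q ^ m - p ^ m) / m) (PowerSeries.mk (ratCoeff p q)) := by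
  refine ⟨by simp [ratCoeff], ?_⟩
  have hD : euler (PowerSeries.mk fun m => (q ^ m - p ^ m) / (m : ℂ)) =
      PowerSeries.mk (fun n => q ^ n) - PowerSeries.mk (fun n => p ^ n) := by
    ext n
    rw [coeff_euler, coeff_mk, map_sub, coeff_mk, coeff_mk]
    rcases eq_or_ne n 0 with rfl | hn
    · simp
    · have : (n : ℂ) ≠ 0 := by exact_mod_cast hn
      rw [smul_eq_mul]
      field_simp
  have hX (a : ℂ) : euler (1 - C a * X) = -(C a * X) := by
    have h1 := euler_X_pow (R := ℂ) 1
    simp only [pow_one, Nat.cast_one, one_smul] at h1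
    rw [euler_sub, euler_C_mul, h1]
    have : euler (1 : PowerSeries ℂ) = 0 := by
      ext n
      rw [coeff_euler, coeff_one]
      split_ifs with h <;> simp [h]
    rw [this, zero_sub]
  have hQ := mk_pow_mul q
  have hP := mk_pow_mul p
  set Q := PowerSeries.mk fun n => q ^ n
  set P := PowerSeries.mk fun n => p ^ n
  have h1 : euler Q * (1 - C q * X) + Q * -(C q * X) = 0 := by
    rw [← hX, ← euler_mul, hQ]
    ext n
    rw [coeff_euler, coeff_one]
    split_ifs with h <;> simp [h]
  rw [mk_ratCoeff, hD, euler_mul, hX]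
  generalize PowerSeries.X (R := ℂ) = x at *
  linear_combination Q * hP + (1 - C p * x) * (-(Q + euler Q - Q ^ 2) * hQ + Q * (h1 - Q * hQ))

/-- The logarithm is unique: scalar power series form a domain, so `Y` cancels from the two Euler
equations. -/
lemma FormalExp.IsExp.coeff_eq {D D' Y : PowerSeries ℂ} (h : IsExp D Y) (h' : IsExp D' Y) {n : ℕ}
    (hn : n ≠ 0) : coeff n D = coeff n D' := by
  have hY : Y ≠ 0 := fun h0 => by
    have := h.zero
    simp [h0] at this
  have h1 := congrArg (coeff n) (mul_right_cancel₀ hY (h.euler_eq.symm.trans h'.euler_eq))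
  rw [coeff_euler, coeff_euler] at h1
  exact smul_right_injective ℂ (Nat.cast_ne_zero.mpr hn : (n : ℂ) ≠ 0) h1

lemma FormalExp.IsExp.eq_mk_ratCoeff_iff {D Y : PowerSeries ℂ} (h : IsExp D Y) (p q : ℂ) :
    Y = PowerSeries.mk (ratCoeff p q) ↔ ∀ n ≠ 0, coeff n D = (q ^ n - p ^ n) / n := by
  constructor
  · rintro rfl n hn
    rw [IsExp.coeff_eq h (isExp_ratCoeff p q) hn, coeff_mk]
  · intro hD
    exact h.unique ((isExp_ratCoeff p q).congr fun n hn => by rw [coeff_mk, hD n hn])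

lemma hasSum_ratCoeff (p : ℂ) {q u : ℂ} (h : ‖q * u‖ < 1) :
    HasSum (fun n => ratCoeff p q n * u ^ n) ((1 - p * u) / (1 - q * u)) := by
  have hne : 1 - q * u ≠ 0 := fun h0 => by
    rw [← sub_eq_zero.mp h0, norm_one] at h
    exact lt_irrefl _ h
  rw [← hasSum_nat_add_iff' 1]
  have h1 := (hasSum_geometric_of_norm_lt_one h).mul_left ((q - p) * u)
  have e1 (n : ℕ) : ratCoeff p q (n + 1) * u ^ (n + 1) = (q - p) * u * (q * u) ^ n := by
    simp only [ratCoeff]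
    ring
  have e2 : (1 - p * u) / (1 - q * u) - ∑ i ∈ Finset.range 1, ratCoeff p q i * u ^ i =
      (q - p) * u * (1 - q * u)⁻¹ := by
    rw [Finset.sum_range_one, ratCoeff, ← div_eq_mul_inv, eq_div_iff hne, sub_mul,
      div_mul_cancel₀ _ hne]
    ring
  simp only [e1]
  rw [e2]
  exact h1

lemma eq_of_hasSum_pow {φ χ : ℕ → ℂ} {f : ℂ → ℂ}
    (hφ : ∀ᶠ u in nhds (0 : ℂ), HasSum (fun n => φ n * u ^ n) (f u))
    (hχ : ∀ᶠ u in nhds (0 : ℂ), HasSum (fun n => χ n * u ^ n) (f u)) : φ = χ := by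
  let ser (a : ℕ → ℂ) : FormalMultilinearSeries ℂ ℂ ℂ := fun n =>
    ContinuousMultilinearMap.mkPiRing ℂ (Fin n) (a n)
  have hser (a : ℕ → ℂ) (n : ℕ) : (ser a).coeff n = a n := by
    simp [ser, FormalMultilinearSeries.coeff]
  have key (a : ℕ → ℂ) (ha : ∀ᶠ u in nhds (0 : ℂ), HasSum (fun n => a n * u ^ n) (f u)) :
      HasFPowerSeriesAt f (ser a) 0 := by
    refine hasFPowerSeriesAt_iff.mpr ?_
    filter_upwards [ha] with u hu
    simpa only [hser, smul_eq_mul, mul_comm, zero_add] using hu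
  have h := (key φ hφ).eq_formalMultilinearSeries (key χ hχ)
  funext n
  rw [← hser φ, h, hser]

/-- `F` depends on `w / z` only, so convergence on a region `|z| > R |w|` is convergence near `u =
0` (take `z = 1`), and the identity theorem for power series applies. -/
lemma hasSum_quotient_iff {φ χ : ℕ → ℂ} {f : ℂ → ℂ} {F : ℂ → ℂ → ℂ} {ρ : ℝ} (hρ : 0 < ρ)
    (hχ : ∀ u, ‖u‖ < ρ → HasSum (fun n => χ n * u ^ n) (f u))
    (hF : ∀ z w, z ≠ 0 → F z w = f (w / z)) :
    (∃ R : ℝ, 0 < R ∧ ∀ z w : ℂ, R * ‖w‖ < ‖z‖ → HasSum (fun n => φ n * (w / z) ^ n) (F z w)) ↔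
      φ = χ := by
  constructor
  · rintro ⟨R, hR, h⟩
    refine eq_of_hasSum_pow (f := f) ?_ ?_
    · filter_upwards [Metric.ball_mem_nhds (0 : ℂ) (inv_pos.mpr hR)] with u hu
      rw [mem_ball_zero_iff] at hu
      have h1 := h 1 u (by
        rw [norm_one, mul_comm]
        exact (lt_inv_mul_iff₀' hR).mp (by simpa using hu))
      rw [hF 1 u one_ne_zero, div_one] at h1
      exact h1
    · filter_upwards [Metric.ball_mem_nhds (0 : ℂ) hρ] with u hu
      exact hχ u (by simpa using hu)
  · rintro rfl
    refine ⟨ρ⁻¹, inv_pos.mpr hρ, fun z w h => ?_⟩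
    have hz : z ≠ 0 := fun h0 => by
      rw [h0, norm_zero] at h
      exact absurd h (not_lt.mpr (by positivity))
    rw [hF z w hz]
    refine hχ _ ?_
    rw [norm_div, div_lt_iff₀ (norm_pos_iff.mpr hz)]
    exact (inv_mul_lt_iff₀ hρ).mp h

/-- With `u = w / z` the function is `(q / p) (1 - p u) / (1 - q u)`. -/
lemma hasSum_locality_left {p q : ℂ} (hp : p ≠ 0) (hq : q ≠ 0) (φ : ℕ → ℂ) :
    (∃ R : ℝ, 0 < R ∧ ∀ z w : ℂ, R * ‖w‖ < ‖z‖ →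
      HasSum (fun n => φ n * (w / z) ^ n) ((w - z / p) / (w - z / q))) ↔
      φ = fun n => q / p * ratCoeff p q n := by
  refine hasSum_quotient_iff (F := fun z w => (w - z / p) / (w - z / q))
    (f := fun u => q / p * ((1 - p * u) / (1 - q * u))) (ρ := ‖q‖⁻¹)
    (inv_pos.mpr (norm_pos_iff.mpr hq)) ?_ ?_
  · intro u hu
    have h := (hasSum_ratCoeff p (q := q) (u := u) (by
      rw [norm_mul]
      exact (lt_inv_mul_iff₀ (norm_pos_iff.mpr hq)).mp (by simpa using hu))).mul_left (q / p)
    simpa only [mul_assoc] using h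
  · intro z w hz
    have h1 : w - z / p = -(z / p) * (1 - p * (w / z)) := by field_simp; ring
    have h2 : w - z / q = -(z / q) * (1 - q * (w / z)) := by field_simp; ring
    rw [h1, h2, mul_div_mul_comm]
    congr 1
    field_simp

/-- With `u = z / w` the function is `(1 - u / p) / (1 - u / q)`, with constant term `1`. -/
lemma hasSum_locality_right {p q : ℂ} (hp : p ≠ 0) (hq : q ≠ 0) (ψ : ℕ → ℂ) :
    (∃ R : ℝ, 0 < R ∧ ∀ z w : ℂ, R * ‖z‖ < ‖w‖ →
      HasSum (fun n => ψ n * (z / w) ^ n) ((w - z / p) / (w - z / q))) ↔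
      ψ = ratCoeff p⁻¹ q⁻¹ := by
  rw [← hasSum_quotient_iff (φ := ψ) (F := fun z w => (z - w / p) / (z - w / q))
    (f := fun u => (1 - p⁻¹ * u) / (1 - q⁻¹ * u)) (ρ := ‖q‖)
    (norm_pos_iff.mpr hq) ?_ ?_]
  · exact exists_congr fun R => and_congr_right fun _ => forall_comm
  · intro u hu
    refine hasSum_ratCoeff _ ?_
    rw [norm_mul, norm_inv]
    exact (inv_mul_lt_iff₀ (norm_pos_iff.mpr hq)).mpr (by simpa using hu)
  · intro z w hz
    have h1 : z - w / p = z * (1 - p⁻¹ * (w / z)) := by field_simp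
    have h2 : z - w / q = z * (1 - q⁻¹ * (w / z)) := by field_simp
    rw [h1, h2, mul_div_mul_left _ _ hz]

end Rational

namespace VertexOp

/-- The commutator of two mutually local vertex operators. -/
lemma commutator_eq (A : Fin 2 → Fin 2 → ℤ → ℂ) (V W : VertexOp) {p q : ℂ} (hp : p ≠ 0) (hq : q ≠ 0)
    (hVW : HasOPE A V W fun n => q / p * ratCoeff p q n)
    (hWV : HasOPE A W V (ratCoeff p⁻¹ q⁻¹)) (a b : ℂ) (v : Fock) :
    V.mode A a (W.mode A b v) - W.mode A b (V.mode A a v) =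
      ∑ᶠ k : ℤ, ((q / p - 1) * q ^ k) • normalMode A V W (a + k) (b - k) v := by
  rw [hVW a b v, hWV b a v]
  set f : ℤ → Fock := fun k => normalMode A V W (a + k) (b - k) v with hf
  have h1 (k : ℕ) : normalMode A V W (a + k) (b - k) v = f k := by simp [hf]
  have h2 (k : ℕ) : normalMode A W V (b + k) (a - k) v = f (-k) := by
    rw [normalMode_comm]
    simp [hf, sub_eq_add_neg]
  simp only [h1, h2]
  have hfin : (Function.support f).Finite := normalMode_finite_int A V W a b v
  obtain ⟨M, hM⟩ : ∃ M : ℕ, ∀ k : ℤ, (M : ℤ) < |k| → f k = 0 := by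
    obtain ⟨M, hM⟩ := (hfin.image fun k => k.natAbs).bddAbove
    refine ⟨M, fun k hk => ?_⟩
    by_contra h0
    have : k.natAbs ≤ M := hM ⟨k, h0, rfl⟩
    rw [Int.abs_eq_natAbs] at hk
    omega
  rw [finsum_eq_sum_of_support_subset (s := Finset.range (M + 1)),
    finsum_eq_sum_of_support_subset (s := Finset.range (M + 1)),
    finsum_eq_sum_of_support_subset (s := (Finset.range (M + 1)).image (fun k : ℕ => (k : ℤ)) ∪
      (Finset.range M).image (fun k : ℕ => -((k + 1 : ℕ) : ℤ))),
    Finset.sum_union, Finset.sum_image, Finset.sum_image]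
  · rw [Finset.sum_range_succ', Finset.sum_range_succ' (fun k => ratCoeff p⁻¹ q⁻¹ k • f (-k)),
      Finset.sum_range_succ']
    -- For `k > 0` only the first product contributes, for `k < 0` only the second, and `k = 0`
    -- leaves `q / p - 1`: the two one-sided expansions join to the bilateral geometric series `(q /
    -- p - 1) q ^ k`.
    have e1 (k : ℕ) : q / p * ratCoeff p q (k + 1) = (q / p - 1) * q ^ ((k + 1 : ℕ) : ℤ) := by
      rw [zpow_natCast]
      simp only [ratCoeff]
      field_simp
      ring
    have e2 (k : ℕ) : (q / p - 1) * q ^ (-((k + 1 : ℕ) : ℤ)) = -ratCoeff p⁻¹ q⁻¹ (k + 1) := by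
      rw [zpow_neg, zpow_natCast]
      simp only [ratCoeff, inv_pow]
      field_simp
      ring
    simp only [e1, e2, neg_smul, Finset.sum_neg_distrib]
    simp only [ratCoeff, Nat.cast_zero, zpow_zero, neg_zero, sub_smul, mul_one]
    abel
  · intro x _ y _ h
    simpa using h
  · intro x _ y _ h
    simpa using h
  · rw [Finset.disjoint_left]
    intro x hx hx'
    simp only [Finset.mem_image] at hx hx'
    obtain ⟨_, _, rfl⟩ := hx
    obtain ⟨_, _, h⟩ := hx'
    omega
  · intro k hk
    have hk0 : f k ≠ 0 := fun h0 => hk (by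
      change _ • f k = 0
      rw [h0, smul_zero])
    have : ¬ (M : ℤ) < |k| := fun h => hk0 (hM k h)
    rw [Finset.coe_union, Finset.coe_image, Finset.coe_image, Set.mem_union, Set.mem_image,
      Set.mem_image]
    rcases le_or_gt 0 k with h | h
    · left
      rw [abs_of_nonneg h] at this
      exact ⟨k.toNat, by simp; omega, by omega⟩
    · right
      rw [abs_of_neg h] at this
      exact ⟨(-k - 1).toNat, by simp; omega, by omega⟩
  · intro k hk
    have hk0 : f (-k) ≠ 0 := fun h0 => hk (by simp [h0])
    have : ¬ (M : ℤ) < |(-k : ℤ)| := fun h => hk0 (hM _ h)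
    rw [abs_neg, Nat.abs_cast] at this
    simp only [Finset.coe_range, Set.mem_Iio]
    omega
  · intro k hk
    have hk0 : f k ≠ 0 := fun h0 => hk (by simp [h0])
    have : ¬ (M : ℤ) < |(k : ℤ)| := fun h => hk0 (hM _ h)
    rw [Nat.abs_cast] at this
    simp only [Finset.coe_range, Set.mem_Iio]
    omega

end VertexOp

/-! ## The conditions as equations for the parameters -/

namespace Params

open VertexOp FormalExp

/-- The `Λ_i` that commutes with `S_j`. -/
def third (j : Fin 2) : Fin 3 := if j = 0 then 2 else 0

lemma sum_fin_three {M : Type*} [AddCommMonoid M] (j : Fin 2) (f : Fin 3 → M) :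
    ∑ i, f i = f j.castSucc + f j.succ + f (third j) := by
  fin_cases j
  · exact Fin.sum_univ_three f
  · rw [Fin.sum_univ_three, add_assoc, add_comm]
    rfl

/-- The system of equations for the parameters that expresses mutual locality, commutativity up to
a total difference, and symmetry, where `L_j = log (q_{j+1,j} / q_{j,j})`. -/
structure Eqs (P : Params) (L : Fin 2 → ℂ) : Prop where
  loc : ∀ i j, ∀ m : ℤ, m ≠ 0 →
    (∑ k, P.lam i k m * P.A k j m) * P.s j (-m) = P.q i j ^ m - P.p i j ^ m
  loc_zero : ∀ i j, Complex.exp (∑ k, P.lam i k 0 * P.A k j 0) = P.q i j / P.p i j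
  diff : ∀ j k, ∀ m : ℤ, m ≠ 0 → P.lam j.castSucc k m - P.lam j.succ k m =
    if k = j then P.s j m * (P.q j.succ j ^ m - P.q j.castSucc j ^ m) else 0
  diff_zero : ∀ j k, P.lam j.castSucc k 0 - P.lam j.succ k 0 = if k = j then -L j else 0
  coeff : ∀ j : Fin 2, P.g j.castSucc * (P.q j.castSucc j / P.p j.castSucc j - 1) =
    -(P.g j.succ * (P.q j.succ j / P.p j.succ j - 1) * Complex.exp (-(P.A j j 0 / 2) * L j))
  symm : ∀ m : ℤ, 0 < m → P.s 0 m * P.A 0 1 m * P.s 1 (-m) = P.s 1 m * P.A 1 0 m * P.s 0 (-m)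
  third : ∀ j, P.p (third j) j = P.q (third j) j

variable {P : Params}

lemma IsHeisenberg.A_neg (h : P.IsHeisenberg) (j k : Fin 2) {m : ℤ} (hm : m ≠ 0) :
    P.A j k m = P.A k j (-m) := by
  fin_cases j <;> fin_cases k
  · simp [h.1 0 m hm, h.1 0 (-m) (by omega)]
  · exact h.2.1 m
  · simpa using (h.2.1 (-m)).symm
  · simp [h.1 1 m hm, h.1 1 (-m) (by omega)]

lemma coeff_contr_lam_S (P : Params) (i : Fin 3) (j : Fin 2) (n : ℕ) :
    PowerSeries.coeff n (contr P.A (P.Lam i) (P.S j)) =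
      ((∑ k, P.lam i k n * P.A k j n) * P.s j (-(n : ℤ))) / n := by
  simp only [contr, PowerSeries.coeff_mk, Lam, S]
  congr 1
  fin_cases j <;> simp <;> ring

lemma coeff_contr_S_lam (P : Params) (i : Fin 3) (j : Fin 2) (n : ℕ) :
    PowerSeries.coeff n (contr P.A (P.S j) (P.Lam i)) =
      ((∑ k, P.lam i k (-(n : ℤ)) * P.A j k n) * P.s j n) / n := by
  simp only [contr, PowerSeries.coeff_mk, Lam, S]
  congr 1
  fin_cases j <;> simp <;> ring

lemma coeff_contr_STilde (P : Params) (i j : Fin 2) (n : ℕ) :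
    PowerSeries.coeff n (contr P.A (P.STilde i) (P.STilde j)) =
      (P.s i n * P.A i j n * P.s j (-(n : ℤ))) / n := by
  simp only [contr, PowerSeries.coeff_mk, STilde, expQMul, S]
  congr 1
  fin_cases i <;> fin_cases j <;> simp

lemma hasOPE_lam_S_iff (P : Params) (i : Fin 3) (j : Fin 2) (φ : ℕ → ℂ) :
    HasOPE P.A (P.Lam i) (P.S j) φ ↔ φ = fun n => Complex.exp (∑ k, P.lam i k 0 * P.A k j 0) *
      PowerSeries.coeff n (opeSeries P.A (P.Lam i) (P.S j)) := by
  rw [hasOPE_iff _ _ _ (by simp [Lam])]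
  have : opeConst P.A (P.Lam i) (P.S j) = Complex.exp (∑ k, P.lam i k 0 * P.A k j 0) := by
    simp only [opeConst, Lam, S]
    congr 1
    refine Finset.sum_congr rfl fun k _ => ?_
    simp [Pi.single_apply]
  rw [this]

lemma hasOPE_S_lam_iff (P : Params) (i : Fin 3) (j : Fin 2) (ψ : ℕ → ℂ) :
    HasOPE P.A (P.S j) (P.Lam i) ψ ↔ ψ = fun n =>
      PowerSeries.coeff n (opeSeries P.A (P.S j) (P.Lam i)) := by
  rw [hasOPE_iff _ _ _ (by simp [Lam])]
  have : opeConst P.A (P.S j) (P.Lam i) = 1 := by simp [opeConst, Lam, S]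
  simp only [this, one_mul]

lemma hasOPE_STilde_iff (P : Params) (i j : Fin 2) (φ : ℕ → ℂ) :
    HasOPE P.A (P.STilde i) (P.STilde j) φ ↔ φ = fun n =>
      PowerSeries.coeff n (opeSeries P.A (P.STilde i) (P.STilde j)) := by
  have hc (k : Fin 2) : (P.STilde j).charge k = 0 := by simp [STilde, expQMul, S]
  rw [hasOPE_iff _ _ _ (by simp [hc])]
  have : opeConst P.A (P.STilde i) (P.STilde j) = 1 := by simp [opeConst, hc]
  simp only [this, one_mul]

/-- With the charges removed only oscillators contract, and two exponentials agree exactly if their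
exponents do. -/
lemma symmetry_iff (P : Params) : P.Symmetry ↔
    ∀ m : ℤ, 0 < m → P.s 0 m * P.A 0 1 m * P.s 1 (-m) = P.s 1 m * P.A 1 0 m * P.s 0 (-m) := by
  have h1 : P.Symmetry ↔
      opeSeries P.A (P.STilde 0) (P.STilde 1) = opeSeries P.A (P.STilde 1) (P.STilde 0) := by
    constructor
    · rintro ⟨φ, h1, h2⟩
      rw [hasOPE_STilde_iff] at h1 h2
      ext n
      exact congrFun (h1.symm.trans h2) n
    · intro h
      refine ⟨_, (hasOPE_STilde_iff P 0 1 _).mpr rfl, (hasOPE_STilde_iff P 1 0 _).mpr ?_⟩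
      rw [h]
  rw [h1]
  constructor
  · intro h m hm
    obtain ⟨n, rfl⟩ := Int.eq_ofNat_of_zero_le hm.le
    have hn : n ≠ 0 := by omega
    have h2 := IsExp.coeff_eq (isExp_opeSeries P.A (P.STilde 0) (P.STilde 1))
      (h ▸ isExp_opeSeries P.A (P.STilde 1) (P.STilde 0)) hn
    rw [coeff_contr_STilde, coeff_contr_STilde] at h2
    exact (div_left_inj' (Nat.cast_ne_zero.mpr hn)).mp h2
  · intro h
    refine (isExp_opeSeries P.A (P.STilde 0) (P.STilde 1)).unique
      ((isExp_opeSeries P.A (P.STilde 1) (P.STilde 0)).congr fun n hn => ?_)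
    rw [coeff_contr_STilde, coeff_contr_STilde, h n (by omega)]

/-- The product `Λ_i S_j` gives the equations with `m > 0` and, through its constant term, the zero
mode equation. The product `S_j Λ_i` gives those with `m < 0`, rewritten by `A_{j,k}(m) =
A_{k,j}(-m)`. -/
lemma mutualLocality_iff (hP : P.IsHeisenberg) (hp : ∀ i j, P.p i j ≠ 0) (hq : ∀ i j, P.q i j ≠ 0) :
    P.MutualLocality ↔
      (∀ i j, ∀ m : ℤ, m ≠ 0 →
        (∑ k, P.lam i k m * P.A k j m) * P.s j (-m) = P.q i j ^ m - P.p i j ^ m) ∧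
      ∀ i j, Complex.exp (∑ k, P.lam i k 0 * P.A k j 0) = P.q i j / P.p i j := by
  have hL (i : Fin 3) (j : Fin 2) : (∃ φ ψ : ℕ → ℂ,
      HasOPE P.A (P.Lam i) (P.S j) φ ∧ HasOPE P.A (P.S j) (P.Lam i) ψ ∧
      (∃ R : ℝ, 0 < R ∧ ∀ z w : ℂ, R * ‖w‖ < ‖z‖ →
        HasSum (fun n => φ n * (w / z) ^ n) ((w - z / P.p i j) / (w - z / P.q i j))) ∧
      (∃ R : ℝ, 0 < R ∧ ∀ z w : ℂ, R * ‖z‖ < ‖w‖ →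
        HasSum (fun n => ψ n * (z / w) ^ n) ((w - z / P.p i j) / (w - z / P.q i j)))) ↔
      (∀ m : ℤ, m ≠ 0 →
        (∑ k, P.lam i k m * P.A k j m) * P.s j (-m) = P.q i j ^ m - P.p i j ^ m) ∧
      Complex.exp (∑ k, P.lam i k 0 * P.A k j 0) = P.q i j / P.p i j := by
    have hne : P.q i j / P.p i j ≠ 0 := div_ne_zero (hq i j) (hp i j)
    have h1 := (isExp_opeSeries P.A (P.Lam i) (P.S j)).eq_mk_ratCoeff_iff (P.p i j) (P.q i j)
    have h2 := (isExp_opeSeries P.A (P.S j) (P.Lam i)).eq_mk_ratCoeff_iff (P.p i j)⁻¹ (P.q i j)⁻¹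
    have hpos : (∀ n : ℕ, n ≠ 0 → PowerSeries.coeff n (contr P.A (P.Lam i) (P.S j)) =
        (P.q i j ^ n - P.p i j ^ n) / n) ↔ ∀ n : ℕ, n ≠ 0 →
        (∑ k, P.lam i k n * P.A k j n) * P.s j (-(n : ℤ)) =
          P.q i j ^ (n : ℤ) - P.p i j ^ (n : ℤ) := by
      refine forall₂_congr fun n hn => ?_
      rw [coeff_contr_lam_S, div_left_inj' (Nat.cast_ne_zero.mpr hn), zpow_natCast, zpow_natCast]
    have hneg : (∀ n : ℕ, n ≠ 0 → PowerSeries.coeff n (contr P.A (P.S j) (P.Lam i)) =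
        ((P.q i j)⁻¹ ^ n - (P.p i j)⁻¹ ^ n) / n) ↔ ∀ n : ℕ, n ≠ 0 →
        (∑ k, P.lam i k (-(n : ℤ)) * P.A k j (-(n : ℤ))) * P.s j (- -(n : ℤ)) =
          P.q i j ^ (-(n : ℤ)) - P.p i j ^ (-(n : ℤ)) := by
      refine forall₂_congr fun n hn => ?_
      have e (k : Fin 2) : P.A k j (-(n : ℤ)) = P.A j k n := by
        rw [hP.A_neg k j (by omega), neg_neg]
      rw [coeff_contr_S_lam, div_left_inj' (Nat.cast_ne_zero.mpr hn), zpow_neg, zpow_neg,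
        zpow_natCast, zpow_natCast, inv_pow, inv_pow, neg_neg]
      simp only [e]
    have hint : (∀ m : ℤ, m ≠ 0 →
        (∑ k, P.lam i k m * P.A k j m) * P.s j (-m) = P.q i j ^ m - P.p i j ^ m) ↔
        (∀ n : ℕ, n ≠ 0 → (∑ k, P.lam i k n * P.A k j n) * P.s j (-(n : ℤ)) =
          P.q i j ^ (n : ℤ) - P.p i j ^ (n : ℤ)) ∧ ∀ n : ℕ, n ≠ 0 →
        (∑ k, P.lam i k (-(n : ℤ)) * P.A k j (-(n : ℤ))) * P.s j (- -(n : ℤ)) =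
          P.q i j ^ (-(n : ℤ)) - P.p i j ^ (-(n : ℤ)) := by
      constructor
      · intro h
        exact ⟨fun n hn => h n (by omega), fun n hn => h (-n) (by omega)⟩
      · rintro ⟨h, h'⟩ m hm
        obtain ⟨n, rfl | rfl⟩ := Int.eq_nat_or_neg m
        · exact h n (by omega)
        · exact h' n (by omega)
    rw [hint, ← hpos, ← hneg, ← h1, ← h2]
    constructor
    · rintro ⟨φ, ψ, hφ, hψ, hl, hr⟩
      rw [hasOPE_lam_S_iff] at hφ
      rw [hasOPE_S_lam_iff] at hψ
      rw [hasSum_locality_left (hp i j) (hq i j)] at hl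
      rw [hasSum_locality_right (hp i j) (hq i j)] at hr
      have h0 : Complex.exp (∑ k, P.lam i k 0 * P.A k j 0) = P.q i j / P.p i j := by
        have := congrFun (hφ.symm.trans hl) 0
        simpa only [(isExp_opeSeries P.A (P.Lam i) (P.S j)).zero, ratCoeff, mul_one] using this
      refine ⟨⟨?_, ?_⟩, h0⟩
      · ext n
        have := congrFun (hφ.symm.trans hl) n
        simp only [h0] at this
        rw [mul_left_cancel₀ hne this, PowerSeries.coeff_mk]
      · ext n
        rw [PowerSeries.coeff_mk]
        exact congrFun (hψ.symm.trans hr) n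
    · rintro ⟨⟨h3, h4⟩, h0⟩
      refine ⟨_, _, (hasOPE_lam_S_iff P i j _).mpr rfl, (hasOPE_S_lam_iff P i j _).mpr rfl,
        (hasSum_locality_left (hp i j) (hq i j) _).mpr ?_,
        (hasSum_locality_right (hp i j) (hq i j) _).mpr ?_⟩
      · rw [h3, h0]
        simp only [PowerSeries.coeff_mk]
      · rw [h4]
        simp only [PowerSeries.coeff_mk]
  constructor
  · intro h
    exact ⟨fun i j => ((hL i j).mp (h i j)).1, fun i j => ((hL i j).mp (h i j)).2⟩
  · intro h i j
    exact (hL i j).mpr ⟨h.1 i j, h.2 i j⟩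

/-- The vertex operator `:Λ_i(z) S_j(e ^ (-ℓ) z):` up to a constant. -/
noncomputable def lamS (P : Params) (i : Fin 3) (j : Fin 2) (ℓ : ℂ) : VertexOp :=
  fuse (P.Lam i) (P.S j) ℓ

/-- The coefficient of `:Λ_i(z) S_j(q_{i,j}⁻¹ z):` in the residue of `[T_1(z), S_j(w)]`. -/
noncomputable def resCoeff (P : Params) (i : Fin 3) (j : Fin 2) (ℓ : ℂ) : ℂ :=
  P.g i * (P.q i j / P.p i j - 1) * Complex.exp (-(P.A j j 0 / 2) * ℓ)

lemma current_eq (P : Params) (ℓ : Fin 3 → Fin 2 → ℂ) (j : Fin 2) (c : ℂ) (v : Fock) :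
    P.current ℓ j c v = P.resCoeff j.castSucc j (ℓ j.castSucc j) •
      (P.lamS j.castSucc j (ℓ j.castSucc j)).mode P.A c v := by
  rw [current, fusion P.A _ _ rfl rfl, smul_smul]
  rfl

lemma mutualLocality_ope (hp : ∀ i j, P.p i j ≠ 0) (hq : ∀ i j, P.q i j ≠ 0)
    (h : P.MutualLocality) (i : Fin 3) (j : Fin 2) :
    HasOPE P.A (P.Lam i) (P.S j) (fun n => P.q i j / P.p i j * ratCoeff (P.p i j) (P.q i j) n) ∧
      HasOPE P.A (P.S j) (P.Lam i) (ratCoeff (P.p i j)⁻¹ (P.q i j)⁻¹) := by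
  obtain ⟨φ, ψ, hφ, hψ, hl, hr⟩ := h i j
  rw [hasSum_locality_left (hp i j) (hq i j)] at hl
  rw [hasSum_locality_right (hp i j) (hq i j)] at hr
  exact ⟨hl ▸ hφ, hr ▸ hψ⟩

/-- The bilateral series of `commutator_eq` is `δ(q_{i,j} w / z)`, on whose support the normally
ordered product fuses. -/
lemma lam_commutator (hp : ∀ i j, P.p i j ≠ 0) {ℓ : Fin 3 → Fin 2 → ℂ}
    (hℓ : ∀ i j, Complex.exp (ℓ i j) = P.q i j) (h : P.MutualLocality) (i : Fin 3) (j : Fin 2)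
    (n : ℤ) (b : ℂ) (v : Fock) :
    P.g i • ((P.Lam i).mode P.A n ((P.S j).mode P.A b v) -
      (P.S j).mode P.A b ((P.Lam i).mode P.A n v)) =
      (Complex.exp (b * ℓ i j) * P.resCoeff i j (ℓ i j)) •
        (P.lamS i j (ℓ i j)).mode P.A (n + b) v := by
  have hq : ∀ i j, P.q i j ≠ 0 := fun i j => hℓ i j ▸ Complex.exp_ne_zero _
  obtain ⟨h1, h2⟩ := mutualLocality_ope hp hq h i j
  rw [commutator_eq P.A _ _ (hp i j) (hq i j) h1 h2]
  have h3 := fusion P.A (P.Lam i) (P.S j) rfl rfl (ℓ i j) (n + b) v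
  set N : ℂ → ℂ → Fock := fun a b => normalMode P.A (P.Lam i) (P.S j) a b v with hN
  have h4 : ∑ᶠ k : ℤ, ((P.q i j / P.p i j - 1) * P.q i j ^ k) • N (n + k) (b - k) =
      ((P.q i j / P.p i j - 1) * Complex.exp (b * ℓ i j)) • ∑ᶠ k : ℤ,
        Complex.exp (-(n + b - k) * ℓ i j) • N k (n + b - k) := by
    -- Shifting the summation index by `n` makes it the exponent of `z` in the normally ordered
    -- product, as `fusion` requires.
    have h5 := finsum_comp_equiv (Equiv.addLeft n)
      (f := fun k : ℤ => Complex.exp (-(n + b - k) * ℓ i j) • N k (n + b - k))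
    rw [← h5, smul_finsum]
    refine finsum_congr fun k => ?_
    have e1 : ((Equiv.addLeft n k : ℤ) : ℂ) = n + k := by simp
    have e2 : P.q i j ^ k = Complex.exp (b * ℓ i j) * Complex.exp (-(n + b - (n + k)) * ℓ i j) := by
      rw [← hℓ i j, ← Complex.exp_int_mul, ← Complex.exp_add]
      congr 1
      ring
    rw [e1, e2, smul_smul, mul_assoc, show (n : ℂ) + b - (n + k) = b - k by ring]
  rw [h4, h3, smul_smul, smul_smul]
  congr 1
  simp only [resCoeff, S]
  ring_nf

lemma T_commutator (hp : ∀ i j, P.p i j ≠ 0) {ℓ : Fin 3 → Fin 2 → ℂ}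
    (hℓ : ∀ i j, Complex.exp (ℓ i j) = P.q i j) (h : P.MutualLocality) (j : Fin 2)
    (n : ℤ) (b : ℂ) (v : Fock) :
    P.TMode n ((P.S j).mode P.A b v) - (P.S j).mode P.A b (P.TMode n v) =
      ∑ i, (Complex.exp (b * ℓ i j) * P.resCoeff i j (ℓ i j)) •
        (P.lamS i j (ℓ i j)).mode P.A (n + b) v := by
  simp only [← lam_commutator hp hℓ h, TMode]
  have hS (w : Fin 3 → Fock) : (P.S j).mode P.A b (∑ i, P.g i • w i) =
      ∑ i, P.g i • (P.S j).mode P.A b (w i) := by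
    simp only [← modeEnd_apply P.A (P.S j), map_sum, map_smul]
  rw [hS, ← Finset.sum_sub_distrib]
  exact Finset.sum_congr rfl fun i _ => (smul_sub _ _ _).symm

lemma lamS_mode_ne_zero (P : Params) (i : Fin 3) (j : Fin 2) (ℓ : ℂ) :
    ∃ c v, (P.lamS i j ℓ).mode P.A c v ≠ 0 := by
  refine ⟨expo (P.lamS i j ℓ) 0 + (0 : ℕ), Finsupp.single 0 (MvPolynomial.C 1), ?_⟩
  rw [mode_vacuum, creation_zero, Module.End.one_apply, lead_vacuum]
  exact smul_ne_zero (Complex.exp_ne_zero _) (vacuum_ne_zero _)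

/-- A Vandermonde argument. -/
lemma eq_zero_of_vandermonde {M : Type*} [AddCommGroup M] [Module ℂ M] {a b c : ℂ}
    (hab : a ≠ b) (hac : a ≠ c) {x y z : M} (h0 : x + y + z = 0)
    (h1 : a • x + b • y + c • z = 0) (h2 : a ^ 2 • x + b ^ 2 • y + c ^ 2 • z = 0) : x = 0 := by
  have h : ((a - b) * (a - c)) • x = 0 := by
    -- The multipliers are the coefficients of `(t - b) (t - c)`, which kills `y` and `z`.
    linear_combination (norm := module) (b * c) • h0 - (b + c) • h1 + h2
  exact (smul_eq_zero.mp h).resolve_left (mul_ne_zero (sub_ne_zero.mpr hab) (sub_ne_zero.mpr hac))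

/-- Delta functions at distinct points are linearly independent, so the residues of the commutator
at the three poles can be compared one by one with those of the total difference. -/
theorem eqs_of_conditions {ℓ : Fin 3 → Fin 2 → ℂ} {B : Fin 2 → ℂ → Fock → Fock}
    (hP : P.IsHeisenberg) (hG : P.Generic) (hℓ : P.IsLogBranch ℓ) (hloc : P.MutualLocality)
    (hcomm : P.Commutativity ℓ B) (hB : ∀ j, ∃ c v, B j c v ≠ 0) (hsymm : P.Symmetry) :
    B = P.current ℓ ∧ P.Eqs (fun j => ℓ j.succ j - ℓ j.castSucc j) ∧
      ∀ j : Fin 2, P.g j.castSucc ≠ 0 ∧ P.g j.succ ≠ 0 ∧ P.p j.castSucc j ≠ P.q j.castSucc j ∧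
        P.p j.succ j ≠ P.q j.succ j := by
  have hp : ∀ i j, P.p i j ≠ 0 := fun i j => (hG.1 i j).1
  have hq : ∀ i j, P.q i j ≠ 0 := fun i j => (hG.1 i j).2
  have hqne (j : Fin 2) {i k : Fin 3} (hik : i ≠ k) : P.q i j ≠ P.q k j := fun h =>
    hik (congrArg Prod.fst (hG.2.1 (a₁ := (i, j)) (a₂ := (k, j)) h))
  have hne1 (j : Fin 2) : j.castSucc ≠ j.succ := by fin_cases j <;> decide
  have hne2 (j : Fin 2) : j.castSucc ≠ third j := by fin_cases j <;> decide
  have hne3 (j : Fin 2) : j.succ ≠ third j := by fin_cases j <;> decide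
  have key (j : Fin 2) (c : ℂ) (v : Fock) :
      P.resCoeff j.castSucc j (ℓ j.castSucc j) •
        (P.lamS j.castSucc j (ℓ j.castSucc j)).mode P.A c v = B j c v ∧
      P.resCoeff j.succ j (ℓ j.succ j) •
        (P.lamS j.succ j (ℓ j.succ j)).mode P.A c v = -B j c v ∧
      P.resCoeff (third j) j (ℓ (third j) j) •
        (P.lamS (third j) j (ℓ (third j) j)).mode P.A c v = 0 := by
    -- The pair of modes `(-k, c + k)` has total exponent `c` for every `k`. The fused operators and
    -- `B_j` are thus always taken at the same mode and only the powers `q ^ k` vary; `k = 0, 1, 2`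
    -- gives a Vandermonde system.
    have h (k : ℕ) : P.q j.castSucc j ^ k • (Complex.exp (c * ℓ j.castSucc j) •
        (P.resCoeff j.castSucc j (ℓ j.castSucc j) •
          (P.lamS j.castSucc j (ℓ j.castSucc j)).mode P.A c v - B j c v)) +
        P.q j.succ j ^ k • (Complex.exp (c * ℓ j.succ j) •
        (P.resCoeff j.succ j (ℓ j.succ j) •
          (P.lamS j.succ j (ℓ j.succ j)).mode P.A c v + B j c v)) +
        P.q (third j) j ^ k • (Complex.exp (c * ℓ (third j) j) •
        (P.resCoeff (third j) j (ℓ (third j) j) •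
          (P.lamS (third j) j (ℓ (third j) j)).mode P.A c v)) = 0 := by
      have h1 := hcomm j (-(k : ℤ)) (c + k) v
      rw [T_commutator hp hℓ.1 hloc, sum_fin_three j] at h1
      have e1 : ((-(k : ℤ) : ℤ) : ℂ) + (c + k) = c := by push_cast; ring
      have e2 (i : Fin 3) : Complex.exp ((c + k) * ℓ i j) =
          P.q i j ^ k * Complex.exp (c * ℓ i j) := by
        rw [← hℓ.1 i j, ← Complex.exp_nat_mul, ← Complex.exp_add]
        congr 1
        ring
      rw [e1] at h1
      simp only [e2] at h1
      linear_combination (norm := module) h1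
    have h0 := h 0
    have h1 := h 1
    have h2 := h 2
    simp only [pow_zero, one_smul, pow_one] at h0 h1
    refine ⟨?_, ?_, ?_⟩
    · have := eq_zero_of_vandermonde (hqne j (hne1 j)) (hqne j (hne2 j)) h0 h1 h2
      exact sub_eq_zero.mp ((smul_eq_zero.mp this).resolve_left (Complex.exp_ne_zero _))
    · rw [add_comm (_ • _) (_ • _)] at h1 h2
      rw [add_comm (Complex.exp (c * ℓ j.castSucc j) • _)] at h0
      have := eq_zero_of_vandermonde (hqne j (hne1 j).symm) (hqne j (hne3 j)) h0 h1 h2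
      exact eq_neg_of_add_eq_zero_left
        ((smul_eq_zero.mp this).resolve_left (Complex.exp_ne_zero _))
    · rw [add_comm _ (P.q (third j) j • _), ← add_assoc] at h1
      rw [add_comm _ (P.q (third j) j ^ 2 • _), ← add_assoc] at h2
      rw [add_comm _ (Complex.exp (c * ℓ (third j) j) • _), ← add_assoc] at h0
      have := eq_zero_of_vandermonde (hqne j (hne2 j).symm) (hqne j (hne3 j).symm) h0 h1 h2
      exact (smul_eq_zero.mp this).resolve_left (Complex.exp_ne_zero _)
  have hK1 (j : Fin 2) : P.resCoeff j.castSucc j (ℓ j.castSucc j) ≠ 0 := fun h0 => by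
    obtain ⟨c, v, hB⟩ := hB j
    exact hB (by rw [← (key j c v).1, h0, zero_smul])
  have hK2 (j : Fin 2) : P.resCoeff j.succ j (ℓ j.succ j) ≠ 0 := fun h0 => by
    obtain ⟨c, v, hB⟩ := hB j
    exact hB (by rw [← neg_eq_zero, ← (key j c v).2.1, h0, zero_smul])
  have hK3 (j : Fin 2) : P.resCoeff (third j) j (ℓ (third j) j) = 0 := by
    obtain ⟨c, v, h⟩ := P.lamS_mode_ne_zero (third j) j (ℓ (third j) j)
    exact (smul_eq_zero.mp (key j c v).2.2).resolve_right h
  have hne {i : Fin 3} {j : Fin 2} {l : ℂ} (h : P.resCoeff i j l ≠ 0) :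
      P.g i ≠ 0 ∧ P.p i j ≠ P.q i j := by
    refine ⟨fun h0 => h (by simp [resCoeff, h0]), fun h0 => h ?_⟩
    rw [resCoeff, h0, div_self (hq i j)]
    simp
  -- The `Λ` that is absent from one current occurs in the other, whose residue is nonzero.
  have hg (j : Fin 2) : P.g (third j) ≠ 0 := by
    fin_cases j
    · exact (hne (hK2 1)).1
    · exact (hne (hK1 0)).1
  -- The two surviving residues are opposite, so the fused operators are proportional and have equal
  -- exponents.
  have hfuse (j : Fin 2) := eq_of_mode_eq (A := P.A) (V := P.lamS j.castSucc j (ℓ j.castSucc j))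
    (W := P.lamS j.succ j (ℓ j.succ j)) (H := -P.resCoeff j.succ j (ℓ j.succ j)) rfl rfl rfl hP.2.2
    (hK1 j) fun c v => by
      rw [neg_smul, (key j c v).1, (key j c v).2.1, neg_neg]
  have hexp (i : Fin 3) (j : Fin 2) (m : ℤ) : Complex.exp (m * ℓ i j) = P.q i j ^ m := by
    rw [Complex.exp_int_mul, hℓ.1]
  refine ⟨?_, ⟨((mutualLocality_iff hP hp hq).mp hloc).1, ((mutualLocality_iff hP hp hq).mp hloc).2,
    ?_, ?_, ?_, (symmetry_iff P).mp hsymm, ?_⟩, fun j => ⟨(hne (hK1 j)).1, (hne (hK2 j)).1,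
      (hne (hK1 j)).2, (hne (hK2 j)).2⟩⟩
  · funext j c v
    rw [current_eq, (key j c v).1]
  · intro j k m hm
    have h := (hfuse j).2.2 k m hm
    simp only [lamS, fuse, Lam, S, hexp] at h
    split_ifs with hk
    · simp only [hk, if_true] at h ⊢
      linear_combination h
    · simp only [hk, if_false] at h
      linear_combination h
  · intro j k
    have h := congrFun (hfuse j).2.1 k
    simp only [lamS, fuse, Lam, S, Pi.single_apply] at h
    split_ifs with hk
    · simp only [hk, if_true] at h ⊢
      simp only [Pi.zero_apply] at h
      linear_combination h
    · simp only [hk, if_false, Pi.zero_apply] at h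
      linear_combination h
  · intro j
    have h := (hfuse j).1
    simp only [resCoeff] at h
    have e : Complex.exp (-(P.A j j 0 / 2) * (ℓ j.succ j - ℓ j.castSucc j)) =
        Complex.exp (-(P.A j j 0 / 2) * ℓ j.succ j) /
          Complex.exp (-(P.A j j 0 / 2) * ℓ j.castSucc j) := by
      rw [← Complex.exp_sub]
      congr 1
      ring
    rw [e, mul_div_assoc', ← neg_div, eq_div_iff (Complex.exp_ne_zero _), h]
  · intro j
    have h := hK3 j
    rw [resCoeff, mul_eq_zero, mul_eq_zero, sub_eq_zero] at h
    have h2 := (h.resolve_right (Complex.exp_ne_zero _)).resolve_left (hg j)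
    rw [div_eq_one_iff_eq (hp _ _)] at h2
    exact h2.symm

theorem conditions_of_eqs {ℓ : Fin 3 → Fin 2 → ℂ} (hP : P.IsHeisenberg) (hp : ∀ i j, P.p i j ≠ 0)
    (hℓ : ∀ i j, Complex.exp (ℓ i j) = P.q i j)
    (h : P.Eqs fun j => ℓ j.succ j - ℓ j.castSucc j) :
    P.MutualLocality ∧ P.Commutativity ℓ (P.current ℓ) ∧ P.Symmetry := by
  have hq : ∀ i j, P.q i j ≠ 0 := fun i j => hℓ i j ▸ Complex.exp_ne_zero _
  have hloc : P.MutualLocality := (mutualLocality_iff hP hp hq).mpr ⟨h.loc, h.loc_zero⟩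
  refine ⟨hloc, ?_, (symmetry_iff P).mpr h.symm⟩
  have hexp (i : Fin 3) (j : Fin 2) (m : ℤ) : Complex.exp (m * ℓ i j) = P.q i j ^ m := by
    rw [Complex.exp_int_mul, hℓ]
  intro j n b v
  rw [T_commutator hp hℓ hloc, sum_fin_three j, current_eq]
  have h3 : P.resCoeff (third j) j (ℓ (third j) j) = 0 := by
    rw [resCoeff, h.third, div_self (hq _ _)]
    simp
  have h2 : P.resCoeff j.succ j (ℓ j.succ j) =
      -P.resCoeff j.castSucc j (ℓ j.castSucc j) := by
    have e : Complex.exp (-(P.A j j 0 / 2) * ℓ j.succ j) =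
        Complex.exp (-(P.A j j 0 / 2) * (ℓ j.succ j - ℓ j.castSucc j)) *
          Complex.exp (-(P.A j j 0 / 2) * ℓ j.castSucc j) := by
      rw [← Complex.exp_add]
      congr 1
      ring
    rw [resCoeff, resCoeff, h.coeff, e]
    ring
  have h1 : (P.lamS j.castSucc j (ℓ j.castSucc j)).mode P.A (n + b) v =
      (P.lamS j.succ j (ℓ j.succ j)).mode P.A (n + b) v := by
    refine mode_congr (A := P.A) (V := P.lamS j.castSucc j (ℓ j.castSucc j))
      (W := P.lamS j.succ j (ℓ j.succ j)) rfl rfl rfl ?_ ?_ (n + b) v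
    · funext k
      have := h.diff_zero j k
      simp only [lamS, fuse, Lam, S, Pi.single_apply]
      split_ifs at this ⊢ with hk
      · linear_combination this
      · linear_combination this
    · intro k m hm
      have := h.diff j k m hm
      simp only [lamS, fuse, Lam, S, hexp]
      split_ifs at this ⊢ with hk
      · rw [hk] at this ⊢
        linear_combination this
      · linear_combination this
  rw [h3, h2, ← h1]
  module

end Params

/-! ## The explicit solutions -/

namespace Params

lemma xpow_ne_zero (ξ y : ℂ) : xpow ξ y ≠ 0 := Complex.exp_ne_zero _

lemma xpow_add (ξ y z : ℂ) : xpow ξ (y + z) = xpow ξ y * xpow ξ z := by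
  rw [xpow, add_mul, Complex.exp_add, xpow, xpow]

lemma xpow_neg (ξ y : ℂ) : xpow ξ (-y) = (xpow ξ y)⁻¹ := by
  rw [xpow, neg_mul, Complex.exp_neg, xpow]

lemma xpow_zero (ξ : ℂ) : xpow ξ 0 = 1 := by simp [xpow]

lemma xpow_zpow (ξ y : ℂ) (m : ℤ) : xpow ξ y ^ m = xpow ξ (y * m) := by
  rw [xpow, ← Complex.exp_int_mul, xpow]
  congr 1
  ring

lemma xpow_ne_one {ξ : ℂ} (hξ : ξ.re ≠ 0) {y : ℝ} (hy : y ≠ 0) : xpow ξ y ≠ 1 := fun h => by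
  have h1 := congrArg norm h
  rw [xpow, Complex.norm_exp, norm_one, Real.exp_eq_one_iff, Complex.re_ofReal_mul] at h1
  exact (mul_ne_zero hy hξ) h1

lemma xpow_sub_ne_zero {ξ : ℂ} (hξ : ξ.re ≠ 0) {y : ℝ} (hy : y ≠ 0) :
    xpow ξ y - xpow ξ (-y) ≠ 0 := fun h => by
  have h1 := sub_eq_zero.mp h
  have h2 : xpow ξ ((2 * y : ℝ) : ℂ) = 1 := by
    rw [Complex.ofReal_mul, Complex.ofReal_ofNat, two_mul, xpow_add]
    nth_rewrite 1 [h1]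
    rw [← xpow_add, neg_add_cancel, xpow_zero]
  exact xpow_ne_one hξ (mul_ne_zero two_ne_zero hy) h2

lemma xnum_ne_zero {ξ : ℂ} (hξ : ξ.re ≠ 0) {y : ℝ} (hy : y ≠ 0) : xnum ξ y ≠ 0 := by
  have h := xpow_sub_ne_zero hξ one_ne_zero
  rw [Complex.ofReal_one] at h
  exact div_ne_zero (xpow_sub_ne_zero hξ hy) h

lemma xnum_neg (ξ y : ℂ) : xnum ξ (-y) = -xnum ξ y := by
  rw [xnum, xnum, neg_neg, ← neg_div, neg_sub]

/-- The numbers that determine a solution: `c_j(m) = s_j(m) s_j(-m)`,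
`d(m) = s_1(m) A_{1,2}(m) s_2(-m)`, `M_{i,j}(m) = λ_{i,j}(m) / s_j(m)` and
`Z_{i,j} = λ_{i,j}(0)`. -/
structure Blueprint (P : Params) (L : ℂ) (c : Fin 2 → ℤ → ℂ) (d : ℤ → ℂ)
    (M : Fin 3 → Fin 2 → ℤ → ℂ) (Z : Fin 3 → Fin 2 → ℂ) : Prop where
  c_ne : ∀ j, ∀ m ≠ 0, c j m ≠ 0
  c_even : ∀ j m, c j (-m) = c j m
  d_even : ∀ m, d (-m) = d m
  det : ∀ m ≠ 0, c 0 m * c 1 m ≠ d m ^ 2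
  sys_zero : ∀ i, ∀ m ≠ 0, M i 0 m * c 0 m + M i 1 m * d m = P.q i 0 ^ m - P.p i 0 ^ m
  sys_one : ∀ i, ∀ m ≠ 0, M i 0 m * d m + M i 1 m * c 1 m = P.q i 1 ^ m - P.p i 1 ^ m
  diff : ∀ j k, ∀ m ≠ 0, M j.castSucc k m - M j.succ k m =
    if k = j then P.q j.succ j ^ m - P.q j.castSucc j ^ m else 0
  zero : ∀ i j, Complex.exp (∑ k, Z i k * P.A k j 0) = P.q i j / P.p i j
  zero_diff : ∀ j k, Z j.castSucc k - Z j.succ k = if k = j then -L else 0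

/-- The formulas for `s_j(m)`, `A_{1,2}(m)` and `λ_{i,j}(m)`, `m ≠ 0`, in terms of a blueprint. -/
structure Follows (P : Params) (c : Fin 2 → ℤ → ℂ) (d : ℤ → ℂ)
    (M : Fin 3 → Fin 2 → ℤ → ℂ) : Prop where
  s_neg : ∀ j, ∀ m < 0, P.s j m = c j m
  A_pos : ∀ m, 0 < m → P.A 0 1 m = d m / c 1 m
  A_neg : ∀ m < 0, P.A 0 1 m = d m / c 0 m
  lam : ∀ i j, ∀ m ≠ 0, P.lam i j m = P.s j m * M i j m

variable {P : Params} {L : ℂ} {c : Fin 2 → ℤ → ℂ} {d : ℤ → ℂ} {M : Fin 3 → Fin 2 → ℤ → ℂ}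
  {Z : Fin 3 → Fin 2 → ℂ}

/-- For positive `m` the normalization `s_j(m) = 1` makes `s_j(-m)` carry all of `c_j`; negative `m`
follows since `c` and `d` are even. -/
lemma Follows.gram (hB : P.Blueprint L c d M Z) (hF : P.Follows c d M) (hC : P.Common) {m : ℤ}
    (hm : m ≠ 0) : (∀ j, P.s j m * P.s j (-m) = c j m) ∧ P.s 0 m * P.A 0 1 m * P.s 1 (-m) = d m ∧
      P.s 1 m * P.A 1 0 m * P.s 0 (-m) = d m := by
  obtain ⟨-, -, hs, -, hA⟩ := hC
  have h0 := hB.c_ne 0 m hm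
  have h1 := hB.c_ne 1 m hm
  rcases lt_or_gt_of_ne hm with h | h
  · have h' : -m > 0 := by omega
    refine ⟨fun j => ?_, ?_, ?_⟩
    · rw [hF.s_neg j m h, hs j _ h', mul_one]
    · rw [hF.s_neg 0 m h, hF.A_neg m h, hs 1 _ h', mul_one, mul_div_cancel₀ _ h0]
    · rw [hF.s_neg 1 m h, hA m hm, hF.A_pos _ h', hs 0 _ h', mul_one, hB.c_even, hB.d_even,
        mul_div_cancel₀ _ h1]
  · have h' : -m < 0 := by omega
    refine ⟨fun j => ?_, ?_, ?_⟩
    · rw [hF.s_neg j _ h', hs j _ h, one_mul, hB.c_even]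
    · rw [hF.s_neg 1 _ h', hF.A_pos m h, hs 0 _ h, one_mul, hB.c_even, div_mul_cancel₀ _ h1]
    · rw [hF.s_neg 0 _ h', hA m hm, hF.A_neg _ h', hs 1 _ h, one_mul, hB.c_even, hB.d_even,
        div_mul_cancel₀ _ h0]

lemma Follows.isHeisenberg (hB : P.Blueprint L c d M Z) (hF : P.Follows c d M) (hC : P.Common)
    (h0 : P.A 0 1 0 = P.A 1 0 0) (hdet : P.A 0 1 0 * P.A 1 0 0 ≠ P.A 0 0 0 * P.A 1 1 0) :
    P.IsHeisenberg := by
  refine ⟨hC.2.2.2.1, fun m => ?_, fun m => ?_⟩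
  · rcases eq_or_ne m 0 with rfl | hm
    · simpa using h0
    · rw [hC.2.2.2.2 (-m) (by omega), neg_neg]
  · rcases eq_or_ne m 0 with rfl | hm
    · exact hdet
    · rw [hC.2.2.2.1 0 m hm, hC.2.2.2.1 1 m hm, mul_one]
      intro h
      obtain ⟨h1, h2, h3⟩ := hF.gram hB hC hm
      refine hB.det m hm ?_
      rw [← h1 0, ← h1 1]
      -- A degenerate `A(m)` would give `c_1 c_2 = d ^ 2`.
      calc P.s 0 m * P.s 0 (-m) * (P.s 1 m * P.s 1 (-m))
          = P.s 0 m * P.s 0 (-m) * (P.s 1 m * P.s 1 (-m)) * (P.A 0 1 m * P.A 1 0 m) := by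
            rw [h, mul_one]
        _ = (P.s 0 m * P.A 0 1 m * P.s 1 (-m)) * (P.s 1 m * P.A 1 0 m * P.s 0 (-m)) := by ring
        _ = d m ^ 2 := by rw [h2, h3, sq]

lemma Follows.eqs (hB : P.Blueprint L c d M Z) (hF : P.Follows c d M) (hC : P.Common)
    (hZ : ∀ i j, P.lam i j 0 = Z i j)
    (hg : ∀ j : Fin 2, P.g j.castSucc * (P.q j.castSucc j / P.p j.castSucc j - 1) =
      -(P.g j.succ * (P.q j.succ j / P.p j.succ j - 1) * Complex.exp (-(P.A j j 0 / 2) * L))) :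
    P.Eqs fun _ => L where
  loc i j m hm := by
    obtain ⟨h1, h2, h3⟩ := hF.gram hB hC hm
    have h4 : ∀ j, P.A j j m = 1 := fun j => hC.2.2.2.1 j m hm
    have h10 := h1 0
    have h11 := h1 1
    rw [Fin.sum_univ_two, hF.lam i 0 m hm, hF.lam i 1 m hm]
    fin_cases j
    · have := hB.sys_zero i m hm
      simp only [Fin.zero_eta, h4]
      linear_combination this + M i 0 m * h10 + M i 1 m * h3
    · have := hB.sys_one i m hm
      simp only [Fin.mk_one, h4]
      linear_combination this + M i 1 m * h11 + M i 0 m * h2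
  loc_zero i j := by
    simp only [hZ, hB.zero]
  diff j k m hm := by
    rw [hF.lam _ _ m hm, hF.lam _ _ m hm, ← mul_sub, hB.diff j k m hm]
    split_ifs with h
    · rw [h]
    · rw [mul_zero]
  diff_zero j k := by
    rw [hZ, hZ, hB.zero_diff]
  coeff := hg
  symm m hm := by
    obtain ⟨-, h2, h3⟩ := hF.gram hB hC hm.ne'
    rw [h2, h3]
  third j := by
    fin_cases j
    · exact hC.2.1
    · exact hC.1

/-- Subtracting the locality equations of `Λ_j` and `Λ_{j+1}` leaves only the oscillator `a_j`, with
a coefficient known from `diff`. This eliminates `λ`. -/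
lemma Eqs.gram {L : Fin 2 → ℂ} (hE : P.Eqs L) (j k : Fin 2) {m : ℤ} (hm : m ≠ 0) :
    P.s j m * (P.q j.succ j ^ m - P.q j.castSucc j ^ m) * P.A j k m * P.s k (-m) =
      (P.q j.castSucc k ^ m - P.p j.castSucc k ^ m) - (P.q j.succ k ^ m - P.p j.succ k ^ m) := by
  rw [← hE.loc _ _ m hm, ← hE.loc _ _ m hm]
  have h0 := hE.diff j 0 m hm
  have h1 := hE.diff j 1 m hm
  simp only [Fin.sum_univ_two]
  fin_cases j
  · simp only [Fin.zero_eta, if_true, Fin.one_eq_zero_iff, OfNat.ofNat_ne_one, if_false] at *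
    linear_combination -P.A 0 k m * P.s k (-m) * h0 - P.A 1 k m * P.s k (-m) * h1
  · simp only [Fin.mk_one, if_true, Fin.zero_eq_one_iff, OfNat.ofNat_ne_one, if_false] at *
    linear_combination -P.A 0 k m * P.s k (-m) * h0 - P.A 1 k m * P.s k (-m) * h1

lemma Blueprint.gram (hB : P.Blueprint L c d M Z) {m : ℤ} (hm : m ≠ 0) (j : Fin 2) :
    (P.q j.succ j ^ m - P.q j.castSucc j ^ m) * c j m =
      (P.q j.castSucc j ^ m - P.p j.castSucc j ^ m) - (P.q j.succ j ^ m - P.p j.succ j ^ m) := by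
  have h0 := hB.diff j 0 m hm
  have h1 := hB.diff j 1 m hm
  fin_cases j
  · have := hB.sys_zero 0 m hm
    have := hB.sys_zero 1 m hm
    simp at *
    linear_combination (-c 0 m) * h0 - d m * h1 + hB.sys_zero 0 m hm - hB.sys_zero 1 m hm
  · simp at *
    linear_combination (-c 1 m) * h1 - d m * h0 + hB.sys_one 1 m hm - hB.sys_one 2 m hm

lemma Blueprint.gram_zero_one (hB : P.Blueprint L c d M Z) {m : ℤ} (hm : m ≠ 0) :
    (P.q 1 0 ^ m - P.q 0 0 ^ m) * d m =
      (P.q 0 1 ^ m - P.p 0 1 ^ m) - (P.q 1 1 ^ m - P.p 1 1 ^ m) := by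
  have h0 := hB.diff 0 0 m hm
  have h1 := hB.diff 0 1 m hm
  simp at h0 h1
  linear_combination (-d m) * h0 - c 1 m * h1 + hB.sys_one 0 m hm - hB.sys_one 1 m hm

/-- The solution and the blueprint satisfy the same identities `gram`; as `q_{j+1,j} ^ m ≠ q_{j,j} ^
m`, these fix `c` and `d`. Then `λ` is fixed by a linear system with nonzero determinant. -/
theorem Eqs.follows {L' : Fin 2 → ℂ} (hE : P.Eqs L') (hB : P.Blueprint L c d M Z)
    (hP : P.IsHeisenberg) (hs : ∀ j, ∀ m > 0, P.s j m = 1)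
    (hq : ∀ j : Fin 2, ∀ m : ℤ, m ≠ 0 → P.q j.succ j ^ m - P.q j.castSucc j ^ m ≠ 0) :
    P.Follows c d M := by
  have hc (j : Fin 2) {m : ℤ} (hm : m ≠ 0) : P.s j m * P.s j (-m) = c j m := by
    refine mul_left_cancel₀ (hq j m hm) ?_
    rw [hB.gram hm j, ← hE.gram j j hm, hP.1 j m hm]
    ring
  have hd {m : ℤ} (hm : m ≠ 0) : P.s 0 m * P.A 0 1 m * P.s 1 (-m) = d m := by
    have h1 : (P.q 1 0 ^ m - P.q 0 0 ^ m) ≠ 0 := hq 0 m hm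
    have h2 := hE.gram 0 1 hm
    refine mul_left_cancel₀ h1 ?_
    rw [hB.gram_zero_one hm]
    refine Eq.trans ?_ h2
    simp only [Fin.castSucc_zero, Fin.succ_zero_eq_one]
    ring
  have hsne (j : Fin 2) {m : ℤ} (hm : m ≠ 0) : P.s j m ≠ 0 := fun h0 => by
    have := hc j hm
    rw [h0, zero_mul] at this
    exact hB.c_ne j m hm this.symm
  have hsneg : ∀ j, ∀ m < 0, P.s j m = c j m := fun j m hm => by
    have := hc j hm.ne
    rwa [hs j (-m) (by omega), mul_one] at this
  refine ⟨hsneg, fun m hm => ?_, fun m hm => ?_, fun i j m hm => ?_⟩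
  · rw [eq_div_iff (hB.c_ne 1 m hm.ne'), ← hB.c_even, ← hsneg 1 (-m) (by omega), ← hd hm.ne',
      hs 0 m hm, one_mul]
  · rw [eq_div_iff (hB.c_ne 0 m hm.ne), ← hsneg 0 m hm, ← hd hm.ne, hs 1 (-m) (by omega), mul_one,
      mul_comm]
  · have hd' : P.s 1 m * P.A 1 0 m * P.s 0 (-m) = d m := by
      have := hd (m := -m) (by omega)
      rw [neg_neg, hB.d_even] at this
      rw [hP.A_neg 1 0 hm, ← this]
      ring
    have e0 := hE.loc i 0 m hm
    have e1 := hE.loc i 1 m hm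
    rw [← hB.sys_zero i m hm, Fin.sum_univ_two, hP.1 0 m hm] at e0
    rw [← hB.sys_one i m hm, Fin.sum_univ_two, hP.1 1 m hm] at e1
    have c0 := hc 0 hm
    have c1 := hc 1 hm
    have hdm := hd hm
    have n0 := hsne 0 hm
    have n1 := hsne 1 hm
    have hdet := sub_ne_zero.mpr (hB.det m hm)
    obtain ⟨u0, hu0⟩ : ∃ u, P.lam i 0 m = P.s 0 m * u :=
      ⟨P.lam i 0 m / P.s 0 m, (mul_div_cancel₀ _ n0).symm⟩
    obtain ⟨u1, hu1⟩ : ∃ u, P.lam i 1 m = P.s 1 m * u :=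
      ⟨P.lam i 1 m / P.s 1 m, (mul_div_cancel₀ _ n1).symm⟩
    rw [hu0, hu1] at e0 e1
    -- The ratios `λ / s` and the blueprint's `M` solve the same system, so their difference solves
    -- the homogeneous one.
    have f0 : (u0 - M i 0 m) * c 0 m + (u1 - M i 1 m) * d m = 0 := by
      linear_combination e0 - u0 * c0 - u1 * hd'
    have f1 : (u0 - M i 0 m) * d m + (u1 - M i 1 m) * c 1 m = 0 := by
      linear_combination e1 - u1 * c1 - u0 * hdm
    have g0 : u0 - M i 0 m = 0 := by
      refine (mul_eq_zero.mp (?_ : _ * (c 0 m * c 1 m - d m ^ 2) = 0)).resolve_right hdet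
      linear_combination c 1 m * f0 - d m * f1
    have g1 : u1 - M i 1 m = 0 := by
      refine (mul_eq_zero.mp (?_ : _ * (c 0 m * c 1 m - d m ^ 2) = 0)).resolve_right hdet
      linear_combination c 0 m * f1 - d m * f0
    fin_cases j
    · exact hu0.trans (by rw [sub_eq_zero.mp g0]; rfl)
    · exact hu1.trans (by rw [sub_eq_zero.mp g1]; rfl)

end Params

/-! ### The three families of blueprints -/

namespace Params

variable {r : ℝ} {ξ : ℂ}

lemma xnum_of_xpow {y T : ℂ} (hT : xpow ξ y = T) :
    xnum ξ y = (T ^ 2 - 1) / (T * (xpow ξ 1 - xpow ξ (-1))) := by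
  subst hT
  rw [xnum, xpow_neg ξ y]
  have := xpow_ne_zero ξ y
  rw [div_mul_eq_div_div]
  congr 1
  field_simp

/-- All the powers of `x` in the formulas, in terms of `X = x ^ m` and `Y = x ^ (r m)`. -/
structure Powers (r : ℝ) (ξ : ℂ) (m : ℤ) (κ X Y T W : ℂ) : Prop where
  κ_ne : κ ≠ 0
  X_ne : X ≠ 0
  Y_ne : Y ≠ 0
  X_two : X ^ 2 - 1 ≠ 0
  X_four : X ^ 2 + 1 ≠ 0
  T_ne : T ≠ 0
  Y_two : Y ^ 2 - 1 ≠ 0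
  YX_sub : Y ^ 2 - X ^ 2 ≠ 0
  W_ne : W ≠ 0
  T_eq : T = X ^ 4 + X ^ 2 + 1
  W_eq : W = X ^ 2 * Y ^ 2 - 1
  κ_eq : xpow ξ 1 - xpow ξ (-1) = κ
  num_one : xnum ξ m = (X ^ 2 - 1) / (X * κ)
  num_two : xnum ξ (2 * m) = (X ^ 2 - 1) * (X ^ 2 + 1) / (X ^ 2 * κ)
  num_three : xnum ξ (3 * m) = (X ^ 2 - 1) * T / (X ^ 3 * κ)
  num_r : xnum ξ (r * m) = (Y ^ 2 - 1) / (Y * κ)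
  num_r_sub : xnum ξ ((r - 1) * m) = (Y ^ 2 - X ^ 2) / (X * Y * κ)
  num_r_add : xnum ξ ((r + 1) * m) = W / (X * Y * κ)
  pow_a : xpow ξ ((r + 2) * m) = Y * X ^ 2
  pow_b : xpow ξ ((r - 1) * m) = Y / X
  pow_c : xpow ξ (2 * r * m) = Y ^ 2
  zpow_zero : xpow ξ 0 ^ m = 1
  zpow_one : xpow ξ 1 ^ m = X
  zpow_two : xpow ξ 2 ^ m = X ^ 2
  zpow_three : xpow ξ 3 ^ m = X ^ 3
  zpow_a : xpow ξ (2 * r) ^ m = Y ^ 2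
  zpow_b : xpow ξ (2 * r + 1) ^ m = Y ^ 2 * X
  zpow_c : xpow ξ (2 * r - 1) ^ m = Y ^ 2 / X
  zpow_d : xpow ξ (2 * r - 2) ^ m = Y ^ 2 / X ^ 2
  zpow_e : xpow ξ (r - 1) ^ m = Y / X
  zpow_f : xpow ξ (3 * r - 1) ^ m = Y ^ 3 / X
  zpow_g : xpow ξ (r + 1) ^ m = Y * X

/-- Each factor that has to be nonzero comes from a power of `x` with nonzero real exponent, and
`|x| ≠ 1`. The quantities `κ`, `X`, `Y`, `T`, `W` are existential, hence atoms for `field_simp`, so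
that `T` and `W` can be cleared as denominators before they are expanded. -/
lemma exists_powers (hr : 1 < r) (hξ : ξ.re ≠ 0) {m : ℤ} (hm : m ≠ 0) :
    ∃ κ X Y T W, Powers r ξ m κ X Y T W := by
  have hm' : (m : ℝ) ≠ 0 := Int.cast_ne_zero.mpr hm
  have hX0 := xpow_ne_zero ξ m
  have hY0 := xpow_ne_zero ξ (r * m)
  have hκ := xpow_sub_ne_zero hξ one_ne_zero
  rw [Complex.ofReal_one] at hκ
  have h2 : xpow ξ (2 * m) = xpow ξ m ^ 2 := by rw [two_mul, xpow_add, sq]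
  have h3 : xpow ξ (3 * m) = xpow ξ m ^ 3 := by
    rw [show (3 : ℂ) * m = m + m + m by ring, xpow_add, xpow_add]; ring
  have h4 : xpow ξ (4 * m) = xpow ξ m ^ 4 := by
    rw [show (4 : ℂ) * m = m + m + m + m by ring, xpow_add, xpow_add, xpow_add]; ring
  have h6 : xpow ξ (6 * m) = xpow ξ m ^ 6 := by
    rw [show (6 : ℂ) * m = 3 * m + 3 * m by ring, xpow_add, h3]; ring
  have h2r : xpow ξ (2 * r * m) = xpow ξ (r * m) ^ 2 := by
    rw [show (2 : ℂ) * r * m = r * m + r * m by ring, xpow_add, sq]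
  have hsub : xpow ξ ((r - 1) * m) = xpow ξ (r * m) / xpow ξ m := by
    rw [show ((r : ℂ) - 1) * m = r * m + -m by ring, xpow_add, xpow_neg, div_eq_mul_inv]
  have hadd : xpow ξ ((r + 1) * m) = xpow ξ (r * m) * xpow ξ m := by
    rw [show ((r : ℂ) + 1) * m = r * m + m by ring, xpow_add]
  have e2 : xpow ξ m ^ 2 ≠ 1 := by
    have := xpow_ne_one hξ (y := 2 * m) (by simpa using hm)
    push_cast at this
    rwa [h2] at this
  have e4 : xpow ξ m ^ 4 ≠ 1 := by
    have := xpow_ne_one hξ (y := 4 * m) (by simpa using hm)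
    push_cast at this
    rwa [h4] at this
  have e6 : xpow ξ m ^ 6 ≠ 1 := by
    have := xpow_ne_one hξ (y := 6 * m) (by simpa using hm)
    push_cast at this
    rwa [h6] at this
  have er : xpow ξ (r * m) ^ 2 ≠ 1 := by
    have := xpow_ne_one hξ (y := 2 * r * m) (by simp [hm]; linarith)
    push_cast at this
    rwa [h2r] at this
  have es : xpow ξ (r * m) ^ 2 ≠ xpow ξ m ^ 2 := fun h => by
    have := xpow_ne_one hξ (y := 2 * (r - 1) * m) (by simp [hm]; linarith)
    push_cast at this
    rw [show (2 : ℂ) * (r - 1) * m = (r - 1) * m + (r - 1) * m by ring, xpow_add, hsub,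
      div_mul_div_comm, ← sq, ← sq, h, div_self (pow_ne_zero _ hX0)] at this
    exact this rfl
  have ea : xpow ξ m ^ 2 * xpow ξ (r * m) ^ 2 ≠ 1 := fun h => by
    have := xpow_ne_one hξ (y := 2 * (r + 1) * m) (by simp [hm]; linarith)
    push_cast at this
    rw [show (2 : ℂ) * (r + 1) * m = (r + 1) * m + (r + 1) * m by ring, xpow_add, hadd] at this
    exact this (by rw [← h]; ring)
  refine ⟨xpow ξ 1 - xpow ξ (-1), xpow ξ m, xpow ξ (r * m),
    xpow ξ m ^ 4 + xpow ξ m ^ 2 + 1, xpow ξ m ^ 2 * xpow ξ (r * m) ^ 2 - 1, ?_⟩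
  constructor
  case κ_eq => rfl
  case κ_ne => exact hκ
  case X_ne => exact hX0
  case Y_ne => exact hY0
  case X_two => exact sub_ne_zero.mpr e2
  case X_four => exact fun h => e4 (by linear_combination (xpow ξ m ^ 2 - 1) * h)
  case T_eq => rfl
  case W_eq => rfl
  case T_ne => exact fun h => e6 (by linear_combination (xpow ξ m ^ 2 - 1) * h)
  case Y_two => exact sub_ne_zero.mpr er
  case YX_sub => exact sub_ne_zero.mpr es
  case W_ne => exact sub_ne_zero.mpr ea
  case num_one => exact xnum_of_xpow rfl
  case num_two => rw [xnum_of_xpow h2]; congr 1; ring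
  case num_three => rw [xnum_of_xpow h3]; congr 1; ring
  case num_r => exact xnum_of_xpow rfl
  case num_r_sub => rw [xnum_of_xpow hsub]; field_simp
  case num_r_add => rw [xnum_of_xpow hadd]; congr 1 <;> ring
  case pow_a => rw [← h2, ← xpow_add]; congr 1; ring
  case pow_b => exact hsub
  case pow_c => exact h2r
  case zpow_zero => rw [xpow_zero, one_zpow]
  case zpow_one => rw [xpow_zpow, one_mul]
  case zpow_two => rw [xpow_zpow, h2]
  case zpow_three => rw [xpow_zpow, h3]
  case zpow_a => rw [xpow_zpow, h2r]
  case zpow_b => rw [xpow_zpow, ← h2r, ← xpow_add]; congr 1; ring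
  case zpow_c => rw [xpow_zpow, ← h2r, div_eq_mul_inv, ← xpow_neg, ← xpow_add]; congr 1; ring
  case zpow_d =>
    rw [xpow_zpow, ← h2r, ← h2, div_eq_mul_inv, ← xpow_neg, ← xpow_add]; congr 1; ring
  case zpow_e => rw [xpow_zpow, hsub]
  case zpow_f =>
    rw [xpow_zpow, pow_succ, ← h2r, div_eq_mul_inv, ← xpow_neg, ← xpow_add, ← xpow_add]
    congr 1; ring
  case zpow_g => rw [xpow_zpow, hadd]

/-- The values of `A_{i,j}(0)`, and the exponents of `x` in `q_{j,j}`, `q_{j+1,j}` and in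
`p_{j,j}`, `p_{j+1,j}`. -/
structure Frame (P : Params) (ξ : ℂ) (A0 qe pe : Matrix (Fin 2) (Fin 2) ℂ) : Prop where
  A_zero : ∀ i j, P.A i j 0 = A0 i j
  q_castSucc : ∀ j : Fin 2, P.q j.castSucc j = xpow ξ (qe j 0)
  q_succ : ∀ j : Fin 2, P.q j.succ j = xpow ξ (qe j 1)
  p_castSucc : ∀ j : Fin 2, P.p j.castSucc j = xpow ξ (pe j 0)
  p_succ : ∀ j : Fin 2, P.p j.succ j = xpow ξ (pe j 1)
  third : ∀ j, P.p (third j) j = P.q (Params.third j) j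

lemma Frame.entries {P : Params} {A0 qe pe : Matrix (Fin 2) (Fin 2) ℂ}
    (h : P.Frame ξ A0 qe pe) :
    (P.q 0 0 = xpow ξ (qe 0 0) ∧ P.q 1 0 = xpow ξ (qe 0 1) ∧ P.q 1 1 = xpow ξ (qe 1 0) ∧
      P.q 2 1 = xpow ξ (qe 1 1)) ∧
    (P.p 0 0 = xpow ξ (pe 0 0) ∧ P.p 1 0 = xpow ξ (pe 0 1) ∧ P.p 1 1 = xpow ξ (pe 1 0) ∧
      P.p 2 1 = xpow ξ (pe 1 1)) ∧ P.p 0 1 = P.q 0 1 ∧ P.p 2 0 = P.q 2 0 :=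
  ⟨⟨h.q_castSucc 0, h.q_succ 0, h.q_castSucc 1, h.q_succ 1⟩,
    ⟨h.p_castSucc 0, h.p_succ 0, h.p_castSucc 1, h.p_succ 1⟩, h.third 1, h.third 0⟩

/-- The matrix `A(0)` in Case 1. -/
noncomputable def zeroA1 (r : ℝ) : Matrix (Fin 2) (Fin 2) ℂ :=
  !![2 * (r - 1) / r, -((r - 1) / r); -((r - 1) / r), 2 * (r - 1) / r]

/-- The matrix `A(0)` in Case 2. -/
noncomputable def zeroA2 (r : ℝ) : Matrix (Fin 2) (Fin 2) ℂ :=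
  !![2 * (r - 1) / r, -((r - 1) / r); -((r - 1) / r), 1]

/-- The matrix `A(0)` in Case 3. -/
noncomputable def zeroA3 (r : ℝ) : Matrix (Fin 2) (Fin 2) ℂ :=
  !![1, -(1 / r); -(1 / r), 1]

/-- The exponents of the `q_{i,j}` in Cases 1 and 2. -/
noncomputable def qExp (r : ℝ) : Matrix (Fin 2) (Fin 2) ℂ := !![0, 2 * r; 1, 2 * r + 1]

/-- The exponents of the `p_{i,j}` in Case 1. -/
noncomputable def pExp1 (r : ℝ) : Matrix (Fin 2) (Fin 2) ℂ := !![2 * r - 2, 2; 2 * r - 1, 3]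

/-- The exponents of the `p_{i,j}` in Case 2. -/
noncomputable def pExp2 (r : ℝ) : Matrix (Fin 2) (Fin 2) ℂ :=
  !![2 * r - 2, 2; 2 * r - 1, 2 * r - 1]

/-- The exponents of the `q_{i,j}` in Case 3. -/
noncomputable def qExp3 (r : ℝ) : Matrix (Fin 2) (Fin 2) ℂ := !![0, 2 * r; r - 1, 3 * r - 1]

/-- The exponents of the `p_{i,j}` in Case 3. -/
noncomputable def pExp3 (r : ℝ) : Matrix (Fin 2) (Fin 2) ℂ :=
  !![2 * r - 2, 2 * r - 2; r + 1, r + 1]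

/-- The value of `s_j(m) s_j(-m)` if `A_{j,j}(0) ≠ 1`. -/
noncomputable def cBoson (r : ℝ) (ξ : ℂ) (m : ℤ) : ℂ :=
  -(xnum ξ ((r - 1) * m) * xnum ξ (2 * m) / (xnum ξ (r * m) * xnum ξ m))

/-- The value of `s_1(m) A_{1,2}(m) s_2(-m)` in Cases 1 and 2. -/
noncomputable def dBoson (r : ℝ) (ξ : ℂ) (m : ℤ) : ℂ := xnum ξ ((r - 1) * m) / xnum ξ (r * m)

/-- The value of `s_1(m) A_{1,2}(m) s_2(-m)` in Case 3. -/
noncomputable def dFermion (r : ℝ) (ξ : ℂ) (m : ℤ) : ℂ := xnum ξ m / xnum ξ (r * m)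

/-- The value of `λ_{i,j}(m) / s_j(m)` in Case 1. -/
noncomputable def lamRatio1 (r : ℝ) (ξ : ℂ) (i : Fin 3) (j : Fin 2) (m : ℤ) : ℂ :=
  -(xnum ξ (r * m) / xnum ξ (3 * m)) * (xpow ξ 1 - xpow ξ (-1)) *
    (if (j : ℕ) < (i : ℕ) then xpow ξ ((r + 2) * m) * xnum ξ (((j : ℕ) + 1) * m)
      else xpow ξ ((r - 1) * m) * xnum ξ (((j : ℕ) + 1 - 3) * m))

/-- The value of `λ_{i,j}(m) / s_j(m)` in Cases 2 and 3. -/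
noncomputable def lamRatio (r : ℝ) (ξ : ℂ) (k : Matrix (Fin 3) (Fin 2) ℂ) (i : Fin 3) (j : Fin 2)
    (m : ℤ) : ℂ :=
  xnum ξ (r * m) / xnum ξ ((r + 1) * m) * (xpow ξ 1 - xpow ξ (-1)) *
    (if (j : ℕ) < (i : ℕ) then -(xpow ξ (2 * r * m) * xnum ξ (k i j * m))
      else xpow ξ ((r - 1) * m) * xnum ξ (k i j * m))

/-- The value of `λ_{i,j}(0)` in Case 1. -/
noncomputable def lamZero1 (r : ℝ) (ξ : ℂ) (i : Fin 3) (j : Fin 2) : ℂ :=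
  2 * r / 3 * ξ * (if (j : ℕ) < (i : ℕ) then ((j : ℕ) : ℂ) + 1 else ((j : ℕ) : ℂ) + 1 - 3)

/-- The value of `λ_{i,j}(0)` in Cases 2 and 3. -/
noncomputable def lamZero (r : ℝ) (ξ : ℂ) (k : Matrix (Fin 3) (Fin 2) ℂ) (i : Fin 3) (j : Fin 2) :
    ℂ :=
  2 * r / (r + 1) * ξ * (if (j : ℕ) < (i : ℕ) then k i j else -k i j)

/-- The matrix `k` in Case 2. -/
noncomputable def kMat2 (r : ℝ) : Matrix (Fin 3) (Fin 2) ℂ := !![(r : ℂ), r - 1; 1, r - 1; 1, 2]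

/-- The matrix `k` in Case 3. -/
noncomputable def kMat3 (r : ℝ) : Matrix (Fin 3) (Fin 2) ℂ := !![(r : ℂ), 1; 1, 1; 1, r]

lemma cBoson_neg (m : ℤ) : cBoson r ξ (-m) = cBoson r ξ m := by
  simp only [cBoson, Int.cast_neg, mul_neg, xnum_neg, neg_mul, neg_neg]

lemma dBoson_neg (m : ℤ) : dBoson r ξ (-m) = dBoson r ξ m := by
  simp only [dBoson, Int.cast_neg, mul_neg, xnum_neg, neg_div_neg_eq]

lemma dFermion_neg (m : ℤ) : dFermion r ξ (-m) = dFermion r ξ m := by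
  simp only [dFermion, Int.cast_neg, mul_neg, xnum_neg, neg_div_neg_eq]

namespace Powers

variable {m : ℤ} {κ X Y T W : ℂ}

lemma cBoson_eq (h : Powers r ξ m κ X Y T W) :
    cBoson r ξ m = -((Y ^ 2 - X ^ 2) * (X ^ 2 + 1) / (X ^ 2 * (Y ^ 2 - 1))) := by
  obtain ⟨hκ, hX, hY, h1, h2, h3, h4, h5, h6⟩ := id h
  rw [cBoson, h.num_r_sub, h.num_two, h.num_r, h.num_one]
  field_simp

lemma dBoson_eq (h : Powers r ξ m κ X Y T W) :
    dBoson r ξ m = (Y ^ 2 - X ^ 2) / (X * (Y ^ 2 - 1)) := by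
  obtain ⟨hκ, hX, hY, h1, h2, h3, h4, h5, h6⟩ := id h
  rw [dBoson, h.num_r_sub, h.num_r]
  field_simp

lemma dFermion_eq (h : Powers r ξ m κ X Y T W) :
    dFermion r ξ m = Y * (X ^ 2 - 1) / (X * (Y ^ 2 - 1)) := by
  obtain ⟨hκ, hX, hY, h1, h2, h3, h4, h5, h6⟩ := id h
  rw [dFermion, h.num_one, h.num_r]
  field_simp

lemma dBoson_div_cBoson (h : Powers r ξ m κ X Y T W) :
    dBoson r ξ m / cBoson r ξ m = -(xnum ξ m / xnum ξ (2 * m)) := by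
  rw [h.dBoson_eq, h.cBoson_eq, h.num_one, h.num_two]
  obtain ⟨hκ, hX, hY, h1, h2, h3, h4, h5, h6⟩ := id h
  field_simp

lemma lamRatio1_eq (h : Powers r ξ m κ X Y T W) (i : Fin 3) (j : Fin 2) :
    lamRatio1 r ξ i j m = (Y ^ 2 - 1) / T *
      !![X ^ 2 + 1, X; -X ^ 4, X; -X ^ 4, -(X ^ 3 * (X ^ 2 + 1))] i j := by
  have e1 : (1 : ℂ) - 3 = -2 := by norm_num
  have e2 : (2 : ℂ) - 3 = -1 := by norm_num
  have e3 : (1 : ℂ) + 1 = 2 := by norm_num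
  obtain ⟨hκ, hX, hY, h1, h2, h3, h4, h5, h6⟩ := id h
  fin_cases i <;> fin_cases j <;> rw [lamRatio1, h.num_r, h.num_three, h.κ_eq, h.pow_a, h.pow_b] <;>
    simp [e1, e2, e3, xnum_neg, h.num_one, h.num_two] <;> field_simp

lemma lamRatio2_eq (h : Powers r ξ m κ X Y T W) (i : Fin 3) (j : Fin 2) :
    lamRatio r ξ (kMat2 r) i j m = (Y ^ 2 - 1) / W *
      !![Y ^ 2 - 1, (Y ^ 2 - X ^ 2) / X; -(Y ^ 2 * (X ^ 2 - 1)), (Y ^ 2 - X ^ 2) / X;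
        -(Y ^ 2 * (X ^ 2 - 1)), -(Y ^ 2 * (X ^ 2 - 1) * (X ^ 2 + 1) / X)] i j := by
  obtain ⟨hκ, hX, hY, h1, h2, h3, h4, h5, h6⟩ := id h
  fin_cases i <;> fin_cases j <;> rw [lamRatio, h.num_r, h.num_r_add, h.κ_eq, h.pow_b, h.pow_c] <;>
    simp [kMat2, h.num_one, h.num_two, h.num_r, h.num_r_sub] <;> field_simp

lemma lamRatio3_eq (h : Powers r ξ m κ X Y T W) (i : Fin 3) (j : Fin 2) :
    lamRatio r ξ (kMat3 r) i j m = (Y ^ 2 - 1) / W *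
      !![Y ^ 2 - 1, Y * (X ^ 2 - 1) / X; -(Y ^ 2 * (X ^ 2 - 1)), Y * (X ^ 2 - 1) / X;
        -(Y ^ 2 * (X ^ 2 - 1)), -((Y ^ 2 - 1) * X * Y)] i j := by
  obtain ⟨hκ, hX, hY, h1, h2, h3, h4, h5, h6⟩ := id h
  fin_cases i <;> fin_cases j <;> rw [lamRatio, h.num_r, h.num_r_add, h.κ_eq, h.pow_b, h.pow_c] <;>
    simp [kMat3, h.num_one, h.num_r] <;> field_simp

end Powers

lemma exp_eq_xpow_div {t y z : ℂ} (h : t = y * ξ - z * ξ) : Complex.exp t = xpow ξ y / xpow ξ z := by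
  rw [h, Complex.exp_sub, xpow, xpow]

lemma exp_eq_one_of_eq_zero {t : ℂ} (h : t = 0) : Complex.exp t = 1 := by rw [h, Complex.exp_zero]

variable {P : Params}

theorem Frame.blueprint1 (hr : 1 < r) (hξ : ξ.re ≠ 0) (hF : P.Frame ξ (zeroA1 r) (qExp r) (pExp1 r))
    (hq : ∀ i j, P.q i j ≠ 0) :
    P.Blueprint (2 * r * ξ) (fun _ => cBoson r ξ) (dBoson r ξ) (lamRatio1 r ξ) (lamZero1 r ξ) := by
  obtain ⟨⟨q00, q10, q11, q21⟩, ⟨p00, p10, p11, p21⟩, p01, p20⟩ := hF.entries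
  simp only [qExp, pExp1, Matrix.of_apply, Matrix.cons_val] at q00 q10 q11 q21 p00 p10 p11 p21
  have hA := hF.A_zero
  have hr0 : (r : ℂ) ≠ 0 := by exact_mod_cast (by linarith : r ≠ 0)
  refine ⟨fun j m hm => ?_, fun j m => cBoson_neg m, dBoson_neg, fun m hm => ?_, fun i m hm => ?_,
    fun i m hm => ?_, fun j k m hm => ?_, fun i j => ?_, fun j k => ?_⟩
  · obtain ⟨κ, X, Y, T, W, h⟩ := exists_powers hr hξ hm
    rw [h.cBoson_eq]
    obtain ⟨hκ, hX, hY, h1, h2, h3, h4, h5, h6⟩ := id h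
    simp [*]
  · obtain ⟨κ, X, Y, T, W, h⟩ := exists_powers hr hξ hm
    rw [h.cBoson_eq, h.dBoson_eq]
    obtain ⟨hκ, hX, hY, h1, h2, h3, h4, h5, h6⟩ := id h
    intro e
    field_simp at e
    -- The determinant `c ^ 2 - d ^ 2` is a nonzero multiple of `T`.
    exact h3 (by linear_combination h.T_eq + e)
  · obtain ⟨κ, X, Y, T, W, h⟩ := exists_powers hr hξ hm
    rw [h.cBoson_eq, h.dBoson_eq, h.lamRatio1_eq, h.lamRatio1_eq]
    obtain ⟨hκ, hX, hY, h1, h2, h3, h4, h5, h6⟩ := id h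
    fin_cases i <;> simp [q00, q10, p00, p10, p20, h.zpow_zero, h.zpow_a, h.zpow_two, h.zpow_d] <;>
      field_simp <;> (try rw [h.T_eq]) <;> ring
  · obtain ⟨κ, X, Y, T, W, h⟩ := exists_powers hr hξ hm
    rw [h.cBoson_eq, h.dBoson_eq, h.lamRatio1_eq, h.lamRatio1_eq]
    obtain ⟨hκ, hX, hY, h1, h2, h3, h4, h5, h6⟩ := id h
    fin_cases i <;> simp [q11, q21, p11, p21, p01, h.zpow_one, h.zpow_b, h.zpow_c, h.zpow_three] <;>
      field_simp <;> (try rw [h.T_eq]) <;> ring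
  · obtain ⟨κ, X, Y, T, W, h⟩ := exists_powers hr hξ hm
    rw [h.lamRatio1_eq, h.lamRatio1_eq]
    obtain ⟨hκ, hX, hY, h1, h2, h3, h4, h5, h6⟩ := id h
    fin_cases j <;> fin_cases k <;>
      simp [q00, q10, q11, q21, h.zpow_zero, h.zpow_one, h.zpow_a, h.zpow_b] <;>
      field_simp <;> (try rw [h.T_eq]) <;> ring
  · fin_cases i <;> fin_cases j <;>
      simp [hA, zeroA1, lamZero1, q00, q10, q11, q21, p00, p10, p11, p21, p01, p20, hq] <;>
      first | (apply exp_eq_xpow_div; field_simp; ring) | (apply exp_eq_one_of_eq_zero; field_simp; ring)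
  · fin_cases j <;> fin_cases k <;> simp [lamZero1] <;> ring

theorem Frame.blueprint2 (hr : 1 < r) (hξ : ξ.re ≠ 0) (hF : P.Frame ξ (zeroA2 r) (qExp r) (pExp2 r))
    (hq : ∀ i j, P.q i j ≠ 0) :
    P.Blueprint (2 * r * ξ) ![cBoson r ξ, fun _ => -1] (dBoson r ξ) (lamRatio r ξ (kMat2 r)) (lamZero r ξ (kMat2 r)) := by
  obtain ⟨⟨q00, q10, q11, q21⟩, ⟨p00, p10, p11, p21⟩, p01, p20⟩ := hF.entries
  simp only [qExp, pExp2, Matrix.of_apply, Matrix.cons_val] at q00 q10 q11 q21 p00 p10 p11 p21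
  have hA := hF.A_zero
  have hr0 : (r : ℂ) ≠ 0 := by exact_mod_cast (by linarith : r ≠ 0)
  have hr1 : (r : ℂ) + 1 ≠ 0 := by exact_mod_cast (by linarith : r + 1 ≠ 0)
  refine ⟨Fin.forall_fin_two.mpr ⟨fun m hm => ?_, fun m hm => ?_⟩,
    Fin.forall_fin_two.mpr ⟨cBoson_neg, fun m => rfl⟩, dBoson_neg, fun m hm => ?_, fun i m hm => ?_,
    fun i m hm => ?_, fun j k m hm => ?_, fun i j => ?_, fun j k => ?_⟩
  · obtain ⟨κ, X, Y, T, W, h⟩ := exists_powers hr hξ hm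
    simp only [Matrix.cons_val]
    rw [h.cBoson_eq]
    obtain ⟨hκ, hX, hY, h1, h2, h3, h4, h5, h6⟩ := id h
    simp [*]
  · simp
  · obtain ⟨κ, X, Y, T, W, h⟩ := exists_powers hr hξ hm
    simp only [Matrix.cons_val]
    rw [h.cBoson_eq, h.dBoson_eq]
    obtain ⟨hκ, hX, hY, h1, h2, h3, h4, h5, h6⟩ := id h
    intro e
    field_simp at e
    -- Here `c_1 c_2 - d ^ 2` is a nonzero multiple of `W`.
    exact h6 (by linear_combination h.W_eq + e)
  · obtain ⟨κ, X, Y, T, W, h⟩ := exists_powers hr hξ hm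
    simp only [Matrix.cons_val]
    rw [h.cBoson_eq, h.dBoson_eq, h.lamRatio2_eq, h.lamRatio2_eq]
    obtain ⟨hκ, hX, hY, h1, h2, h3, h4, h5, h6⟩ := id h
    fin_cases i <;> simp [q00, q10, p00, p10, p20, h.zpow_zero, h.zpow_a, h.zpow_two, h.zpow_d] <;>
      field_simp <;> (try rw [h.W_eq]) <;> ring
  · obtain ⟨κ, X, Y, T, W, h⟩ := exists_powers hr hξ hm
    simp only [Matrix.cons_val]
    rw [h.dBoson_eq, h.lamRatio2_eq, h.lamRatio2_eq]
    obtain ⟨hκ, hX, hY, h1, h2, h3, h4, h5, h6⟩ := id h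
    fin_cases i <;> simp [q11, q21, p11, p21, p01, h.zpow_one, h.zpow_b, h.zpow_c] <;>
      field_simp <;> (try rw [h.W_eq]) <;> ring
  · obtain ⟨κ, X, Y, T, W, h⟩ := exists_powers hr hξ hm
    rw [h.lamRatio2_eq, h.lamRatio2_eq]
    obtain ⟨hκ, hX, hY, h1, h2, h3, h4, h5, h6⟩ := id h
    fin_cases j <;> fin_cases k <;>
      simp [q00, q10, q11, q21, h.zpow_zero, h.zpow_one, h.zpow_a, h.zpow_b] <;>
      field_simp <;> (try rw [h.W_eq]) <;> ring
  · fin_cases i <;> fin_cases j <;>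
      simp [hA, zeroA2, lamZero, kMat2, q00, q10, q11, q21, p00, p10, p11, p21, p01, p20, hq] <;>
      first | (apply exp_eq_xpow_div; field_simp; ring) | (apply exp_eq_one_of_eq_zero; field_simp; ring)
  · fin_cases j <;> fin_cases k <;> simp [lamZero, kMat2] <;> field_simp <;> ring

theorem Frame.blueprint3 (hr : 1 < r) (hξ : ξ.re ≠ 0) (hF : P.Frame ξ (zeroA3 r) (qExp3 r) (pExp3 r))
    (hq : ∀ i j, P.q i j ≠ 0) :
    P.Blueprint (2 * r * ξ) (fun _ _ => -1) (dFermion r ξ) (lamRatio r ξ (kMat3 r)) (lamZero r ξ (kMat3 r)) := by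
  obtain ⟨⟨q00, q10, q11, q21⟩, ⟨p00, p10, p11, p21⟩, p01, p20⟩ := hF.entries
  simp only [qExp3, pExp3, Matrix.of_apply, Matrix.cons_val] at q00 q10 q11 q21 p00 p10 p11 p21
  have hA := hF.A_zero
  have hr0 : (r : ℂ) ≠ 0 := by exact_mod_cast (by linarith : r ≠ 0)
  have hr1 : (r : ℂ) + 1 ≠ 0 := by exact_mod_cast (by linarith : r + 1 ≠ 0)
  refine ⟨fun j m hm => by simp, fun j m => rfl, dFermion_neg, fun m hm => ?_, fun i m hm => ?_,
    fun i m hm => ?_, fun j k m hm => ?_, fun i j => ?_, fun j k => ?_⟩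
  · obtain ⟨κ, X, Y, T, W, h⟩ := exists_powers hr hξ hm
    rw [h.dFermion_eq]
    obtain ⟨hκ, hX, hY, h1, h2, h3, h4, h5, h6⟩ := id h
    intro e
    field_simp at e
    -- Here `1 - d ^ 2` is a nonzero multiple of `(Y ^ 2 - X ^ 2) W`.
    exact mul_ne_zero h6 h5 (by linear_combination (Y ^ 2 - X ^ 2) * h.W_eq + e)
  · obtain ⟨κ, X, Y, T, W, h⟩ := exists_powers hr hξ hm
    rw [h.dFermion_eq, h.lamRatio3_eq, h.lamRatio3_eq]
    obtain ⟨hκ, hX, hY, h1, h2, h3, h4, h5, h6⟩ := id h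
    fin_cases i <;> simp [q00, q10, p00, p10, p20, h.zpow_zero, h.zpow_a, h.zpow_d] <;>
      field_simp <;> (try rw [h.W_eq]) <;> ring
  · obtain ⟨κ, X, Y, T, W, h⟩ := exists_powers hr hξ hm
    rw [h.dFermion_eq, h.lamRatio3_eq, h.lamRatio3_eq]
    obtain ⟨hκ, hX, hY, h1, h2, h3, h4, h5, h6⟩ := id h
    fin_cases i <;> simp [q11, q21, p11, p21, p01, h.zpow_e, h.zpow_f, h.zpow_g] <;>
      field_simp <;> (try rw [h.W_eq]) <;> ring
  · obtain ⟨κ, X, Y, T, W, h⟩ := exists_powers hr hξ hm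
    rw [h.lamRatio3_eq, h.lamRatio3_eq]
    obtain ⟨hκ, hX, hY, h1, h2, h3, h4, h5, h6⟩ := id h
    fin_cases j <;> fin_cases k <;>
      simp [q00, q10, q11, q21, h.zpow_zero, h.zpow_a, h.zpow_e, h.zpow_f] <;>
      field_simp <;> (try rw [h.W_eq]) <;> ring
  · fin_cases i <;> fin_cases j <;>
      simp [hA, zeroA3, lamZero, kMat3, q00, q10, q11, q21, p00, p10, p11, p21, p01, p20, hq] <;>
      first | (apply exp_eq_xpow_div; field_simp; ring) | (apply exp_eq_one_of_eq_zero; field_simp; ring)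
  · fin_cases j <;> fin_cases k <;> simp [lamZero, kMat3] <;> field_simp <;> ring

end Params

/-! ### The coefficients `g_i`, and the solution formulas in terms of blueprints -/

namespace Params

variable {r : ℝ} {ξ : ℂ} {P : Params}

/-- The exponential equals `t`, and `t' = t⁻¹`, so the right side is `g' (t - 1)`. -/
lemma boson_coeff_iff (hr : 1 < r) (hξ : ξ.re ≠ 0) {g g' t t' : ℂ} (ht : t = xpow ξ (2 - 2 * r))
    (ht' : t' = xpow ξ (2 * r - 2)) :
    g * (t - 1) = -(g' * (t' - 1) * Complex.exp (-(2 * (r - 1) / r / 2) * (2 * r * ξ))) ↔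
      g = g' := by
  have hr0 : (r : ℂ) ≠ 0 := by exact_mod_cast (by linarith : r ≠ 0)
  have h1 : Complex.exp (-(2 * (r - 1) / r / 2) * (2 * r * ξ)) = t := by
    rw [ht, xpow]
    congr 1
    field_simp
    ring
  have h2 : t' * t = 1 := by
    rw [ht, ht', ← xpow_add, ← xpow_zero ξ]
    congr 1
    ring
  have h3 : t - 1 ≠ 0 := by
    have := xpow_ne_one hξ (y := 2 - 2 * r) (by linarith)
    push_cast at this
    rw [ht]
    exact sub_ne_zero.mpr this
  rw [h1]
  constructor
  · intro h
    refine mul_right_cancel₀ h3 ?_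
    linear_combination h - g' * h2
  · intro h
    linear_combination (t - 1) * h + g' * h2

/-- The exponential is `x ^ (-r)`. After removal of `x ^ (1 - r)` from both sides, `t - 1` becomes
`x ^ (1 - r) - x ^ (r - 1)` and `t' - 1` becomes `x - x⁻¹`; their quotient is `-[r - 1]_x`. -/
lemma fermion_coeff_iff (hξ : ξ.re ≠ 0) {g g' t t' : ℂ} (ht : t = xpow ξ (2 - 2 * r))
    (ht' : t' = xpow ξ 2) :
    g * (t - 1) = -(g' * (t' - 1) * Complex.exp (-(1 / 2) * (2 * r * ξ))) ↔
      g' = xnum ξ (r - 1) * g := by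
  have hκ := xpow_sub_ne_zero hξ one_ne_zero
  rw [Complex.ofReal_one] at hκ
  have h1 : Complex.exp (-(1 / 2) * (2 * r * ξ)) = xpow ξ (1 - r) * xpow ξ (-1) := by
    rw [← xpow_add, xpow]
    congr 1
    ring
  have h2 : t = xpow ξ (1 - r) * xpow ξ (1 - r) := by
    rw [ht, ← xpow_add]
    congr 1
    ring
  have h3 : t' = xpow ξ 1 * xpow ξ 1 := by
    rw [ht', ← xpow_add]
    norm_num
  have h4 : xpow ξ 1 * xpow ξ (-1) = 1 := by rw [← xpow_add, add_neg_cancel, xpow_zero]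
  have h5 : xpow ξ (r - 1) * xpow ξ (1 - r) = 1 := by
    rw [← xpow_add, ← xpow_zero ξ]
    congr 1
    ring
  have h6 : xnum ξ (r - 1) * (xpow ξ 1 - xpow ξ (-1)) = xpow ξ (r - 1) - xpow ξ (1 - r) := by
    rw [xnum, div_mul_cancel₀ _ hκ, neg_sub]
  rw [h1, h2, h3]
  constructor
  · intro h
    refine mul_right_cancel₀ (mul_ne_zero (xpow_ne_zero ξ (1 - r)) hκ) ?_
    linear_combination h - g' * xpow ξ (1 - r) * xpow ξ 1 * h4 - g * h5 - g * xpow ξ (1 - r) * h6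
  · intro h
    linear_combination (xpow ξ (1 - r) * (xpow ξ 1 - xpow ξ (-1))) * h +
      g' * xpow ξ (1 - r) * xpow ξ 1 * h4 + g * h5 + g * xpow ξ (1 - r) * h6

/-- The mirror image of `fermion_coeff_iff`, needed for the second current of Case 3, where the
roles of the two coefficients are exchanged. -/
lemma fermion_coeff_iff' (hξ : ξ.re ≠ 0) {g g' t t' : ℂ} (ht : t = xpow ξ (-2))
    (ht' : t' = xpow ξ (2 * r - 2)) :
    g * (t - 1) = -(g' * (t' - 1) * Complex.exp (-(1 / 2) * (2 * r * ξ))) ↔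
      g = xnum ξ (r - 1) * g' := by
  have hκ := xpow_sub_ne_zero hξ one_ne_zero
  rw [Complex.ofReal_one] at hκ
  have h1 : Complex.exp (-(1 / 2) * (2 * r * ξ)) = xpow ξ (1 - r) * xpow ξ (-1) := by
    rw [← xpow_add, xpow]
    congr 1
    ring
  have h2 : t = xpow ξ (-1) * xpow ξ (-1) := by
    rw [ht, ← xpow_add]
    norm_num
  have h3 : t' = xpow ξ (r - 1) * xpow ξ (r - 1) := by
    rw [ht', ← xpow_add]
    congr 1
    ring
  have h4 : xpow ξ 1 * xpow ξ (-1) = 1 := by rw [← xpow_add, add_neg_cancel, xpow_zero]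
  have h5 : xpow ξ (r - 1) * xpow ξ (1 - r) = 1 := by
    rw [← xpow_add, ← xpow_zero ξ]
    congr 1
    ring
  have h6 : xnum ξ (r - 1) * (xpow ξ 1 - xpow ξ (-1)) = xpow ξ (r - 1) - xpow ξ (1 - r) := by
    rw [xnum, div_mul_cancel₀ _ hκ, neg_sub]
  rw [h1, h2, h3]
  constructor
  · intro h
    refine mul_right_cancel₀ (mul_ne_zero (xpow_ne_zero ξ (-1)) hκ) ?_
    linear_combination -h + g' * xpow ξ (-1) * xpow ξ (r - 1) * h5 + g * h4 -
      g' * xpow ξ (-1) * h6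
  · intro h
    linear_combination -(xpow ξ (-1) * (xpow ξ 1 - xpow ξ (-1))) * h +
      g' * xpow ξ (-1) * xpow ξ (r - 1) * h5 + g * h4 - g' * xpow ξ (-1) * h6

lemma xpow_div (ξ y z : ℂ) : xpow ξ y / xpow ξ z = xpow ξ (y - z) := by
  rw [div_eq_mul_inv, ← xpow_neg, ← xpow_add, sub_eq_add_neg]

/-- The equations for the coefficients `g_i`, with `log (q_{j+1,j} / q_{j,j}) = L`. -/
def CoeffEqs (P : Params) (L : ℂ) : Prop :=
  ∀ j : Fin 2, P.g j.castSucc * (P.q j.castSucc j / P.p j.castSucc j - 1) =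
    -(P.g j.succ * (P.q j.succ j / P.p j.succ j - 1) * Complex.exp (-(P.A j j 0 / 2) * L))

lemma Frame.coeffEqs_iff1 (hr : 1 < r) (hξ : ξ.re ≠ 0)
    (hF : P.Frame ξ (zeroA1 r) (qExp r) (pExp1 r)) :
    P.CoeffEqs (2 * r * ξ) ↔ P.g 0 = P.g 1 ∧ P.g 1 = P.g 2 := by
  rw [CoeffEqs, Fin.forall_fin_two]
  simp only [hF.q_castSucc, hF.q_succ, hF.p_castSucc, hF.p_succ, xpow_div, hF.A_zero]
  refine and_congr (boson_coeff_iff hr hξ ?_ ?_) (boson_coeff_iff hr hξ ?_ ?_) <;>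
    congr 1 <;> simp [qExp, pExp1] <;> ring

lemma Frame.coeffEqs_iff2 (hr : 1 < r) (hξ : ξ.re ≠ 0)
    (hF : P.Frame ξ (zeroA2 r) (qExp r) (pExp2 r)) :
    P.CoeffEqs (2 * r * ξ) ↔ P.g 0 = P.g 1 ∧ P.g 2 = xnum ξ (r - 1) * P.g 1 := by
  rw [CoeffEqs, Fin.forall_fin_two]
  simp only [hF.q_castSucc, hF.q_succ, hF.p_castSucc, hF.p_succ, xpow_div, hF.A_zero]
  refine and_congr (boson_coeff_iff hr hξ ?_ ?_) (fermion_coeff_iff hξ ?_ ?_) <;>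
    congr 1 <;> simp [qExp, pExp2] <;> ring

lemma Frame.coeffEqs_iff3 (hξ : ξ.re ≠ 0)
    (hF : P.Frame ξ (zeroA3 r) (qExp3 r) (pExp3 r)) :
    P.CoeffEqs (2 * r * ξ) ↔
      P.g 1 = xnum ξ (r - 1) * P.g 0 ∧ P.g 1 = xnum ξ (r - 1) * P.g 2 := by
  rw [CoeffEqs, Fin.forall_fin_two]
  simp only [hF.q_castSucc, hF.q_succ, hF.p_castSucc, hF.p_succ, xpow_div, hF.A_zero]
  refine and_congr (fermion_coeff_iff hξ ?_ ?_) (fermion_coeff_iff' hξ ?_ ?_) <;>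
    congr 1 <;> simp [qExp3, pExp3] <;> ring

/-- Separates the formulas into the data from which a blueprint is built and those that follow from
it, so that both directions of the theorem can use the blueprint. -/
lemma solution1_iff (hr : 1 < r) (hξ : ξ.re ≠ 0) : P.Solution1 r ξ ↔ P.Common ∧
    P.Frame ξ (zeroA1 r) (qExp r) (pExp1 r) ∧ P.CoeffEqs (2 * r * ξ) ∧
    P.Follows (fun _ => cBoson r ξ) (dBoson r ξ) (lamRatio1 r ξ) ∧
    ∀ i j, P.lam i j 0 = lamZero1 r ξ i j := by
  have hA {m : ℤ} (hm : m ≠ 0) :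
      -(xnum ξ m / xnum ξ (2 * m)) = dBoson r ξ m / cBoson r ξ m := by
    obtain ⟨κ, X, Y, T, W, h⟩ := exists_powers hr hξ hm
    rw [h.dBoson_div_cBoson]
  constructor
  · rintro ⟨hC, h1, h2, h3, g1, g2, hqp, hA1, hs, hlam⟩
    have hF : P.Frame ξ (zeroA1 r) (qExp r) (pExp1 r) := by
      refine ⟨?_, ?_, ?_, ?_, ?_, Fin.forall_fin_two.mpr ⟨hC.2.1, hC.1⟩⟩
      · simp [Fin.forall_fin_two, zeroA1, h1, h2, h3]
      all_goals
        refine fun j => ?_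
        first
          | refine (hqp j).1.trans ?_
          | refine (hqp j).2.1.trans ?_
          | refine (hqp j).2.2.1.trans ?_
          | refine (hqp j).2.2.2.trans ?_
        congr 1
        fin_cases j <;> simp [qExp, pExp1] <;> ring
    refine ⟨hC, hF, (hF.coeffEqs_iff1 hr hξ).mpr ⟨g1, g2⟩, ⟨hs, fun m hm => ?_, fun m hm => ?_,
      fun i j => (hlam i j).2⟩, fun i j => (hlam i j).1⟩
    · rw [hA1 m hm.ne', hA hm.ne']
    · rw [hA1 m hm.ne, hA hm.ne]
  · rintro ⟨hC, hF, hg, hfol, hlam⟩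
    obtain ⟨g1, g2⟩ := (hF.coeffEqs_iff1 hr hξ).mp hg
    refine ⟨hC, fun j => ?_, hF.A_zero 0 1, hF.A_zero 1 0, g1, g2, fun j => ?_, fun m hm => ?_,
      hfol.s_neg, fun i j => ⟨hlam i j, hfol.lam i j⟩⟩
    · rw [hF.A_zero]
      fin_cases j <;> rfl
    · simp only [hF.q_castSucc, hF.q_succ, hF.p_castSucc, hF.p_succ]
      refine ⟨?_, ?_, ?_, ?_⟩ <;> congr 1 <;> fin_cases j <;> simp [qExp, pExp1] <;> ring
    · rcases lt_or_gt_of_ne hm with h | h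
      · rw [hfol.A_neg m h, hA hm]
      · rw [hfol.A_pos m h, hA hm]

lemma solution2_iff (hr : 1 < r) (hξ : ξ.re ≠ 0) : P.Solution2 r ξ ↔ P.Common ∧
    P.Frame ξ (zeroA2 r) (qExp r) (pExp2 r) ∧ P.CoeffEqs (2 * r * ξ) ∧
    P.Follows ![cBoson r ξ, fun _ => -1] (dBoson r ξ) (lamRatio r ξ (kMat2 r)) ∧
    ∀ i j, P.lam i j 0 = lamZero r ξ (kMat2 r) i j := by
  have hA {m : ℤ} (hm : m ≠ 0) :
      -(xnum ξ m / xnum ξ (2 * m)) = dBoson r ξ m / cBoson r ξ m := by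
    obtain ⟨κ, X, Y, T, W, h⟩ := exists_powers hr hξ hm
    rw [h.dBoson_div_cBoson]
  constructor
  · rintro ⟨hC, h1, h1', h2, h3, g1, g2, hqp, hA1, hA2, hs, hlam⟩
    have hF : P.Frame ξ (zeroA2 r) (qExp r) (pExp2 r) := by
      refine ⟨?_, ?_, ?_, ?_, ?_, Fin.forall_fin_two.mpr ⟨hC.2.1, hC.1⟩⟩
      · simp [Fin.forall_fin_two, zeroA2, h1, h1', h2, h3]
      all_goals
        refine fun j => ?_
        first
          | refine (hqp j).1.trans ?_
          | refine (hqp j).2.1.trans ?_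
          | refine (hqp j).2.2.1.trans ?_
          | refine (hqp j).2.2.2.trans ?_
        congr 1
        fin_cases j <;> simp [qExp, pExp2] <;> ring
    refine ⟨hC, hF, (hF.coeffEqs_iff2 hr hξ).mpr ⟨g1, g1 ▸ g2⟩, ⟨Fin.forall_fin_two.mpr
      ⟨fun m hm => (hs m hm).1, fun m hm => (hs m hm).2⟩, fun m hm => ?_, fun m hm => ?_,
      fun i j => (hlam i j).2⟩, fun i j => (hlam i j).1⟩
    -- `A_{1,2}(m)` has two formulas because `c_1 ≠ c_2` in Case 2: for `m > 0` it is `d / c_2` with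
    -- `c_2 = -1`, for `m < 0` it is `d / c_1`.
    · rw [hA1 m hm, dBoson]
      simp [div_neg]
    · rw [hA2 m hm, hA hm.ne]
      rfl
  · rintro ⟨hC, hF, hg, hfol, hlam⟩
    obtain ⟨g1, g2⟩ := (hF.coeffEqs_iff2 hr hξ).mp hg
    refine ⟨hC, hF.A_zero 0 0, hF.A_zero 1 1, hF.A_zero 0 1, hF.A_zero 1 0, g1, g1 ▸ g2,
      fun j => ?_, fun m hm => ?_, fun m hm => ?_,
      fun m hm => ⟨hfol.s_neg 0 m hm, hfol.s_neg 1 m hm⟩, fun i j => ⟨hlam i j, hfol.lam i j⟩⟩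
    · simp only [hF.q_castSucc, hF.q_succ, hF.p_castSucc, hF.p_succ]
      refine ⟨?_, ?_, ?_, ?_⟩ <;> congr 1 <;> fin_cases j <;> simp [qExp, pExp2] <;> ring
    · rw [hfol.A_pos m hm, dBoson]
      simp [div_neg]
    · rw [hfol.A_neg m hm, hA hm.ne]
      rfl

lemma solution3_iff (hr : 1 < r) (hξ : ξ.re ≠ 0) : P.Solution3 r ξ ↔ P.Common ∧
    P.Frame ξ (zeroA3 r) (qExp3 r) (pExp3 r) ∧ P.CoeffEqs (2 * r * ξ) ∧
    P.Follows (fun _ _ => -1) (dFermion r ξ) (lamRatio r ξ (kMat3 r)) ∧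
    ∀ i j, P.lam i j 0 = lamZero r ξ (kMat3 r) i j := by
  have hne : xnum ξ (r - 1) ≠ 0 := by
    have := xnum_ne_zero hξ (y := r - 1) (by linarith)
    push_cast at this
    exact this
  constructor
  · rintro ⟨hC, h1, h2, h3, g1, g2, hqp, hA1, hs, hlam⟩
    have hF : P.Frame ξ (zeroA3 r) (qExp3 r) (pExp3 r) := by
      refine ⟨?_, ?_, ?_, ?_, ?_, Fin.forall_fin_two.mpr ⟨hC.2.1, hC.1⟩⟩
      · simp [Fin.forall_fin_two, zeroA3, h1, h2, h3]
      all_goals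
        refine fun j => ?_
        first
          | refine (hqp j).1.trans ?_
          | refine (hqp j).2.1.trans ?_
          | refine (hqp j).2.2.1.trans ?_
          | refine (hqp j).2.2.2.trans ?_
        congr 1
        fin_cases j <;> simp [qExp3, pExp3] <;> ring
    refine ⟨hC, hF, (hF.coeffEqs_iff3 hξ).mpr ⟨g1, g2.symm ▸ g1⟩, ⟨hs, fun m hm => ?_,
      fun m hm => ?_, fun i j => (hlam i j).2⟩, fun i j => (hlam i j).1⟩
    · rw [hA1 m hm.ne', dFermion, div_neg, div_one]
    · rw [hA1 m hm.ne, dFermion, div_neg, div_one]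
  · rintro ⟨hC, hF, hg, hfol, hlam⟩
    obtain ⟨g1, g2⟩ := (hF.coeffEqs_iff3 hξ).mp hg
    refine ⟨hC, fun j => ?_, hF.A_zero 0 1, hF.A_zero 1 0, g1,
      mul_left_cancel₀ hne (g2.symm.trans g1), fun j => ?_, fun m hm => ?_,
      hfol.s_neg, fun i j => ⟨hlam i j, hfol.lam i j⟩⟩
    · rw [hF.A_zero]
      fin_cases j <;> rfl
    · simp only [hF.q_castSucc, hF.q_succ, hF.p_castSucc, hF.p_succ]
      refine ⟨?_, ?_, ?_, ?_⟩ <;> congr 1 <;> fin_cases j <;> simp [qExp3, pExp3] <;> ring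
    · rcases lt_or_gt_of_ne hm with h | h
      · rw [hfol.A_neg m h, dFermion, div_neg, div_one]
      · rw [hfol.A_pos m h, dFermion, div_neg, div_one]

lemma Frame.p_ne_zero {A0 qe pe : Matrix (Fin 2) (Fin 2) ℂ} (hF : P.Frame ξ A0 qe pe)
    (hq : ∀ i j, P.q i j ≠ 0) (i : Fin 3) (j : Fin 2) : P.p i j ≠ 0 := by
  obtain ⟨-, ⟨p00, p10, p11, p21⟩, p01, p20⟩ := hF.entries
  fin_cases i <;> fin_cases j <;> simp [p00, p10, p11, p21, p01, p20, hq, xpow_ne_zero]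

/-- The explicit solutions satisfy all the conditions. -/
theorem conditions_of_solution {ℓ : Fin 3 → Fin 2 → ℂ} (hr : 1 < r) (hξ : ξ.re ≠ 0)
    (hS : P.Solution1 r ξ ∨ P.Solution2 r ξ ∨ P.Solution3 r ξ)
    (hℓ : ∀ i j, Complex.exp (ℓ i j) = P.q i j)
    (hL : ∀ j : Fin 2, ℓ j.succ j - ℓ j.castSucc j = 2 * r * ξ) :
    P.IsHeisenberg ∧ P.MutualLocality ∧ P.Commutativity ℓ (P.current ℓ) ∧ P.Symmetry := by
  have hq : ∀ i j, P.q i j ≠ 0 := fun i j => hℓ i j ▸ Complex.exp_ne_zero _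
  have hr0 : (r : ℂ) ≠ 0 := by exact_mod_cast (by linarith : r ≠ 0)
  have hr1 : (r : ℂ) - 1 ≠ 0 := by exact_mod_cast (by linarith : r - 1 ≠ 0)
  have hr2 : (r : ℂ) + 1 ≠ 0 := by exact_mod_cast (by linarith : r + 1 ≠ 0)
  obtain ⟨hP, hp, hE⟩ : P.IsHeisenberg ∧ (∀ i j, P.p i j ≠ 0) ∧ P.Eqs fun _ => 2 * r * ξ := by
    rcases hS with hS | hS | hS
    · obtain ⟨hC, hF, hg, hfol, hlam⟩ := (solution1_iff hr hξ).mp hS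
      have hB := hF.blueprint1 hr hξ hq
      refine ⟨hfol.isHeisenberg hB hC ?_ ?_, hF.p_ne_zero hq, hfol.eqs hB hC hlam hg⟩
      · rw [hF.A_zero, hF.A_zero]
        rfl
      · simp only [hF.A_zero, zeroA1, Matrix.of_apply, Matrix.cons_val]
        intro h
        field_simp at h
        norm_num at h
    · obtain ⟨hC, hF, hg, hfol, hlam⟩ := (solution2_iff hr hξ).mp hS
      have hB := hF.blueprint2 hr hξ hq
      refine ⟨hfol.isHeisenberg hB hC ?_ ?_, hF.p_ne_zero hq, hfol.eqs hB hC hlam hg⟩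
      · rw [hF.A_zero, hF.A_zero]
        rfl
      · simp only [hF.A_zero, zeroA2, Matrix.of_apply, Matrix.cons_val]
        intro h
        field_simp at h
        exact hr2 (by linear_combination -h)
    · obtain ⟨hC, hF, hg, hfol, hlam⟩ := (solution3_iff hr hξ).mp hS
      have hB := hF.blueprint3 hr hξ hq
      refine ⟨hfol.isHeisenberg hB hC ?_ ?_, hF.p_ne_zero hq, hfol.eqs hB hC hlam hg⟩
      · rw [hF.A_zero, hF.A_zero]
        rfl
      · simp only [hF.A_zero, zeroA3, Matrix.of_apply, Matrix.cons_val]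
        intro h
        field_simp at h
        exact mul_ne_zero hr1 hr2 (by linear_combination -h)
  have hL' : (fun j : Fin 2 => ℓ j.succ j - ℓ j.castSucc j) = fun _ => 2 * r * ξ := funext hL
  exact ⟨hP, conditions_of_eqs hP hp hℓ (hL' ▸ hE)⟩

end Params

/-! ### The relations between the parameters -/

namespace Params

variable {P : Params}

/-- `|exp (t L)| = exp (t Re L)` for real `t`. This is where the reality of `A(0)` and `|q_{j+1,j} /
q_{j,j}| ≠ 1` are used. -/
lemma eq_zero_of_exp_mul_eq_one {t L : ℂ} (ht : t.im = 0) (hL : L.re ≠ 0)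
    (h : Complex.exp (t * L) = 1) : t = 0 := by
  have h1 := congrArg norm h
  rw [Complex.norm_exp, norm_one, Real.exp_eq_one_iff, Complex.mul_re, ht, zero_mul, sub_zero] at h1
  exact Complex.ext ((mul_eq_zero.mp h1).resolve_right hL) ht

/-- The relations that mutual locality, commutativity up to a total difference, and symmetry imply
between the `p_{i,j}`, `q_{i,j}` and `A_{i,j}(0)`. -/
structure Relations (P : Params) (L : ℂ) : Prop where
  q_succ : ∀ j : Fin 2, P.q j.succ j = P.q j.castSucc j * Complex.exp L
  p_one_one : P.p 1 1 = P.q 1 1 * Complex.exp (-(P.A 0 1 0 * L))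
  p_one_zero : P.p 1 0 = P.q 1 0 * Complex.exp (P.A 0 1 0 * L)
  p_succ : ∀ j : Fin 2, P.p j.succ j = P.p j.castSucc j * Complex.exp ((1 - P.A j j 0) * L)
  q_one_one : P.q 1 1 ^ 2 = P.q 0 0 ^ 2 * Complex.exp ((1 + P.A 0 1 0) * L)
  A_diag : ∀ j, P.A j j 0 = 1 ∨ P.A j j 0 = -2 * P.A 0 1 0

variable {L : Fin 2 → ℂ}

/-- The zero mode counterpart of `Eqs.gram`. -/
lemma Eqs.ratio (hE : P.Eqs L) (j k : Fin 2) : P.q j.castSucc k / P.p j.castSucc k =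
    P.q j.succ k / P.p j.succ k * Complex.exp (-(P.A j k 0 * L j)) := by
  rw [← hE.loc_zero, ← hE.loc_zero, ← Complex.exp_add]
  congr 1
  have h0 := hE.diff_zero j 0
  have h1 := hE.diff_zero j 1
  simp only [Fin.sum_univ_two]
  fin_cases j
  · simp at h0 h1 ⊢
    linear_combination P.A 0 k 0 * h0 + P.A 1 k 0 * h1
  · simp at h0 h1 ⊢
    linear_combination P.A 0 k 0 * h0 + P.A 1 k 0 * h1

/-- If `D (y - x) = u - v` and `D (y⁻¹ - x⁻¹) = u⁻¹ - v⁻¹` then `u = v` or `u v = x y`. -/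
lemma mul_eq_mul_of_even {D x y u v : ℂ} (hx : x ≠ 0) (hy : y ≠ 0) (hu : u ≠ 0) (hv : v ≠ 0)
    (h1 : D * (y - x) = u - v) (h2 : D * (y⁻¹ - x⁻¹) = u⁻¹ - v⁻¹) (huv : u ≠ v) :
    u * v = x * y := by
  field_simp at h2
  refine mul_left_cancel₀ (sub_ne_zero.mpr huv) ?_
  linear_combination -h2 - u * v * h1

/-- Only the modes `m = ±1` and `m = 0` are used. The off-diagonal identities fix the `q`, the
diagonal ones give the dichotomy for `A_{j,j}(0)`. -/
theorem Eqs.relations (hE : P.Eqs L) (hP : P.IsHeisenberg) (hG : P.Generic)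
    (hne : ∀ j : Fin 2, P.p j.castSucc j ≠ P.q j.castSucc j ∧ P.p j.succ j ≠ P.q j.succ j)
    (hL : ∀ j : Fin 2, Complex.exp (L j) = P.q j.succ j / P.q j.castSucc j)
    (hbr : P.q 1 0 / P.q 0 0 = P.q 2 1 / P.q 1 1 → L 0 = L 1) :
    (∀ j, (L j).re ≠ 0) ∧ L 0 = L 1 ∧ P.Relations (L 0) := by
  obtain ⟨hpq, -, hnorm, hA, hsym, -, ha0⟩ := hG
  have hre (j : Fin 2) : (L j).re ≠ 0 := fun h => hnorm j <| by
    rw [← hL, Complex.norm_exp, h, Real.exp_zero]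
  have hp i j := (hpq i j).1
  have hq i j := (hpq i j).2
  have hqs (j : Fin 2) : P.q j.succ j = P.q j.castSucc j * Complex.exp (L j) := by
    rw [hL, mul_div_cancel₀ _ (hq _ _)]
  have t0 : P.p 2 0 = P.q 2 0 := hE.third 0
  have t1 : P.p 0 1 = P.q 0 1 := hE.third 1
  have n11 : P.p 1 1 ≠ P.q 1 1 := (hne 1).1
  have n10 : P.p 1 0 ≠ P.q 1 0 := (hne 0).2
  have hp11 : P.p 1 1 = P.q 1 1 * Complex.exp (-(P.A 0 1 0 * L 0)) := by
    have h : P.q 0 1 / P.p 0 1 = P.q 1 1 / P.p 1 1 * Complex.exp (-(P.A 0 1 0 * L 0)) :=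
      hE.ratio 0 1
    rw [t1, div_self (hq 0 1)] at h
    have := hp 1 1
    field_simp at h
    exact h
  have hp10 : P.p 1 0 = P.q 1 0 * Complex.exp (P.A 0 1 0 * L 1) := by
    have h : P.q 1 0 / P.p 1 0 = P.q 2 0 / P.p 2 0 * Complex.exp (-(P.A 1 0 0 * L 1)) :=
      hE.ratio 1 0
    rw [t0, div_self (hq 2 0), one_mul, ← hsym, Complex.exp_neg] at h
    have := hp 1 0
    have := Complex.exp_ne_zero (P.A 0 1 0 * L 1)
    field_simp at h
    rw [← h]
  have hps (j : Fin 2) :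
      P.p j.succ j = P.p j.castSucc j * Complex.exp ((1 - P.A j j 0) * L j) := by
    have h := hE.ratio j j
    rw [hqs j] at h
    have h1 := hp j.succ j
    have h2 := hp j.castSucc j
    have h3 := hq j.castSucc j
    rw [sub_mul, one_mul, sub_eq_add_neg, Complex.exp_add]
    field_simp at h
    rw [h, mul_assoc]
  -- By symmetry `D` is also the value at `m = -1`, and it is the common factor of the identities
  -- for `(j, k) = (0, 1)` and `(1, 0)`; `e1`, `e2`, `e3` are its four expressions.
  set D := P.s 0 1 * P.A 0 1 1 * P.s 1 (-1) with hD
  have e1 : P.s 1 1 * P.A 1 0 1 * P.s 0 (-1) = D := (hE.symm 1 one_pos).symm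
  have e2 : P.s 0 (-1) * P.A 0 1 (-1) * P.s 1 1 = D := by
    rw [hP.A_neg 0 1 (by norm_num), neg_neg, ← e1]
    ring
  have e3 : P.s 1 (-1) * P.A 1 0 (-1) * P.s 0 1 = D := by
    rw [hP.A_neg 1 0 (by norm_num), neg_neg]
    ring
  have g01 : D * (P.q 1 0 - P.q 0 0) = P.p 1 1 - P.q 1 1 := by
    have h := hE.gram 0 1 one_ne_zero
    simp at h
    linear_combination h - t1
  have g01' : D * ((P.q 1 0)⁻¹ - (P.q 0 0)⁻¹) = (P.p 1 1)⁻¹ - (P.q 1 1)⁻¹ := by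
    have h := hE.gram 0 1 (m := -1) (by norm_num)
    simp [t1] at h
    linear_combination h - ((P.q 1 0)⁻¹ - (P.q 0 0)⁻¹) * e2
  have g10 : D * (P.q 2 1 - P.q 1 1) = P.q 1 0 - P.p 1 0 := by
    have h := hE.gram 1 0 one_ne_zero
    simp at h
    linear_combination h + t0 - (P.q 2 1 - P.q 1 1) * e1
  have g10' : D * ((P.q 2 1)⁻¹ - (P.q 1 1)⁻¹) = (P.q 1 0)⁻¹ - (P.p 1 0)⁻¹ := by
    have h := hE.gram 1 0 (m := -1) (by norm_num)
    simp [t0] at h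
    linear_combination h - ((P.q 2 1)⁻¹ - (P.q 1 1)⁻¹) * e3
  have r1 := mul_eq_mul_of_even (hq 0 0) (hq 1 0) (hp 1 1) (hq 1 1) g01 g01' n11
  have r2 := mul_eq_mul_of_even (hq 1 1) (hq 2 1) (hq 1 0) (hp 1 0) g10 g10' n10.symm
  -- Elimination of `D` from `g01` and `g10` by cross multiplication; `r1` and `r2` cancel the mixed
  -- terms.
  have r3 : P.p 1 1 * P.q 2 1 + P.q 1 1 ^ 2 = P.q 1 0 ^ 2 + P.p 1 0 * P.q 0 0 := by
    linear_combination r1 - r2 + (P.q 1 0 - P.q 0 0) * g10 - (P.q 2 1 - P.q 1 1) * g01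
  have q10 : P.q 1 0 = P.q 0 0 * Complex.exp (L 0) := hqs 0
  have q21 : P.q 2 1 = P.q 1 1 * Complex.exp (L 1) := hqs 1
  have r4 : P.p 1 1 * P.q 2 1 = P.q 1 0 ^ 2 := by
    -- With `r1` and `r2` the relation `r3` factors. The second factor cannot vanish: it would give
    -- `exp ((1 - A_{1,2}(0)) L) = 1`, while `A_{1,2}(0) < 0`.
    have h : (P.p 1 1 * P.q 2 1 - P.q 1 0 ^ 2) * (P.q 1 0 ^ 2 - P.q 1 1 ^ 2) = 0 := by
      linear_combination (P.q 1 0 ^ 2) * r3 - P.q 1 1 * P.q 2 1 * r1 + P.q 1 0 * P.q 0 0 * r2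
    refine sub_eq_zero.mp ((mul_eq_zero.mp h).resolve_right fun h0 => ?_)
    have h1 : Complex.exp ((1 - P.A 0 1 0) * L 0) = 1 := by
      refine mul_left_cancel₀ (mul_ne_zero (hq 1 0) (hq 0 0)) ?_
      rw [sub_mul, one_mul, sub_eq_add_neg, Complex.exp_add]
      rw [hp11] at r1
      linear_combination r1 + Complex.exp (-(P.A 0 1 0 * L 0)) * h0 -
        P.q 1 0 * Complex.exp (-(P.A 0 1 0 * L 0)) * q10
    have h2 := eq_zero_of_exp_mul_eq_one (by simp [hA]) (hre 0) h1
    have h3 := congrArg Complex.re h2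
    simp at h3
    linarith
  -- `r1` and `r4` give `q_{2,1} / q_{1,1} = q_{3,2} / q_{2,2}`; only now does the compatibility of
  -- the logarithms apply and give `L 0 = L 1`.
  have r5 : Complex.exp (L 0) = Complex.exp (L 1) := by
    refine mul_left_cancel₀ (mul_ne_zero (hq 1 0) (hq 0 0)) ?_
    rw [q21] at r4
    linear_combination Complex.exp (L 1) * r1 - r4 + (-P.q 1 0) * q10
  have hLL : L 0 = L 1 := hbr (by
    have h0 := hL 0
    have h1 := hL 1
    rw [r5] at h0
    exact h0.symm.trans h1)
  have hLj (j : Fin 2) : L j = L 0 := by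
    fin_cases j
    · rfl
    · exact hLL.symm
  refine ⟨hre, hLL, ?_, hp11, hLL ▸ hp10, ?_, ?_, fun j => ?_⟩
  · intro j
    rw [hqs, hLj]
  · intro j
    rw [hps, hLj]
  · rw [add_mul, one_mul, Complex.exp_add]
    rw [hp11, Complex.exp_neg] at r1
    have := Complex.exp_ne_zero (P.A 0 1 0 * L 0)
    field_simp at r1
    linear_combination r1 + P.q 0 0 * Complex.exp (P.A 0 1 0 * L 0) * q10
  · have hc : P.s j 1 * P.s j (-1) * (P.q j.succ j - P.q j.castSucc j) =
        (P.q j.castSucc j - P.p j.castSucc j) - (P.q j.succ j - P.p j.succ j) := by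
      have h := hE.gram j j one_ne_zero
      rw [hP.1 j 1 one_ne_zero] at h
      simp only [zpow_one] at h
      linear_combination h
    have hc' : P.s j 1 * P.s j (-1) * ((P.q j.succ j)⁻¹ - (P.q j.castSucc j)⁻¹) =
        ((P.q j.castSucc j)⁻¹ - (P.p j.castSucc j)⁻¹) -
          ((P.q j.succ j)⁻¹ - (P.p j.succ j)⁻¹) := by
      have h := hE.gram j j (m := -1) (by norm_num)
      rw [hP.1 j (-1) (by norm_num)] at h
      simp only [zpow_neg_one, neg_neg] at h
      linear_combination h
    have hps' := hps j
    rw [hLj] at hps'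
    -- By `hc` and `hc'`, the number `s_j(1) s_j(-1) + 1` times the difference of the `q` is the
    -- difference of the `p`, also after inversion. So either the two `p` agree, giving `A_{j,j}(0)
    -- = 1`, or their product is that of the `q`, giving `A_{j,j}(0) = -2 A_{1,2}(0)`.
    rcases eq_or_ne (P.p j.succ j) (P.p j.castSucc j) with he | he
    · left
      rw [he] at hps'
      have h1 : Complex.exp ((1 - P.A j j 0) * L 0) = 1 :=
        mul_left_cancel₀ (hp j.castSucc j) (by rw [← hps', mul_one])
      exact (sub_eq_zero.mp (eq_zero_of_exp_mul_eq_one (by simp [hA]) (hre 0) h1)).symm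
    · right
      have h1 := mul_eq_mul_of_even (D := P.s j 1 * P.s j (-1) + 1) (hq j.castSucc j) (hq j.succ j)
        (hp j.succ j) (hp j.castSucc j) (by linear_combination hc) (by linear_combination hc') he
      have h2 : Complex.exp ((P.A j j 0 + 2 * P.A 0 1 0) * L 0) = 1 := by
        have hE0 := Complex.exp_ne_zero (P.A 0 1 0 * L 0)
        have h4 : Complex.exp ((1 - P.A j j 0) * L 0) =
            Complex.exp (L 0) * Complex.exp (P.A 0 1 0 * L 0) ^ 2 := by
          rw [Complex.exp_neg] at hp11
          field_simp at hp11
          rw [← hLL] at hp10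
          fin_cases j
          · simp only [Fin.zero_eta, Fin.castSucc_zero, Fin.succ_zero_eq_one] at hps' h1 ⊢
            have h5 : P.p 0 0 * Complex.exp (P.A 0 1 0 * L 0) = P.q 0 0 := by
              refine mul_left_cancel₀ (hq 1 0) ?_
              linear_combination h1 - P.p 0 0 * hp10
            refine mul_left_cancel₀ (hp 0 0) ?_
            linear_combination hp10 - hps' + Complex.exp (P.A 0 1 0 * L 0) * q10 -
              Complex.exp (L 0) * Complex.exp (P.A 0 1 0 * L 0) * h5
          · simp only [Fin.mk_one, Fin.castSucc_one, Fin.succ_one_eq_two] at hps' h1 ⊢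
            refine mul_left_cancel₀ (pow_ne_zero 2 (hp 1 1)) ?_
            rw [← hLL] at q21
            linear_combination h1 - P.p 1 1 * hps' + P.q 1 1 * q21 - Complex.exp (L 0) *
              (P.q 1 1 + P.p 1 1 * Complex.exp (P.A 0 1 0 * L 0)) * hp11
        refine mul_left_cancel₀ (Complex.exp_ne_zero ((1 - P.A j j 0) * L 0)) ?_
        rw [← Complex.exp_add, mul_one, h4, ← Complex.exp_nat_mul, ← Complex.exp_add]
        congr 1
        push_cast
        ring
      have h3 := eq_zero_of_exp_mul_eq_one (by simp [hA]) (hre 0) h2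
      linear_combination h3

end Params

/-! ### Transformations of the parameters -/

namespace Params

variable {P : Params} {L : Fin 2 → ℂ}

lemma scaling_neg {α : Fin 2 → ℤ → ℂ} (hα : ∀ j, ∀ m > 0, α j (-m) = (α j m)⁻¹) (j : Fin 2) {m : ℤ}
    (hm : m ≠ 0) : α j (-m) = (α j m)⁻¹ := by
  rcases lt_or_gt_of_ne hm with h | h
  · have h1 := hα j (-m) (by omega)
    rw [neg_neg] at h1
    rw [h1, inv_inv]
  · exact hα j m h

lemma IsHeisenberg.scaleBoson {α : Fin 2 → ℤ → ℂ} (h : P.IsHeisenberg)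
    (hα : ∀ j, ∀ m ≠ 0, α j m ≠ 0) (hα' : ∀ j, ∀ m > 0, α j (-m) = (α j m)⁻¹) :
    (P.scaleBoson α).IsHeisenberg := by
  refine ⟨fun j m hm => ?_, fun m => ?_, fun m => ?_⟩
  · have := hα j m hm
    simp only [Params.scaleBoson, if_neg hm, h.1 j m hm]
    field_simp
  · rcases eq_or_ne m 0 with rfl | hm
    · simpa [Params.scaleBoson] using h.2.1 0
    · have hm' : -m ≠ 0 := by omega
      simp only [Params.scaleBoson, if_neg hm, if_neg hm', scaling_neg hα' _ hm, h.2.1 m, inv_inv]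
      ring
  · rcases eq_or_ne m 0 with rfl | hm
    · simpa [Params.scaleBoson] using h.2.2 0
    · have h0 := hα 0 m hm
      have h1 := hα 1 m hm
      simp only [Params.scaleBoson, if_neg hm]
      intro e
      field_simp at e
      exact h.2.2 m e

lemma Eqs.scaleVar {σ : ℂ} (h : P.Eqs L) (hσ : σ ≠ 0) : (P.scaleVar σ).Eqs L where
  loc i j m hm := by
    simp only [Params.scaleVar, mul_zpow, ← mul_sub]
    rw [← h.loc i j m hm, Finset.sum_mul, Finset.sum_mul, Finset.mul_sum]
    exact Finset.sum_congr rfl fun k _ => by ring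
  loc_zero i j := by
    simp only [Params.scaleVar, zpow_zero, one_mul, mul_div_mul_left _ _ hσ]
    exact h.loc_zero i j
  diff j k m hm := by
    simp only [Params.scaleVar, mul_zpow, ← mul_sub]
    rw [h.diff j k m hm]
    split_ifs <;> ring
  diff_zero j k := by
    simp only [Params.scaleVar, zpow_zero, one_mul]
    exact h.diff_zero j k
  coeff j := by
    simp only [Params.scaleVar, mul_div_mul_left _ _ hσ]
    exact h.coeff j
  symm := h.symm
  third j := congrArg (σ * ·) (h.third j)

/-- Only a sign is allowed: `diff` and `symm` need `ε ^ m = ε ^ (-m)`. -/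
lemma Eqs.scaleSecond {ε : ℂ} (h : P.Eqs L) (hε : ε = 1 ∨ ε = -1) : (P.scaleSecond ε).Eqs L := by
  have h0 : ε ≠ 0 := by rcases hε with rfl | rfl <;> norm_num
  have h1 (m : ℤ) : ε ^ m * ε ^ m = 1 := by
    rw [← mul_zpow]
    rcases hε with rfl | rfl <;> simp
  have h2 (m : ℤ) : ε ^ (-m) = ε ^ m := by
    rw [zpow_neg]
    exact inv_eq_of_mul_eq_one_left (h1 m)
  have hdiv (i : Fin 3) (j : Fin 2) :
      (P.scaleSecond ε).q i j / (P.scaleSecond ε).p i j = P.q i j / P.p i j := by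
    simp only [Params.scaleSecond]
    split_ifs
    · exact mul_div_mul_left _ _ h0
    · rfl
  refine ⟨fun i j m hm => ?_, fun i j => ?_, fun j k m hm => ?_, h.diff_zero, fun j => ?_,
    fun m hm => ?_, fun j => ?_⟩
  · have := h.loc i j m hm
    simp only [Params.scaleSecond]
    split_ifs with hj
    · rw [mul_zpow, mul_zpow, h2]
      linear_combination ε ^ m * this
    · exact this
  · rw [hdiv]
    exact h.loc_zero i j
  · refine (h.diff j k m hm).trans ?_
    simp only [Params.scaleSecond]
    split_ifs with _ hj
    · rw [mul_zpow, mul_zpow]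
      linear_combination -(P.s j m * (P.q j.succ j ^ m - P.q j.castSucc j ^ m)) * h1 m
    · rfl
    · rfl
  · rw [hdiv, hdiv]
    exact h.coeff j
  · have := h.symm m hm
    simp only [Params.scaleSecond, h2, if_true, Fin.zero_eq_one_iff, OfNat.ofNat_ne_one, if_false]
    linear_combination ε ^ m * this
  · simp only [Params.scaleSecond, h.third]

/-- The condition `α_j(-m) = α_j(m)⁻¹` makes all products such as `s_j(m) A_{j,k}(m) s_k(-m)`
invariant. -/
lemma Eqs.scaleBoson {α : Fin 2 → ℤ → ℂ} (h : P.Eqs L)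
    (hα : ∀ j, ∀ m ≠ 0, α j m ≠ 0) (hα' : ∀ j, ∀ m > 0, α j (-m) = (α j m)⁻¹) :
    (P.scaleBoson α).Eqs L := by
  have hneg (j : Fin 2) {m : ℤ} (hm : m ≠ 0) : α j m * α j (-m) = 1 := by
    rw [scaling_neg hα' j hm, mul_inv_cancel₀ (hα j m hm)]
  refine ⟨fun i j m hm => ?_, fun i j => ?_, fun j k m hm => ?_, fun j k => ?_, h.coeff,
    fun m hm => ?_, h.third⟩
  · simp only [Params.scaleBoson, if_neg hm]
    rw [← h.loc i j m hm, Finset.sum_mul, Finset.sum_mul]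
    refine Finset.sum_congr rfl fun k _ => ?_
    have h1 := mul_inv_cancel₀ (hα k m hm)
    linear_combination (P.lam i k m * P.A k j m * P.s j (-m)) * h1 * (α j m * α j (-m)) +
      (P.lam i k m * P.A k j m * P.s j (-m)) * hneg j hm
  · simpa only [Params.scaleBoson, if_true] using h.loc_zero i j
  · simp only [Params.scaleBoson, if_neg hm, ← sub_mul]
    rw [h.diff j k m hm]
    split_ifs with hk
    · rw [hk]
      ring
    · rw [zero_mul]
  · simpa only [Params.scaleBoson, if_true] using h.diff_zero j k
  · have h0 := mul_inv_cancel₀ (hα 0 m hm.ne')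
    have h1 := mul_inv_cancel₀ (hα 1 m hm.ne')
    simp only [Params.scaleBoson, if_neg hm.ne']
    linear_combination h.symm m hm +
      (P.s 0 m * P.A 0 1 m * P.s 1 (-m)) * (h0 * (α 1 m * α 1 (-m)) + hneg 1 hm.ne') -
      (P.s 1 m * P.A 1 0 m * P.s 0 (-m)) * (h1 * (α 0 m * α 0 (-m)) + hneg 0 hm.ne')

lemma Eqs.shiftZero {c : Fin 2 → ℂ} (h : P.Eqs L)
    (hc : ∀ j, Complex.exp (∑ k, c k * P.A k j 0) = 1) : (P.shiftZero c).Eqs L := by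
  refine ⟨fun i j m hm => ?_, fun i j => ?_, fun j k m hm => ?_, fun j k => ?_, h.coeff, h.symm,
    h.third⟩
  · simpa only [Params.shiftZero, if_neg hm] using h.loc i j m hm
  · simp only [Params.shiftZero, if_true, add_mul, Finset.sum_add_distrib, Complex.exp_add, hc,
      mul_one]
    exact h.loc_zero i j
  · simpa only [Params.shiftZero, if_neg hm] using h.diff j k m hm
  · simpa only [Params.shiftZero, if_true, add_sub_add_right_eq_sub] using h.diff_zero j k

/-- Reversal exchanges `Λ_j` and `Λ_{j+1}` within each pair, so the logarithms change sign and the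
coefficient equation is multiplied by the inverse exponential. -/
lemma Eqs.relabel (h : P.Eqs L) :
    (P.relabel Fin.revPerm Fin.revPerm).Eqs fun j => -L j.rev := by
  refine ⟨fun i j m hm => ?_, fun i j => ?_, fun j k m hm => ?_, fun j k => ?_, fun j => ?_,
    fun m hm => ?_, fun j => ?_⟩
  · have := h.loc i.rev j.rev m hm
    rw [Fin.sum_univ_two, add_comm] at this
    rw [Fin.sum_univ_two]
    exact this
  · have := h.loc_zero i.rev j.rev
    rw [Fin.sum_univ_two, add_comm] at this
    rw [Fin.sum_univ_two]
    exact this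
  · have := h.diff j.rev k.rev m hm
    simp only [Params.relabel, Fin.revPerm_apply, Fin.rev_castSucc, Fin.rev_succ,
      Fin.rev_inj] at this ⊢
    rw [← neg_inj, neg_sub, this]
    split_ifs
    · ring
    · rw [neg_zero]
  · have := h.diff_zero j.rev k.rev
    simp only [Params.relabel, Fin.revPerm_apply, Fin.rev_castSucc, Fin.rev_succ,
      Fin.rev_inj] at this ⊢
    rw [← neg_inj, neg_sub, this]
    split_ifs
    · ring
    · rw [neg_zero]
  · have := h.coeff j.rev
    simp only [Params.relabel, Fin.revPerm_apply, Fin.rev_castSucc, Fin.rev_succ] at this ⊢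
    have h1 : Complex.exp (-(P.A j.rev j.rev 0 / 2) * L j.rev) *
        Complex.exp (-(P.A j.rev j.rev 0 / 2) * -L j.rev) = 1 := by
      rw [← Complex.exp_add, ← Complex.exp_zero]
      congr 1
      ring
    linear_combination Complex.exp (-(P.A j.rev j.rev 0 / 2) * -L j.rev) * this -
      P.g j.rev.succ * (P.q j.rev.succ j.rev / P.p j.rev.succ j.rev - 1) * h1
  · have := h.symm m hm
    simpa [Params.relabel] using this.symm
  · have := h.third j.rev
    fin_cases j
    · exact this
    · exact this

lemma IsHeisenberg.relabel (h : P.IsHeisenberg) :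
    (P.relabel Fin.revPerm Fin.revPerm).IsHeisenberg := by
  refine ⟨fun j => h.1 j.rev, fun m => ?_, fun m => ?_⟩
  · have := h.2.1 (-m)
    rw [neg_neg] at this
    exact this.symm
  · have := h.2.2 m
    intro e
    refine this ?_
    have e' : P.A 1 0 m * P.A 0 1 m = P.A 1 1 m * P.A 0 0 m := e
    linear_combination e'

lemma Generic.relabel (h : P.Generic) : (P.relabel Fin.revPerm Fin.revPerm).Generic := by
  obtain ⟨h1, h2, h3, h4, h5, h6, h7⟩ := h
  refine ⟨fun i j => h1 i.rev j.rev, fun t u htu => ?_, fun j => ?_, fun i j => h4 i.rev j.rev,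
    h5.symm, ?_, ?_⟩
  · have := @h2 (t.1.rev, t.2.rev) (u.1.rev, u.2.rev) htu
    simp only [Prod.mk.injEq, Fin.rev_inj] at this
    exact Prod.ext this.1 this.2
  · have := h3 j.rev
    simp only [Params.relabel, Fin.revPerm_apply, Fin.rev_castSucc, Fin.rev_succ]
    rwa [← inv_div, norm_inv, ne_eq, inv_eq_one]
  · rwa [h5] at h6
  · rwa [h5] at h7

lemma IsLogBranch.relabel {ℓ : Fin 3 → Fin 2 → ℂ} (h : P.IsLogBranch ℓ) :
    (P.relabel Fin.revPerm Fin.revPerm).IsLogBranch fun i j => ℓ i.rev j.rev := by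
  refine ⟨fun i j => h.1 i.rev j.rev, fun e => ?_⟩
  have e' : P.q 1 1 / P.q 2 1 = P.q 0 0 / P.q 1 0 := e
  have h1 := h.2 (by rw [← inv_div, ← e', inv_div])
  change ℓ 1 1 - ℓ 2 1 = ℓ 0 0 - ℓ 1 0
  linear_combination h1

/-! ### The explicit form of the solutions -/

lemma Blueprint.congr {P' : Params} {L : ℂ} {c : Fin 2 → ℤ → ℂ} {d : ℤ → ℂ}
    {M : Fin 3 → Fin 2 → ℤ → ℂ} {Z : Fin 3 → Fin 2 → ℂ} (h : P.Blueprint L c d M Z)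
    (hp : P'.p = P.p) (hq : P'.q = P.q) (hA : ∀ k j, P'.A k j 0 = P.A k j 0) :
    P'.Blueprint L c d M Z where
  c_ne := h.c_ne
  c_even := h.c_even
  d_even := h.d_even
  det := h.det
  sys_zero := by rw [hp, hq]; exact h.sys_zero
  sys_one := by rw [hp, hq]; exact h.sys_one
  diff := by rw [hq]; exact h.diff
  zero := by simpa only [hp, hq, hA] using h.zero
  zero_diff := h.zero_diff

lemma Frame.congr {P' : Params} {ξ : ℂ} {A0 qe pe : Matrix (Fin 2) (Fin 2) ℂ}
    (h : P.Frame ξ A0 qe pe)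
    (hp : P'.p = P.p) (hq : P'.q = P.q) (hA : ∀ k j, P'.A k j 0 = P.A k j 0) :
    P'.Frame ξ A0 qe pe where
  A_zero i j := (hA i j).trans (h.A_zero i j)
  q_castSucc := by rw [hq]; exact h.q_castSucc
  q_succ := by rw [hq]; exact h.q_succ
  p_castSucc := by rw [hp]; exact h.p_castSucc
  p_succ := by rw [hp]; exact h.p_succ
  third := by rw [hp, hq]; exact h.third

/-- Parameters with the `p_{i,j}`, `q_{i,j}` and `A_{i,j}(0)` of a blueprint are determined by it,
up to scaling the free fields and shifting the zero modes. -/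
theorem Eqs.normalize {L : ℂ} {c : Fin 2 → ℤ → ℂ} {d : ℤ → ℂ}
    {M : Fin 3 → Fin 2 → ℤ → ℂ} {Z : Fin 3 → Fin 2 → ℂ} (hE : P.Eqs fun _ => L)
    (hB : P.Blueprint L c d M Z) (hP : P.IsHeisenberg)
    (hq0 : ∀ i j, P.q i j ≠ 0) (hp0 : ∀ i j, P.p i j ≠ 0)
    (hq : ∀ j : Fin 2, ∀ m : ℤ, m ≠ 0 → P.q j.succ j ^ m - P.q j.castSucc j ^ m ≠ 0) :
    ∃ (α : Fin 2 → ℤ → ℂ) (b : Fin 2 → ℂ),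
      (∀ j, ∀ m ≠ 0, α j m ≠ 0) ∧ (∀ j, ∀ m > 0, α j (-m) = (α j m)⁻¹) ∧
      (∀ j, ∃ n : ℤ, ∑ k, b k * P.A k j 0 = 2 * Real.pi * Complex.I * n) ∧
      ((P.scaleBoson α).shiftZero b).Common ∧
      ((P.scaleBoson α).shiftZero b).CoeffEqs L ∧
      ((P.scaleBoson α).shiftZero b).Follows c d M ∧
      ∀ i j, ((P.scaleBoson α).shiftZero b).lam i j 0 = Z i j := by
  have hs (j : Fin 2) {m : ℤ} (hm : m ≠ 0) : P.s j m ≠ 0 := fun h0 => by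
    have h := hE.gram j j hm
    rw [← hB.gram hm j, h0] at h
    simp only [zero_mul] at h
    exact mul_ne_zero (hq j m hm) (hB.c_ne j m hm) h.symm
  -- Chosen to make `s_j(m) = 1` for `m > 0`; the values at negative `m` are then forced.
  set α : Fin 2 → ℤ → ℂ := fun j m => if 0 < m then (P.s j m)⁻¹ else P.s j (-m) with hαdef
  have hα : ∀ j, ∀ m ≠ 0, α j m ≠ 0 := fun j m hm => by
    simp only [hαdef]
    split_ifs
    · exact inv_ne_zero (hs j hm)
    · exact hs j (by omega)
  have hα' : ∀ j, ∀ m > 0, α j (-m) = (α j m)⁻¹ := fun j m hm => by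
    simp only [hαdef]
    rw [if_neg (by omega), if_pos hm, neg_neg, inv_inv]
  -- The shift makes the zero modes of the first `Λ` agree with `Z`; the other two follow, as
  -- consecutive differences agree. It is an ambiguity of logarithms since both sides solve the same
  -- exponential equation.
  set b : Fin 2 → ℂ := fun j => Z 0 j - P.lam 0 j 0 with hb
  have hb1 : ∀ j, Complex.exp (∑ k, b k * P.A k j 0) = 1 := fun j => by
    simp only [hb, sub_mul, Finset.sum_sub_distrib]
    rw [Complex.exp_sub, hB.zero, hE.loc_zero, div_self (div_ne_zero (hq0 0 j) (hp0 0 j))]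
  have hA0 : ∀ k j, ((P.scaleBoson α).shiftZero b).A k j 0 = P.A k j 0 := fun k j => rfl
  have hP1 : ((P.scaleBoson α).shiftZero b).IsHeisenberg := hP.scaleBoson hα hα'
  have hE1 : ((P.scaleBoson α).shiftZero b).Eqs fun _ => L :=
    (hE.scaleBoson hα hα').shiftZero hb1
  have hB1 : ((P.scaleBoson α).shiftZero b).Blueprint L c d M Z := hB.congr rfl rfl hA0
  have hs1 : ∀ j, ∀ m > 0, ((P.scaleBoson α).shiftZero b).s j m = 1 := fun j m hm => by
    simp only [Params.shiftZero, Params.scaleBoson, hαdef]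
    rw [if_pos hm, inv_mul_cancel₀ (hs j hm.ne')]
  refine ⟨α, b, hα, hα', fun j => ?_, ⟨hE1.third 1, hE1.third 0, hs1, hP1.1,
    fun m hm => hP1.A_neg 1 0 hm⟩, hE1.coeff, hE1.follows hB1 hP1 hs1 hq, ?_⟩
  · obtain ⟨n, hn⟩ := Complex.exp_eq_one_iff.mp (hb1 j)
    exact ⟨n, by rw [hn]; ring⟩
  · have h0 (j : Fin 2) : ((P.scaleBoson α).shiftZero b).lam 0 j 0 = Z 0 j := by
      simp [Params.shiftZero, Params.scaleBoson, hb]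
    have h1 (j : Fin 2) : ((P.scaleBoson α).shiftZero b).lam 1 j 0 = Z 1 j := by
      have e1 := (hE1.diff_zero 0 j).trans (hB1.zero_diff 0 j).symm
      simp only [Fin.castSucc_zero, Fin.succ_zero_eq_one, h0] at e1
      linear_combination -e1
    have h2 (j : Fin 2) : ((P.scaleBoson α).shiftZero b).lam 2 j 0 = Z 2 j := by
      have e1 := (hE1.diff_zero 1 j).trans (hB1.zero_diff 1 j).symm
      simp only [Fin.castSucc_one, Fin.succ_one_eq_two, h1] at e1
      linear_combination -e1
    intro i
    fin_cases i
    exacts [h0, h1, h2]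

end Params

/-! ### Classification of the solutions -/

namespace Params

variable {P : Params}

lemma zpow_sub_zpow_ne_zero {x y L : ℂ} (hy : y ≠ 0) (hL : L.re ≠ 0) (h : x = y * Complex.exp L)
    {m : ℤ} (hm : m ≠ 0) : x ^ m - y ^ m ≠ 0 := fun h0 => by
  rw [h, mul_zpow, ← Complex.exp_int_mul] at h0
  have h1 : Complex.exp (m * L) = 1 :=
    mul_left_cancel₀ (zpow_ne_zero m hy) (by rw [mul_one]; exact sub_eq_zero.mp h0)
  exact hm (Int.cast_eq_zero.mp (eq_zero_of_exp_mul_eq_one (Complex.intCast_im m) hL h1))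

/-- Scaling by `q_{1,1}⁻¹` makes `q_{1,1} = 1`, and `ε` selects the square root in the relation for
`q_{2,2} ^ 2`. The remaining `p`, `q` are then exponentials of multiples of `L`, so only the
exponents have to be compared. -/
lemma Relations.frame {L ξ ε : ℂ} {A0 qe pe : Matrix (Fin 2) (Fin 2) ℂ} (hR : P.Relations L)
    (hq : P.q 0 0 ≠ 0)
    (hw : ε * P.q 1 1 = P.q 0 0 * Complex.exp ((1 + P.A 0 1 0) / 2 * L))
    (hthird : ∀ j, P.p (Params.third j) j = P.q (Params.third j) j)
    (hA : ∀ i j, P.A i j 0 = A0 i j)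
    (q00 : qe 0 0 * ξ = 0) (q01 : qe 0 1 * ξ = L) (q10 : qe 1 0 * ξ = (1 + A0 0 1) / 2 * L)
    (q11 : qe 1 1 * ξ = (1 + A0 0 1) / 2 * L + L)
    (p00 : pe 0 0 * ξ = (A0 0 1 + A0 0 0) * L) (p01 : pe 0 1 * ξ = (1 + A0 0 1) * L)
    (p10 : pe 1 0 * ξ = ((1 + A0 0 1) / 2 - A0 0 1) * L)
    (p11 : pe 1 1 * ξ = ((1 + A0 0 1) / 2 - A0 0 1 + (1 - A0 1 1)) * L) :
    ((P.scaleVar (P.q 0 0)⁻¹).scaleSecond ε).Frame ξ A0 qe pe := by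
  have hs0 : P.q 1 0 = P.q 0 0 * Complex.exp L := hR.q_succ 0
  have hs1 : P.q 2 1 = P.q 1 1 * Complex.exp L := hR.q_succ 1
  have ht0 : P.p 1 0 = P.p 0 0 * Complex.exp ((1 - A0 0 0) * L) := hA 0 0 ▸ hR.p_succ 0
  have ht1 : P.p 2 1 = P.p 1 1 * Complex.exp ((1 - A0 1 1) * L) := hA 1 1 ▸ hR.p_succ 1
  have h11 := hR.p_one_one
  have h10 := hR.p_one_zero
  have hw' : ε * ((P.q 0 0)⁻¹ * P.q 1 1) = Complex.exp ((1 + A0 0 1) / 2 * L) := by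
    rw [hA] at hw
    rw [mul_left_comm, hw, inv_mul_cancel_left₀ hq]
  rw [hA] at h11 h10
  have hp11 : ε * ((P.q 0 0)⁻¹ * P.p 1 1) =
      Complex.exp (((1 + A0 0 1) / 2 - A0 0 1) * L) := by
    rw [sub_mul, sub_eq_add_neg, Complex.exp_add, ← hw', h11]
    ring
  have hp00 : (P.q 0 0)⁻¹ * P.p 0 0 = Complex.exp ((A0 0 1 + A0 0 0) * L) := by
    have h1 : P.p 0 0 * Complex.exp ((1 - A0 0 0) * L) =
        P.q 0 0 * Complex.exp L * Complex.exp (A0 0 1 * L) := by rw [← ht0, h10, hs0]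
    refine mul_right_cancel₀ (Complex.exp_ne_zero ((1 - A0 0 0) * L)) ?_
    rw [mul_assoc, h1, ← mul_assoc, ← mul_assoc, inv_mul_cancel₀ hq, one_mul, ← Complex.exp_add,
      ← Complex.exp_add]
    congr 1
    ring
  refine ⟨hA, ?_, ?_, ?_, ?_, fun j => ?_⟩
  · rw [Fin.forall_fin_two]
    simp only [xpow, q00, q10, Complex.exp_zero]
    exact ⟨inv_mul_cancel₀ hq, hw'⟩
  · rw [Fin.forall_fin_two]
    simp only [xpow, q01, q11, Complex.exp_add]
    refine ⟨?_, ?_⟩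
    · change (P.q 0 0)⁻¹ * P.q 1 0 = _
      rw [hs0, inv_mul_cancel_left₀ hq]
    · change ε * ((P.q 0 0)⁻¹ * P.q 2 1) = _
      rw [hs1, ← hw']
      ring
  · rw [Fin.forall_fin_two]
    simp only [xpow, p00, p10]
    exact ⟨hp00, hp11⟩
  · rw [Fin.forall_fin_two]
    simp only [xpow, p01, p11, add_mul _ (1 - A0 1 1), Complex.exp_add]
    refine ⟨?_, ?_⟩
    · change (P.q 0 0)⁻¹ * P.p 1 0 = _
      rw [h10, hs0, add_mul, one_mul, Complex.exp_add, mul_assoc, inv_mul_cancel_left₀ hq]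
    · change ε * ((P.q 0 0)⁻¹ * P.p 2 1) = _
      rw [ht1, ← hp11]
      ring
  · simp only [scaleSecond, scaleVar, hthird]

/-- The relations put `p`, `q`, `A(0)` into the frame of one of Cases 1, 2, 3; its blueprint then
determines everything else through `Eqs.normalize`. -/
theorem Eqs.isExplicit {ℓ : Fin 3 → Fin 2 → ℂ}
    (hE : P.Eqs fun j => ℓ j.succ j - ℓ j.castSucc j) (hP : P.IsHeisenberg) (hG : P.Generic)
    (hℓ : P.IsLogBranch ℓ)
    (hne : ∀ j : Fin 2, P.p j.castSucc j ≠ P.q j.castSucc j ∧ P.p j.succ j ≠ P.q j.succ j)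
    (hcase : ¬(P.A 0 0 0 = 1 ∧ P.A 1 1 0 ≠ 1)) : P.IsExplicit ℓ := by
  obtain ⟨hre, hLL, hR⟩ := hE.relations hP hG hne
    (fun j => by rw [Complex.exp_sub, hℓ.1, hℓ.1]) hℓ.2
  obtain ⟨hpq, -, -, hA, hsym, ha1, ha0⟩ := hG
  obtain ⟨a, ha⟩ : ∃ a : ℝ, P.A 0 1 0 = a :=
    ⟨(P.A 0 1 0).re, Complex.ext rfl (hA 0 1)⟩
  rw [ha, Complex.ofReal_re] at ha1 ha0
  have hr : 1 < P.rOf := by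
    rw [rOf, ha, Complex.ofReal_re]
    split_ifs
    · rw [← div_neg, lt_div_iff₀ (by linarith)]
      linarith
    · rw [lt_div_iff₀ (by linarith)]
      linarith
  set r := P.rOf with hrdef
  set ξ := P.xiOf ℓ with hξdef
  have hr0 : (r : ℂ) ≠ 0 := by exact_mod_cast (by linarith : r ≠ 0)
  have hL : ℓ 1 0 - ℓ 0 0 = 2 * r * ξ := by
    rw [hξdef, xiOf, ← hrdef]
    field_simp
  have hLj : (fun j : Fin 2 => ℓ j.succ j - ℓ j.castSucc j) = fun _ => 2 * r * ξ := by
    funext j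
    fin_cases j
    · exact hL
    · exact hLL.symm.trans hL
  have hL0 : ∀ j : Fin 2, ℓ j.succ j - ℓ j.castSucc j = 2 * r * ξ := congrFun hLj
  have hre0 : (2 * r * ξ).re ≠ 0 := hL0 0 ▸ hre 0
  have hξ : ξ.re ≠ 0 := fun h => hre0 (by
    rw [show (2 : ℂ) * r * ξ = ((2 * r : ℝ) : ℂ) * ξ by push_cast; ring, Complex.re_ofReal_mul, h,
      mul_zero])
  rw [hLj] at hE
  simp only [hL0] at hR
  have hq0 := (hpq 0 0).2
  -- Only the square of `q_{2,2}` is known; this sign is the transformation `S_2(w) ↦ S_2(-w)`.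
  obtain ⟨ε, hε, hw⟩ : ∃ ε : ℂ, (ε = 1 ∨ ε = -1) ∧
      ε * P.q 1 1 = P.q 0 0 * Complex.exp ((1 + P.A 0 1 0) / 2 * (2 * r * ξ)) := by
    have h1 : P.q 1 1 ^ 2 =
        (P.q 0 0 * Complex.exp ((1 + P.A 0 1 0) / 2 * (2 * r * ξ))) ^ 2 := by
      rw [hR.q_one_one, mul_pow, ← Complex.exp_nat_mul]
      congr 2
      push_cast
      ring
    rcases sq_eq_sq_iff_eq_or_eq_neg.mp h1 with h | h
    · exact ⟨1, Or.inl rfl, by rw [one_mul, h]⟩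
    · exact ⟨-1, Or.inr rfl, by rw [h]; ring⟩
  have hε0 : ε ≠ 0 := by rcases hε with rfl | rfl <;> norm_num
  have hσ : (P.q 0 0)⁻¹ ≠ 0 := inv_ne_zero hq0
  set P' := (P.scaleVar (P.q 0 0)⁻¹).scaleSecond ε with hP'
  have hE' : P'.Eqs fun _ => 2 * r * ξ := (hE.scaleVar hσ).scaleSecond hε
  have hq' : ∀ i j, P'.q i j ≠ 0 := fun i j => by
    simp only [hP', Params.scaleSecond, Params.scaleVar]
    split_ifs
    · exact mul_ne_zero hε0 (mul_ne_zero hσ (hpq i j).2)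
    · exact mul_ne_zero hσ (hpq i j).2
  have hp' : ∀ i j, P'.p i j ≠ 0 := fun i j => by
    simp only [hP', Params.scaleSecond, Params.scaleVar]
    split_ifs
    · exact mul_ne_zero hε0 (mul_ne_zero hσ (hpq i j).1)
    · exact mul_ne_zero hσ (hpq i j).1
  have hqs : ∀ j : Fin 2, P'.q j.succ j = P'.q j.castSucc j * Complex.exp (2 * r * ξ) := fun j => by
    simp only [hP', Params.scaleSecond, Params.scaleVar, hR.q_succ]
    split_ifs <;> ring
  have hdiff : ∀ j : Fin 2, ∀ m : ℤ, m ≠ 0 → P'.q j.succ j ^ m - P'.q j.castSucc j ^ m ≠ 0 :=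
    fun j m hm => zpow_sub_zpow_ne_zero (hq' _ _) hre0 (hqs j) hm
  have ha' : P.A 1 0 0 = a := hsym.symm.trans ha
  have hrc : (r : ℂ) + 1 ≠ 0 := by exact_mod_cast (by linarith : r + 1 ≠ 0)
  have hfr : ∀ A0 qe pe, _ := fun A0 qe pe => hR.frame (ξ := ξ) (A0 := A0) (qe := qe) (pe := pe)
    hq0 hw hE.third
  refine ⟨hr, hξ, (P.q 0 0)⁻¹, ε, ?_⟩
  by_cases h00 : P.A 0 0 0 = 1
  · have h11 : P.A 1 1 0 = 1 := by
      by_contra h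
      exact hcase ⟨h00, h⟩
    have har : (a : ℂ) = -(1 / r) := by
      have : a = -(1 / r) := by
        rw [hrdef, rOf, if_pos h00, ha, Complex.ofReal_re]
        simp
      rw [this]
      push_cast
      rfl
    have hF : P'.Frame ξ (zeroA3 r) (qExp3 r) (pExp3 r) := by
      refine hfr _ _ _ ?_ ?_ ?_ ?_ ?_ ?_ ?_ ?_ ?_
      · simp [Fin.forall_fin_two, zeroA3, h00, h11, ha, ha', har]
      all_goals
        simp [zeroA3, qExp3, pExp3]
        try field_simp
        try ring
    obtain ⟨α, b, h1, h2, h3, hC, hg, hfol, hZ⟩ :=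
      hE'.normalize (hF.blueprint3 hr hξ hq') hP hq' hp' hdiff
    refine ⟨α, b, hσ, hε, h1, h2, h3, fun h => absurd h00 h, fun h => absurd h00 h, fun _ _ => ?_⟩
    exact (solution3_iff hr hξ).mpr ⟨hC, hF.congr rfl rfl fun _ _ => rfl, hg, hfol, hZ⟩
  · have har : (a : ℂ) = -((r - 1) / r) := by
      have : a = -((r - 1) / r) := by
        have h1 : r = 1 / (a + 1) := by
          rw [hrdef, rOf, if_neg h00, ha, Complex.ofReal_re]
        have h2 : a + 1 ≠ 0 := by linarith
        rw [h1]
        field_simp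
        ring
      rw [this]
      push_cast
      rfl
    -- With `A_{1,2}(0) = -(r - 1) / r`, the alternative `-2 A_{1,2}(0)` of the dichotomy is the
    -- value in the formulas.
    have hboson {j : Fin 2} (h : P.A j j 0 ≠ 1) : P.A j j 0 = 2 * (r - 1) / r := by
      rw [(hR.A_diag j).resolve_left h, ha, har]
      ring
    by_cases h11 : P.A 1 1 0 = 1
    · have hF : P'.Frame ξ (zeroA2 r) (qExp r) (pExp2 r) := by
        refine hfr _ _ _ ?_ ?_ ?_ ?_ ?_ ?_ ?_ ?_ ?_
        · simp [Fin.forall_fin_two, zeroA2, hboson h00, h11, ha, ha', har]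
        all_goals
          simp [zeroA2, qExp, pExp2]
          try field_simp
          try ring
      obtain ⟨α, b, h1, h2, h3, hC, hg, hfol, hZ⟩ :=
        hE'.normalize (hF.blueprint2 hr hξ hq') hP hq' hp' hdiff
      refine ⟨α, b, hσ, hε, h1, h2, h3, fun _ h => absurd h11 h, fun _ _ => ?_,
        fun h => absurd h h00⟩
      exact (solution2_iff hr hξ).mpr ⟨hC, hF.congr rfl rfl fun _ _ => rfl, hg, hfol, hZ⟩
    · have hF : P'.Frame ξ (zeroA1 r) (qExp r) (pExp1 r) := by
        refine hfr _ _ _ ?_ ?_ ?_ ?_ ?_ ?_ ?_ ?_ ?_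
        · simp [Fin.forall_fin_two, zeroA1, hboson h00, hboson h11, ha, ha', har]
        all_goals
          simp [zeroA1, qExp, pExp1]
          try field_simp
          try ring
      obtain ⟨α, b, h1, h2, h3, hC, hg, hfol, hZ⟩ :=
        hE'.normalize (hF.blueprint1 hr hξ hq') hP hq' hp' hdiff
      refine ⟨α, b, hσ, hε, h1, h2, h3, fun _ _ => ?_, fun _ h => absurd h h11,
        fun h => absurd h h00⟩
      exact (solution1_iff hr hξ).mpr ⟨hC, hF.congr rfl rfl fun _ _ => rfl, hg, hfol, hZ⟩

end Params

/-! ### The main theorem -/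

theorem mainTheorem2 :
    (∀ (P : Params) (ℓ : Fin 3 → Fin 2 → ℂ) (B : Fin 2 → ℂ → Fock → Fock),
      P.IsHeisenberg → P.Generic → P.IsLogBranch ℓ →
      P.MutualLocality → P.Commutativity ℓ B → (∀ j, ∃ c v, B j c v ≠ 0) → P.Symmetry →
        B = P.current ℓ ∧
        (¬ (P.A 0 0 0 = 1 ∧ P.A 1 1 0 ≠ 1) → P.IsExplicit ℓ) ∧
        (P.A 0 0 0 = 1 ∧ P.A 1 1 0 ≠ 1 →
          (P.relabel Fin.revPerm Fin.revPerm).IsExplicit fun i j => ℓ i.rev j.rev)) ∧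
    (∀ (r : ℝ) (ξ : ℂ) (P : Params) (ℓ : Fin 3 → Fin 2 → ℂ), 1 < r → ξ.re ≠ 0 →
      (P.Solution1 r ξ ∨ P.Solution2 r ξ ∨ P.Solution3 r ξ) →
      (∀ i j, Complex.exp (ℓ i j) = P.q i j) →
      (∀ j : Fin 2, ℓ j.succ j - ℓ j.castSucc j = 2 * r * ξ) →
        P.IsHeisenberg ∧ P.MutualLocality ∧ P.Commutativity ℓ (P.current ℓ) ∧ P.Symmetry) := by
  refine ⟨fun P ℓ B hP hG hℓ hloc hcomm hB hsymm => ?_,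
    fun r ξ P ℓ hr hξ hS hℓ hL => Params.conditions_of_solution hr hξ hS hℓ hL⟩
  obtain ⟨hcur, hE, hne⟩ := Params.eqs_of_conditions hP hG hℓ hloc hcomm hB hsymm
  have hne' : ∀ j : Fin 2, P.p j.castSucc j ≠ P.q j.castSucc j ∧ P.p j.succ j ≠ P.q j.succ j :=
    fun j => (hne j).2.2
  refine ⟨hcur, hE.isExplicit hP hG hℓ hne', fun h4 => ?_⟩
  -- Case 4 becomes Case 2 after reversal, and every hypothesis used by the classification is stable
  -- under it.
  have hE' := hE.relabel
  refine Params.Eqs.isExplicit ?_ hP.relabel hG.relabel hℓ.relabel (fun j => ?_) fun h => h4.2 h.1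
  · convert hE' using 2 with j
    rw [Fin.rev_succ, Fin.rev_castSucc, neg_sub]
  · have := hne' j.rev
    simp only [Params.relabel, Fin.revPerm_apply, Fin.rev_castSucc, Fin.rev_succ]
    exact this.symm
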